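/- **Setting.** Consider LDPC codes over $\mathbb F_q$ with edge-perspective degree distribution pair $\lambda(x)=x$, $\rho(x)=\rho_\epsilon(x)=(1-\epsilon)x+\epsilon x^2$, $0<\epsilon\le 1$. So all $n$ variable nodes have degree $2$, and a fraction $1-\epsilon$ (resp. $\epsilon$) of the edges is attached to check nodes of degree $2$ (resp. $3$), up to a tolerance that tends to $0$ with $n\to\infty$. The edges connect the variable-node sockets to the check-node sockets by a uniformly random permutation. The edges carry arbitrary non-zero weights in $\mathbb F_q$ (for instance all $1$), and the code consists of the words whose weighted sum at each check node is zero. The *LMP threshold* of a pair $(\lambda,\rho)$ is $$p^*=\sup\{p\in(0,1] : p\,\lambda(1-\rho(1-x))<x\ \ \forall x\in(0,1]\},$$ and its *design rate* is $r=1-\int_0^1\rho\,\big/\int_0^1\lambda$. The $q$-ary symmetric channel with error rate $p$ leaves a symbol unchanged with probability $1-p$ and changes it to each of the other $q-1$ symbols with probability $p/(q-1)$. The *LMP decoder* with unbounded list size passes lists of candidate symbols, possibly marked as verified, along the edges; in the beginning each variable node sends the received symbol, unverified. The output of a check node on an edge is the list of all symbols that can satisfy the check, given the lists on its other edges, and is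 verified if and only if all of those are. The output of a variable node on an edge depends on the lists on its other edges and on the received symbol, which counts as an unverified one-element list. If some of these lists are verified, the output is verified with their common symbol, or is the unverified received symbol if they disagree. If none is verified and exactly one symbol appears on more than one list, the output is this symbol, verified; if no symbol does, it is the union of the lists; if several do, it is the unverified received symbol. After a chosen number $l$ of iterations the same rule, with all the incoming lists, is applied at every variable node; a node decodes to its verified symbol, and a node that is not verified counts as an error. The *symbol error rate* of a code for a transmitted codeword is the expected fraction of symbols in error. Running time counts field operations, symbol comparisons, list operations and message accesses as one step each. **Corollary.** 1. For $0<\epsilon\le1$ the pair $(\lambda,\rho_\epsilon)$ has LMP threshold $p^*=1-\frac{\epsilon}{1+\epsilon}$ and design rate $r>\frac{\epsilon}{3(1+\epsilon)}$. 2. For $0<\epsilon\le 1$ and every channel error rate $0\le p<p^*$, the ensemble achieves the rate $r$ with linear-time decoding for large $q$. That is, it contains codes of arbitrarily large block length, and for every $\eta>0$ there are $l$, $q_0$, $K$ such that for every finite field $\mathbb F_q$ with $q\ge q_0$: the LMP decoder with $l$ iterations takes at most $Kn$ steps on every code of length $n$ in the ensemble and every received word; and for every $\xi>0$, if $n$ is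 large enough and the degree fractions are close enough to $(\lambda,\rho_\epsilon)$, then for all edge weights every code of the ensemble has rate at least $r-\xi$, and with probability at least $1-\xi$ over the random code, the symbol error rate is less than $\eta$ for every transmitted codeword. 3. Therefore a rate of $\Theta(\delta)$ is achieved at channel error rate $p=1-\delta$: there are constants $c,C>0$ and a choice of $\epsilon=\epsilon(\delta)\in(0,1]$ such that, for every $\delta\in(0,1)$, the pair $(\lambda,\rho_{\epsilon(\delta)})$ has design rate $r$ with $c\,\delta\le r\le C\,\delta$ and threshold $p^*>1-\delta$, and it achieves the rate $r$ at channel error rate $1-\delta$ with linear-time decoding in the sense of part 2. -/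

import Mathlib

open Polynomial

/-! ### Degree distributions, threshold and design rate -/

/-- The threshold of the unbounded-list decoder for the edge-perspective degree distribution pair
`(L, R)`: the supremum of all `p ∈ (0, 1]` such that `p * L (1 - R (1 - x)) < x` on `(0, 1]`. -/
noncomputable def lmpThreshold (L R : ℝ[X]) : ℝ :=
  sSup {p : ℝ | p ∈ Set.Ioc (0 : ℝ) 1 ∧
    ∀ x ∈ Set.Ioc (0 : ℝ) 1, p * L.eval (1 - R.eval (1 - x)) < x}

/-- The design rate `1 - (∫₀¹ R) / (∫₀¹ L)` of the degree distribution pair `(L, R)`. -/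
noncomputable def designRate (L R : ℝ[X]) : ℝ :=
  1 - (∫ x in (0 : ℝ)..1, R.eval x) / (∫ x in (0 : ℝ)..1, L.eval x)

/-- The variable-node degree distribution `x`. -/
noncomputable def varDist : ℝ[X] := X

/-- The check-node degree distribution `(1 - ε) x + ε x ^ 2`. -/
noncomputable def checkDist (ε : ℝ) : ℝ[X] := C (1 - ε) * X + C ε * X ^ 2

/-- For a list of node degrees, the fraction of the edges that are attached to nodes of
degree `k`. -/
noncomputable def edgeFraction {n : ℕ} (d : Fin n → ℕ) (k : ℕ) : ℝ :=
  ((k * (Finset.univ.filter fun i => d i = k).card : ℕ) : ℝ) / ((∑ i, d i : ℕ) : ℝ)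

/-- The node degrees `dv` (of `n` variable nodes) and `dc` (of `m` check nodes) realize the pair
`(L, R)` up to `τ`: only degrees that occur in `L`, `R` are used, both sides have the same number
of edges, and the edge fractions differ from the coefficients of `L`, `R` by at most `τ`
(the coefficient of `x ^ k` belongs to the degree `k + 1`). The tolerance `τ` is needed
because `n` times a coefficient need not be an integer. -/
structure IsRealization (L R : ℝ[X]) (τ : ℝ) {n m : ℕ} (dv : Fin n → ℕ) (dc : Fin m → ℕ) :
    Prop where
  var_deg : ∀ i, ∃ k, dv i = k + 1 ∧ L.coeff k ≠ 0
  check_deg : ∀ j, ∃ k, dc j = k + 1 ∧ R.coeff k ≠ 0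
  edges_eq : ∑ i, dv i = ∑ j, dc j
  var_frac : ∀ k, |edgeFraction dv (k + 1) - L.coeff k| ≤ τ
  check_frac : ∀ k, |edgeFraction dc (k + 1) - R.coeff k| ≤ τ

/-! ### The code of a Tanner graph -/

/-- The sockets of nodes with degrees `d`: node `i` has `d i` of them. -/
abbrev Sockets {n : ℕ} (d : Fin n → ℕ) : Type := Σ i : Fin n, Fin (d i)

/-- A way to connect the variable sockets with the check sockets, that is, a Tanner multigraph
of the configuration model. Edges are identified with their variable sockets. -/
abbrev Wiring {n m : ℕ} (dv : Fin n → ℕ) (dc : Fin m → ℕ) : Type := Sockets dv ≃ Sockets dc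

/-- The linear code over `F` of a Tanner graph with non-zero edge weights `w`: at every check
node, the weighted sum of the adjacent symbols is zero. -/
def ldpcCode {F : Type} [Field F] {n m : ℕ} {dv : Fin n → ℕ} {dc : Fin m → ℕ}
    (σ : Wiring dv dc) (w : Sockets dv → Fˣ) : Submodule F (Fin n → F) where
  carrier := {x | ∀ j, ∑ k : Fin (dc j),
    (w (σ.symm ⟨j, k⟩) : F) * x (σ.symm ⟨j, k⟩).1 = 0}
  add_mem' := by
    intro x y hx hy j
    simp only [Pi.add_apply, mul_add, Finset.sum_add_distrib, hx j, hy j, add_zero]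
  zero_mem' := by
    intro j
    simp
  smul_mem' := by
    intro a x hx j
    simp only [Pi.smul_apply, smul_eq_mul, mul_left_comm _ a, ← Finset.mul_sum, hx j, mul_zero]

/-- The rate of a linear code of length `n`. -/
noncomputable def codeRate {F : Type} [Field F] {n : ℕ} (C : Submodule F (Fin n → F)) : ℝ :=
  (Module.finrank F C : ℝ) / n

open Classical in
/-- The probability of an event for a uniformly random wiring. -/
noncomputable def wiringProb {n m : ℕ} (dv : Fin n → ℕ) (dc : Fin m → ℕ)
    (A : Wiring dv dc → Prop) : ℝ :=
  ((Finset.univ.filter A).card : ℝ) / (Fintype.card (Wiring dv dc) : ℝ)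

/-! ### Computations with a step count -/

/-- A computation together with the number of elementary steps it takes. The model is a
unit-cost random access machine: a field operation, a comparison of two symbols, a list
operation on one symbol, reading or writing one message all cost one step. -/
structure Counted (α : Type) where
  val : α
  steps : ℕ

instance : Monad Counted where
  pure a := ⟨a, 0⟩
  bind x f := ⟨(f x.val).val, x.steps + (f x.val).steps⟩

/-- One elementary step. -/
def tick : Counted Unit := ⟨(), 1⟩

/-- Fill an array indexed by `ι`: the computations for all the entries are carried out one after
the other, and writing an entry costs one step. -/
def forAll {ι α : Type} [Fintype ι] (f : ι → Counted α) : Counted (ι → α) :=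
  ⟨fun i => (f i).val, ∑ i, ((f i).steps + 1)⟩

/-- Read the entries `f k` at the positions `k` that satisfy `keep`, at one step per position. -/
def collect {d : ℕ} {α : Type} (keep : Fin d → Bool) (f : Fin d → α) : Counted (List α) :=
  ⟨((List.finRange d).filter keep).map f, d⟩

section Lists

variable {F : Type} [DecidableEq F]

/-- Membership test by linear search. -/
def memC (a : F) : List F → Counted Bool
  | [] => pure false
  | b :: l => do
    tick
    if a = b then pure true else memC a l

/-- Insert a symbol in a list unless it is already there. -/
def insertC (a : F) (l : List F) : Counted (List F) := do
  if ← memC a l then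
    pure l
  else
    tick
    pure (a :: l)

/-- The list, without repetition, of all the sums `a + b` with `a` in `l₁` and `b` in `l₂`. -/
def sumsetC [Add F] (l₁ l₂ : List F) : Counted (List F) :=
  l₁.foldlM (fun acc a => l₂.foldlM (fun acc b => do
    tick
    insertC (a + b) acc) acc) []

end Lists

/-! ### The list-message-passing decoder with unbounded list size -/

/-- A message: a list of candidate symbols that is not verified, or a verified symbol. Without a
maximum list size no erasures arise. -/
inductive Msg (F : Type) : Type
  | unver (l : List F) : Msg F
  | ver (a : F) : Msg F

section Decoder

variable {F : Type} [Field F] [DecidableEq F]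

/-- The candidate symbols of a message. -/
def Msg.symbols : Msg F → List F
  | Msg.unver l => l
  | Msg.ver a => [a]

/-- Multiply all the candidates of a message by a field element. -/
def scaleMsg (a : F) : Msg F → Counted (Msg F)
  | Msg.ver b => do
    tick
    pure (Msg.ver (a * b))
  | Msg.unver l => ⟨Msg.unver (l.map fun b => a * b), l.length⟩

/-- The basic check-node operation: the sum is verified if and only if both summands are; its
candidates are all the sums of candidates. -/
def addMsg : Msg F → Msg F → Counted (Msg F)
  | Msg.ver a, Msg.ver b => do
    tick
    pure (Msg.ver (a + b))
  | m₁, m₂ => do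
    let l ← sumsetC m₁.symbols m₂.symbols
    pure (Msg.unver l)

/-- The check-node rule. Given the (weighted) messages on the other edges of the check node, the
output on an edge of weight `w` consists of the symbols that can satisfy the check, and is
verified if and only if all the inputs are. -/
def checkRule (w : F) (ms : List (F × Msg F)) : Counted (Msg F) := do
  let s ← ms.foldlM (fun acc wm => do
    let m ← scaleMsg wm.1 wm.2
    addMsg acc m) (Msg.ver 0)
  tick
  scaleMsg (-w⁻¹) s

/-- The list, without repetition, of the verified symbols among the messages `ms`. -/
def verifiedSymbols (ms : List (Msg F)) : Counted (List F) :=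
  ms.foldlM (fun acc m => do
    tick
    match m with
    | Msg.ver a => insertC a acc
    | Msg.unver _ => pure acc) []

/-- The first component is the union of `[y]` and of the candidate lists of `ms`, the second one
the list of the symbols that lie on more than one of these lists. (No list that the decoder
handles has repeated entries.) -/
def mergeLists (y : F) (ms : List (Msg F)) : Counted (List F × List F) :=
  ms.foldlM (fun acc m => do
    tick
    m.symbols.foldlM (fun (s : List F × List F) b => do
      if ← memC b s.1 then
        let r ← insertC b s.2
        pure (s.1, r)
      else
        tick
        pure (b :: s.1, s.2)) acc) ([y], [])

/-- The variable-node rule for the received symbol `y` and the incoming messages `ms`.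
* If there are verified inputs and they agree, the output is verified with their value; if they
  disagree, the output is the unverified received symbol.
* Otherwise, if exactly one symbol appears more than once among the input lists (one of which is
  the received symbol), the output is verified with this value. If no symbol does, the
  output is the union of the lists. If several symbols do, this is a disagreement again. -/
def varRule (y : F) (ms : List (Msg F)) : Counted (Msg F) := do
  let v ← verifiedSymbols ms
  match v with
  | [a] => pure (Msg.ver a)
  | _ :: _ :: _ => pure (Msg.unver [y])
  | [] =>
    let s ← mergeLists y ms
    match s.2 with
    | [] => pure (Msg.unver s.1)
    | [a] => pure (Msg.ver a)
    | _ :: _ :: _ => pure (Msg.unver [y])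

variable {n m : ℕ} {dv : Fin n → ℕ} {dc : Fin m → ℕ}

/-- All the messages from check nodes to variable nodes, given all the messages from variable nodes
to check nodes. Only the messages on the other edges of a check node are used. -/
def checkRound (σ : Wiring dv dc) (w : Sockets dv → Fˣ) (M : Sockets dv → Msg F) :
    Counted (Sockets dv → Msg F) :=
  forAll fun e => do
    let ms ← collect (fun k => decide (k ≠ (σ e).2)) fun k =>
      ((w (σ.symm ⟨(σ e).1, k⟩) : F), M (σ.symm ⟨(σ e).1, k⟩))
    checkRule (w e : F) ms

/-- All the messages from variable nodes to check nodes, given the received word `y` and all the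
messages from check nodes to variable nodes. Only the messages on the other edges of a
variable node are used. -/
def varRound (y : Fin n → F) (M : Sockets dv → Msg F) : Counted (Sockets dv → Msg F) :=
  forAll fun e => do
    let ms ← collect (fun k => decide (k ≠ e.2)) fun k => M ⟨e.1, k⟩
    varRule (y e.1) ms

/-- The messages from variable nodes to check nodes after `l` iterations. In the beginning every
variable node sends the received symbol. -/
def lmpMessages (σ : Wiring dv dc) (w : Sockets dv → Fˣ) (y : Fin n → F) :
    ℕ → Counted (Sockets dv → Msg F)
  | 0 => forAll fun e => pure (Msg.unver [y e.1])
  | l + 1 => do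
    let M ← lmpMessages σ w y l
    let M₁ ← checkRound σ w M
    varRound y M₁

/-- The decoder: `l` iterations of message passing, then the check-node messages are computed
once more and every variable node applies its rule to all its incoming messages. The output at a
node is the verified symbol, or `none` if the node is not verified. -/
def lmpDecode (σ : Wiring dv dc) (w : Sockets dv → Fˣ) (l : ℕ) (y : Fin n → F) :
    Counted (Fin n → Option F) := do
  let M ← lmpMessages σ w y l
  let M₁ ← checkRound σ w M
  forAll fun i => do
    let ms ← collect (fun _ => true) fun k => M₁ ⟨i, k⟩
    let r ← varRule (y i) ms
    match r with
    | Msg.ver a => pure (some a)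
    | Msg.unver _ => pure none

end Decoder

/-! ### The channel and the symbol error rate -/

/-- The probability that the `q`-ary symmetric channel with error probability `p` maps the
symbol `x` to the symbol `y`, where `q` is the number of elements of `F`. -/
noncomputable def qsc {F : Type} [Fintype F] [DecidableEq F] (p : ℝ) (x y : F) : ℝ :=
  if y = x then 1 - p else p / ((Fintype.card F : ℝ) - 1)

/-- The symbol error rate when the word `x` is sent over `n` uses of the channel: the expected
fraction of the positions at which the decoder (run for `l` iterations) does not output the
transmitted symbol. Unverified positions count as errors. -/
noncomputable def symbolErrorRate {F : Type} [Field F] [Fintype F] [DecidableEq F] {n m : ℕ}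
    {dv : Fin n → ℕ} {dc : Fin m → ℕ} (p : ℝ) (σ : Wiring dv dc) (w : Sockets dv → Fˣ) (l : ℕ)
    (x : Fin n → F) : ℝ :=
  ∑ y : Fin n → F, (∏ i, qsc p (x i) (y i)) *
    (((Finset.univ.filter fun i => (lmpDecode σ w l y).val i ≠ some (x i)).card : ℝ) / n)

/-- The ensemble `(L, R)` achieves the rate `r` on the `q`-ary symmetric channels with error
probability `p` and large `q`, with linear-time decoding.

The ensemble exists at arbitrarily large block lengths. For every `η > 0` there are a number `l`
of iterations, a bound `q₀` on the alphabet size and a constant `K`, such that for all fields with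
`q ≥ q₀` elements: the decoder takes at most `K * n` steps on every code of length `n` of the
ensemble and every received word; and for all `ξ > 0`, as soon as the block length is large
enough (and the degrees realize `(L, R)` closely enough), and whatever the non-zero edge
weights are, all the codes have rate at least `r - ξ`, and with probability at least `1 - ξ` the
random code has a symbol error rate below `η` for every transmitted codeword. -/
def AchievesInLinearTime (L R : ℝ[X]) (p r : ℝ) : Prop :=
  (∀ τ > (0 : ℝ), ∀ N : ℕ, ∃ n ≥ N, ∃ (m : ℕ) (dv : Fin n → ℕ) (dc : Fin m → ℕ),
    IsRealization L R τ dv dc) ∧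
  ∀ η > (0 : ℝ), ∃ l q₀ K : ℕ,
    ∀ (F : Type) [Field F] [Fintype F] [DecidableEq F], q₀ ≤ Fintype.card F →
      (∀ (τ : ℝ) (n m : ℕ) (dv : Fin n → ℕ) (dc : Fin m → ℕ), IsRealization L R τ dv dc →
        ∀ (σ : Wiring dv dc) (w : Sockets dv → Fˣ) (y : Fin n → F),
          (lmpDecode σ w l y).steps ≤ K * n) ∧
      ∀ ξ > (0 : ℝ), ∃ N : ℕ, ∃ τ > (0 : ℝ), ∀ n ≥ N,
        ∀ (m : ℕ) (dv : Fin n → ℕ) (dc : Fin m → ℕ), IsRealization L R τ dv dc →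
          ∀ w : Sockets dv → Fˣ,
            (∀ σ : Wiring dv dc, r - ξ ≤ codeRate (ldpcCode σ w)) ∧
            1 - ξ ≤ wiringProb dv dc fun σ =>
              ∀ x ∈ ldpcCode σ w, symbolErrorRate p σ w l x < η

set_option linter.unusedSectionVars false

/-! ### Indicators -/

/-! All variable nodes have degree two, so the decoder is governed by non-backtracking walks in the
Tanner graph. Call it a clash when a wrong symbol occurs by chance on two lists that are merged.
Without clashes every verified symbol is right, and a message lacks the transmitted symbol only if a
whole path of wrongly received symbols leads away from it (`sound_varMsg`, `mem_varMsg`). In a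
tree-like neighbourhood the received symbols along a path are independent, so a path with `l + 1`
nodes is wrong with probability `p ^ (l + 1)`. A walk branches at a random check node into about
`ρ'(1) = 1 + ε` continuations on average. The error probability is thus of order `(p * (1 + ε)) ^ (l
+ 1)`, and it tends to zero exactly below the threshold `1 / (1 + ε)`.

Clashes are rare for large `q`. The channel and the decoder commute with dilations centred at the
transmitted word, so all `q - 1` wrong symbols are equally likely to be on a given list
(`prob_mem_checkMsg_le`). The list lengths are bounded in terms of `l` alone, which gives clash
probabilities of order `1 / q` and also the linear running time with a constant independent of `q`.

For the random graph, exchanging the check sockets of two edges (`switching`) shows that the next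
check socket of a walk is nearly uniform. Hence the expected number of walks grows like a branching
process, and the expected number of walks that run into themselves stays bounded as `n` grows. The
number of walks is concentrated because one exchange affects boundedly many of them
(`variance_perm_le`, `card_deviation_le`). Concentration is needed because `l` is fixed before the
failure probability `ξ`. The typical event (`card_typical_ge`) speaks of the wiring only and
therefore serves all codewords and all edge weights at once.

The rate follows from counting check equations, and the last part from the choice `ε = δ`. -/

open Classical in
/-- The indicator of a proposition. -/
noncomputable def ind (P : Prop) : ℝ := if P then 1 else 0

lemma ind_of {P : Prop} (h : P) : ind P = 1 := if_pos h

lemma ind_of_not {P : Prop} (h : ¬P) : ind P = 0 := if_neg h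

lemma ind_nonneg (P : Prop) : 0 ≤ ind P := by
  by_cases h : P <;> simp [ind, h]

lemma ind_le_one (P : Prop) : ind P ≤ 1 := by
  by_cases h : P <;> simp [ind, h]

lemma ind_mono {P Q : Prop} (h : P → Q) : ind P ≤ ind Q := by
  by_cases hP : P
  · rw [ind_of hP, ind_of (h hP)]
  · rw [ind_of_not hP]; exact ind_nonneg Q

lemma ind_congr {P Q : Prop} (h : P ↔ Q) : ind P = ind Q := by rw [propext h]

lemma ind_and (P Q : Prop) : ind (P ∧ Q) = ind P * ind Q := by
  by_cases hP : P <;> by_cases hQ : Q <;> simp [ind, hP, hQ]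

lemma ind_le_add {P Q R : Prop} (h : P → Q ∨ R) : ind P ≤ ind Q + ind R := by
  by_cases hP : P
  · rcases h hP with hQ | hR
    · rw [ind_of hP, ind_of hQ]; linarith [ind_nonneg R]
    · rw [ind_of hP, ind_of hR]; linarith [ind_nonneg Q]
  · rw [ind_of_not hP]; linarith [ind_nonneg Q, ind_nonneg R]

lemma ind_le_sum {ι : Type*} {s : Finset ι} {P : Prop} {f : ι → ℝ} (hf : ∀ i ∈ s, 0 ≤ f i)
    (h : P → ∃ i ∈ s, 1 ≤ f i) : ind P ≤ ∑ i ∈ s, f i := by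
  by_cases hP : P
  · obtain ⟨i, hi, hi1⟩ := h hP
    rw [ind_of hP]
    exact hi1.trans (Finset.single_le_sum hf hi)
  · rw [ind_of_not hP]; exact Finset.sum_nonneg hf

lemma sum_ind_eq_card {ι : Type*} [Fintype ι] (P : ι → Prop) [DecidablePred P] :
    ∑ i, ind (P i) = ((Finset.univ.filter P).card : ℝ) := by
  rw [Finset.card_filter]
  push_cast
  refine Finset.sum_congr rfl fun i _ => ?_
  by_cases h : P i <;> simp [ind, h]

lemma sum_ind_le_card {ι : Type*} [Fintype ι] [DecidableEq ι] {P : ι → Prop} (s : Finset ι)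
    (h : ∀ i, P i → i ∈ s) : ∑ i, ind (P i) ≤ (s.card : ℝ) := by
  classical
  rw [sum_ind_eq_card]
  exact_mod_cast Finset.card_le_card fun i hi => h i (Finset.mem_filter.1 hi).2

/-! ### Walks in a Tanner graph with variable nodes of degree two -/

section Walks

open Finset

variable {S T J : Type}

/-- The finite set of the lists of length `t` over a finite type. -/
def listsOfLength (S : Type) [Fintype S] : ℕ → Finset (List S)
  | 0 => {[]}
  | t + 1 => (univ ×ˢ listsOfLength S t).map
      ⟨fun p : S × List S => p.1 :: p.2, fun p q h => by
        simp only [List.cons.injEq] at h; exact Prod.ext h.1 h.2⟩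

lemma mem_listsOfLength [Fintype S] (t : ℕ) (l : List S) :
    l ∈ listsOfLength S t ↔ l.length = t := by
  induction t generalizing l with
  | zero => simp [listsOfLength]
  | succ t ih =>
    cases l with
    | nil => simp [listsOfLength]
    | cons a l =>
      rw [listsOfLength, mem_map, List.length_cons, Nat.add_right_cancel_iff, ← ih]
      constructor
      · rintro ⟨⟨b, m⟩, hm, h⟩
        obtain ⟨-, rfl⟩ := List.cons.inj h
        exact (mem_product.1 hm).2
      · exact fun h => ⟨(a, l), mem_product.2 ⟨mem_univ _, h⟩, rfl⟩

lemma sum_listsOfLength_succ [Fintype S] (t : ℕ) (g : List S → ℝ) :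
    ∑ w ∈ listsOfLength S (t + 1), g w = ∑ e, ∑ l ∈ listsOfLength S t, g (e :: l) := by
  rw [listsOfLength, sum_map, sum_product]
  rfl

variable (opp : S → S) (κ : T → J)

/-- One step of a non-backtracking walk: from the variable socket `e`, walk through the node to
its other socket, and then through the check node there to a further socket `f`. -/
def Step (σ : S ≃ T) (e f : S) : Prop := κ (σ f) = κ (σ (opp e)) ∧ f ≠ opp e

/-- A non-backtracking walk; the list starts with the last socket. -/
def IsWalk (σ : S ≃ T) (w : List S) : Prop := w.IsChain fun f e => Step opp κ σ e f

/-- The walk never leaves a variable node towards a check node it has already seen. -/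
def NoCollision (σ : S ≃ T) : List S → Prop
  | [] => True
  | e :: l => κ (σ (opp e)) ∉ (e :: l).map (fun x => κ (σ x)) ∧ NoCollision σ l

variable {opp κ} {σ : S ≃ T}

lemma isWalk_cons_cons {f e : S} {l : List S} :
    IsWalk opp κ σ (f :: e :: l) ↔ Step opp κ σ e f ∧ IsWalk opp κ σ (e :: l) :=
  List.isChain_cons_cons

lemma isWalk_singleton (e : S) : IsWalk opp κ σ [e] := List.isChain_singleton _

lemma IsWalk.tail {e : S} {l : List S} (h : IsWalk opp κ σ (e :: l)) : IsWalk opp κ σ l :=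
  List.IsChain.tail h

lemma step_reverse (hopp : ∀ e, opp (opp e) = e) {e f : S} (h : Step opp κ σ e f) :
    Step opp κ σ (opp f) (opp e) := by
  refine ⟨?_, fun h' => h.2 ?_⟩
  · rw [hopp, h.1]
  · rw [hopp] at h'; exact h'.symm

/-- Read backwards, a walk enters each variable node through the socket by which it used to leave,
hence the `opp`. This serves to glue two walks that leave a node in opposite directions. -/
lemma IsWalk.reverse (hopp : ∀ e, opp (opp e) = e) {w : List S} (h : IsWalk opp κ σ w) :
    IsWalk opp κ σ (w.reverse.map opp) := by
  rw [IsWalk, List.isChain_map, List.isChain_reverse]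
  exact List.IsChain.imp (fun _ _ h' => step_reverse hopp h') h

/-- The witness is the socket visited right after `x`. -/
lemma IsWalk.exists_succ {d : S} {l : List S} (h : IsWalk opp κ σ (d :: l)) {x : S}
    (hx : x ∈ l) : ∃ z ∈ d :: l, κ (σ z) = κ (σ (opp x)) := by
  induction l generalizing d with
  | nil => simp at hx
  | cons e l ih =>
    rw [isWalk_cons_cons] at h
    rcases List.mem_cons.1 hx with rfl | hx
    · exact ⟨d, by simp, h.1.1⟩
    · obtain ⟨z, hz, hz'⟩ := ih h.2 hx
      exact ⟨z, List.mem_cons_of_mem _ hz, hz'⟩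

/-- The socket `e` sits at the check node behind its predecessor, and no socket of `l` sits there.
-/
lemma IsWalk.notMem_of_noCollision {e : S} {l : List S} (h : IsWalk opp κ σ (e :: l))
    (hl : NoCollision opp κ σ l) : e ∉ l := by
  cases l with
  | nil => simp
  | cons d l =>
    intro he
    rw [isWalk_cons_cons] at h
    refine hl.1 ?_
    rw [← h.1.1]
    exact List.mem_map_of_mem (f := fun x => κ (σ x)) he

/-- Had the walk traversed this node before, entering by `opp e`, it would have gone on to the check
node of `e`, which is the one behind the predecessor of `e`; an immediate return is excluded by
`Step`. Together with `notMem_of_noCollision` this shows that the walk has not yet used the value of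
`σ` at `opp e`. -/
lemma IsWalk.opp_notMem_of_noCollision (hopp : ∀ e, opp (opp e) = e) (hfix : ∀ e, opp e ≠ e)
    {e : S} {l : List S} (h : IsWalk opp κ σ (e :: l)) (hl : NoCollision opp κ σ l) :
    opp e ∉ e :: l := by
  rw [List.mem_cons, not_or]
  refine ⟨hfix e, ?_⟩
  cases l with
  | nil => simp
  | cons d l =>
    intro he
    rw [isWalk_cons_cons] at h
    rcases List.mem_cons.1 he with he | he
    · exact h.1.2 (by rw [← he, hopp])
    · obtain ⟨z, hz, hz'⟩ := h.2.exists_succ he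
      refine hl.1 ?_
      rw [← h.1.1, ← hopp e, ← hz']
      exact List.mem_map_of_mem (f := fun x => κ (σ x)) hz

/-! ### Switching two edges -/

lemma agree_of_notMem [DecidableEq S] {σ : S ≃ T} {a b x : S} (ha : x ≠ a) (hb : x ≠ b) :
    ((Equiv.swap a b).trans σ) x = σ x := by
  simp [Equiv.swap_apply_of_ne_of_ne ha hb]

/-- The walk does not look behind its last socket `e`, so opposite sockets matter only for `l`. This
is the freedom that `switching` exploits. -/
lemma isWalk_congr {σ σ' : S ≃ T} {e : S} {l : List S} (h : ∀ x ∈ e :: l, σ' x = σ x)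
    (h' : ∀ x ∈ l, σ' (opp x) = σ (opp x)) (hw : IsWalk opp κ σ (e :: l)) :
    IsWalk opp κ σ' (e :: l) := by
  induction l generalizing e with
  | nil => exact isWalk_singleton e
  | cons d l ih =>
    rw [isWalk_cons_cons] at hw ⊢
    refine ⟨⟨?_, hw.1.2⟩, ih (fun x hx => h x (List.mem_cons_of_mem _ hx))
      (fun x hx => h' x (List.mem_cons_of_mem _ hx)) hw.2⟩
    rw [h e (by simp), h' d (by simp), hw.1.1]

lemma noCollision_congr {σ σ' : S ≃ T} {l : List S} (h : ∀ x ∈ l, σ' x = σ x)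
    (h' : ∀ x ∈ l, σ' (opp x) = σ (opp x)) (hw : NoCollision opp κ σ l) :
    NoCollision opp κ σ' l := by
  induction l with
  | nil => trivial
  | cons d l ih =>
    refine ⟨?_, ih (fun x hx => h x (List.mem_cons_of_mem _ hx))
      (fun x hx => h' x (List.mem_cons_of_mem _ hx)) hw.2⟩
    have : (d :: l).map (fun x => κ (σ' x)) = (d :: l).map (fun x => κ (σ x)) :=
      List.map_congr_left fun x hx => by rw [h x hx]
    rw [this, h' d (by simp)]
    exact hw.1

variable [DecidableEq S] [Fintype S] [Fintype T] [DecidableEq T]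

/-- Summed over all wirings, replacing the check socket that follows a walk without collisions
by a uniformly random check socket does not change much. -/
lemma switching (hopp : ∀ e, opp (opp e) = e) (hfix : ∀ e, opp e ≠ e) (t : ℕ)
    (Φ : List J → T → ℝ) (hΦ : ∀ l c, 0 ≤ Φ l c) :
    (∑ σ : S ≃ T, ∑ e, ∑ l ∈ listsOfLength S t,
      ind (IsWalk opp κ σ (e :: l) ∧ NoCollision opp κ σ l) *
        Φ ((e :: l).map fun x => κ (σ x)) (σ (opp e))) * (Fintype.card S - (2 * t + 1)) ≤
    ∑ σ : S ≃ T, ∑ e, ∑ l ∈ listsOfLength S t,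
      ind (IsWalk opp κ σ (e :: l) ∧ NoCollision opp κ σ l) *
        ∑ c, Φ ((e :: l).map fun x => κ (σ x)) c := by
  have key : ∀ e : S, ∀ l ∈ listsOfLength S t,
      (∑ σ : S ≃ T, ind (IsWalk opp κ σ (e :: l) ∧ NoCollision opp κ σ l) *
        Φ ((e :: l).map fun x => κ (σ x)) (σ (opp e))) * (Fintype.card S - (2 * t + 1)) ≤
      ∑ σ : S ≃ T, ind (IsWalk opp κ σ (e :: l) ∧ NoCollision opp κ σ l) *
        ∑ c, Φ ((e :: l).map fun x => κ (σ x)) c := by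
    intro e l hl
    rw [mem_listsOfLength] at hl
    -- The walk reads `σ` at the `t + 1` sockets of `e :: l` and at the `t` sockets opposite to `l`.
    -- Any other `f` may exchange its check socket with `opp e`.
    set F : Finset S := univ \ ((e :: l) ++ l.map opp).toFinset with hF
    have hcard : (Fintype.card S : ℝ) - (2 * t + 1) ≤ (F.card : ℝ) := by
      have h1 := Finset.le_card_sdiff ((e :: l) ++ l.map opp).toFinset (univ : Finset S)
      have h2 := List.toFinset_card_le ((e :: l) ++ l.map opp)
      have h3 : ((e :: l) ++ l.map opp).length = 2 * t + 1 := by simp [hl]; ring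
      rw [card_univ] at h1
      have h4 : Fintype.card S ≤ F.card + (2 * t + 1) := by rw [hF]; omega
      have h5 : (Fintype.card S : ℝ) ≤ F.card + (2 * t + 1) := by exact_mod_cast h4
      linarith
    have hterm : ∀ f ∈ F, ∑ σ : S ≃ T, ind (IsWalk opp κ σ (e :: l) ∧ NoCollision opp κ σ l) *
        Φ ((e :: l).map fun x => κ (σ x)) (σ (opp e)) ≤
        ∑ σ : S ≃ T, ind (IsWalk opp κ σ (e :: l) ∧ NoCollision opp κ σ l) *
        Φ ((e :: l).map fun x => κ (σ x)) (σ f) := by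
      intro f hf
      rw [hF, mem_sdiff, List.mem_toFinset, List.mem_append, not_or] at hf
      let E : (S ≃ T) ≃ (S ≃ T) := Equiv.equivCongr (Equiv.swap (opp e) f) (Equiv.refl T)
      rw [← Equiv.sum_comp E (fun σ : S ≃ T =>
        ind (IsWalk opp κ σ (e :: l) ∧ NoCollision opp κ σ l) *
        Φ ((e :: l).map fun x => κ (σ x)) (σ f))]
      refine sum_le_sum fun σ _ => ?_
      by_cases hw : IsWalk opp κ σ (e :: l) ∧ NoCollision opp κ σ l
      · have hE : E σ = (Equiv.swap (opp e) f).trans σ := by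
          ext x; simp [E, Equiv.equivCongr]
        -- Since `opp e` is not read either, the exchange preserves the walk, the absence of
        -- collisions and all the check nodes met, while `f` receives the old check socket of `opp
        -- e`.
        have ho := hw.1.opp_notMem_of_noCollision hopp hfix hw.2
        have hn := hw.1.notMem_of_noCollision hw.2
        have h1 : ∀ x ∈ e :: l, (E σ) x = σ x := fun x hx => by
          rw [hE]
          exact agree_of_notMem (fun h => ho (h ▸ hx)) (fun h => hf.2.1 (h ▸ hx))
        have h2 : ∀ x ∈ l, (E σ) (opp x) = σ (opp x) := fun x hx => by
          rw [hE]
          refine agree_of_notMem (fun h => hn ?_) (fun h => hf.2.2 ?_)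
          · rw [← hopp e, ← h, hopp]; exact hx
          · rw [← h]; exact List.mem_map_of_mem hx
        have h3 : ((e :: l).map fun x => κ ((E σ) x)) = (e :: l).map fun x => κ (σ x) :=
          List.map_congr_left fun x hx => by rw [h1 x hx]
        have h4 : (E σ) f = σ (opp e) := by rw [hE]; simp
        rw [h3, h4, ind_of hw, ind_of ⟨isWalk_congr h1 h2 hw.1, noCollision_congr
          (fun x hx => h1 x (List.mem_cons_of_mem _ hx)) h2 hw.2⟩]
      · rw [ind_of_not hw, zero_mul]
        exact mul_nonneg (ind_nonneg _) (hΦ _ _)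
    calc _ ≤ (∑ σ : S ≃ T, ind (IsWalk opp κ σ (e :: l) ∧ NoCollision opp κ σ l) *
          Φ ((e :: l).map fun x => κ (σ x)) (σ (opp e))) * F.card :=
          mul_le_mul_of_nonneg_left hcard
            (sum_nonneg fun σ _ => mul_nonneg (ind_nonneg _) (hΦ _ _))
      _ = ∑ f ∈ F, ∑ σ : S ≃ T, ind (IsWalk opp κ σ (e :: l) ∧ NoCollision opp κ σ l) *
          Φ ((e :: l).map fun x => κ (σ x)) (σ (opp e)) := by
          rw [sum_const, nsmul_eq_mul, mul_comm]
      _ ≤ ∑ f ∈ F, ∑ σ : S ≃ T, ind (IsWalk opp κ σ (e :: l) ∧ NoCollision opp κ σ l) *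
          Φ ((e :: l).map fun x => κ (σ x)) (σ f) := sum_le_sum hterm
      _ ≤ ∑ f, ∑ σ : S ≃ T, ind (IsWalk opp κ σ (e :: l) ∧ NoCollision opp κ σ l) *
          Φ ((e :: l).map fun x => κ (σ x)) (σ f) :=
          sum_le_sum_of_subset_of_nonneg (subset_univ _) fun f _ _ =>
            sum_nonneg fun σ _ => mul_nonneg (ind_nonneg _) (hΦ _ _)
      _ = _ := by
          rw [sum_comm]
          refine sum_congr rfl fun σ _ => ?_
          rw [← mul_sum, Equiv.sum_comp σ]
  have swap3 : ∀ g : (S ≃ T) → S → List S → ℝ, ∑ σ, ∑ e, ∑ l ∈ listsOfLength S t, g σ e l =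
      ∑ e, ∑ l ∈ listsOfLength S t, ∑ σ, g σ e l := by
    intro g
    rw [sum_comm]
    exact sum_congr rfl fun e _ => sum_comm
  rw [swap3, swap3, sum_mul]
  refine sum_le_sum fun e _ => ?_
  rw [sum_mul]
  exact sum_le_sum fun l hl => key e l hl

end Walks

/-! ### Expected numbers of walks and of collisions in a random wiring -/

section WalkCounts

open Finset

variable {S T J : Type} [Fintype S] [DecidableEq S] [Fintype T] [DecidableEq T]
variable (opp : S → S) (κ : T → J)

/-- The number of further sockets at the node of a check socket. -/
noncomputable def siblings (c : T) : ℝ := ∑ c', ind (κ c' = κ c ∧ c' ≠ c)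

/-- The number of walks with `t` steps. -/
noncomputable def walkCount (σ : S ≃ T) (t : ℕ) : ℝ :=
  ∑ e, ∑ l ∈ listsOfLength S t, ind (IsWalk opp κ σ (e :: l))

/-- The number of walks with `t` steps the first `t - 1` of which are without collision. -/
noncomputable def simpleCount (σ : S ≃ T) (t : ℕ) : ℝ :=
  ∑ e, ∑ l ∈ listsOfLength S t, ind (IsWalk opp κ σ (e :: l) ∧ NoCollision opp κ σ l)

/-- The number of walks with `t` steps that have a collision. -/
noncomputable def badCount (σ : S ≃ T) (t : ℕ) : ℝ :=
  ∑ e, ∑ l ∈ listsOfLength S t, ind (IsWalk opp κ σ (e :: l) ∧ ¬NoCollision opp κ σ (e :: l))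

/-- The number of walks with `t` steps whose first collision is at the end. -/
noncomputable def firstCount (σ : S ≃ T) (t : ℕ) : ℝ :=
  ∑ e, ∑ l ∈ listsOfLength S t, ind (IsWalk opp κ σ (e :: l) ∧ NoCollision opp κ σ l) *
    ind (κ (σ (opp e)) ∈ (e :: l).map fun x => κ (σ x))

variable {opp κ} {σ : S ≃ T}

lemma siblings_nonneg (c : T) : 0 ≤ siblings κ c := sum_nonneg fun _ _ => ind_nonneg _

lemma sum_step (e : S) : ∑ f, ind (Step opp κ σ e f) = siblings κ (σ (opp e)) := by
  rw [siblings, ← Equiv.sum_comp σ]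
  exact sum_congr rfl fun f _ => ind_congr (by simp [Step])

/-- Extending each walk by one more step. -/
lemma sum_extend_le {Δ : ℝ} (hΔ : ∀ c, siblings κ c ≤ Δ) (t : ℕ) (P : List S → Prop) :
    ∑ f, ∑ w ∈ listsOfLength S (t + 1), ind (IsWalk opp κ σ (f :: w) ∧ P w) ≤
      Δ * ∑ e, ∑ l ∈ listsOfLength S t, ind (IsWalk opp κ σ (e :: l) ∧ P (e :: l)) := by
  simp_rw [sum_listsOfLength_succ, mul_sum]
  rw [sum_comm]
  refine sum_le_sum fun e _ => ?_
  rw [sum_comm]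
  refine sum_le_sum fun l _ => ?_
  have : ∀ f, ind (IsWalk opp κ σ (f :: e :: l) ∧ P (e :: l)) =
      ind (Step opp κ σ e f) * ind (IsWalk opp κ σ (e :: l) ∧ P (e :: l)) := fun f => by
    rw [← ind_and, isWalk_cons_cons, and_assoc]
  simp_rw [this, ← sum_mul, sum_step]
  exact mul_le_mul_of_nonneg_right (hΔ _) (ind_nonneg _)

lemma badCount_zero_le : badCount opp κ σ 0 ≤ firstCount opp κ σ 0 := by
  refine sum_le_sum fun e _ => sum_le_sum fun l hl => ?_
  rw [← ind_and]
  refine ind_mono fun h => ⟨⟨h.1, ?_⟩, ?_⟩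
  · rw [mem_listsOfLength, List.length_eq_zero_iff] at hl
    rw [hl]; trivial
  · by_contra h'
    refine h.2 ⟨h', ?_⟩
    rw [mem_listsOfLength, List.length_eq_zero_iff] at hl
    rw [hl]; trivial

/-- Either the first collision is at the last socket, or it is present before the last step, which
can be chosen in at most `Δ` ways. -/
lemma badCount_succ_le {Δ : ℝ} (hΔ : ∀ c, siblings κ c ≤ Δ) (t : ℕ) :
    badCount opp κ σ (t + 1) ≤ firstCount opp κ σ (t + 1) + Δ * badCount opp κ σ t := by
  refine le_trans ?_ (add_le_add_right (sum_extend_le hΔ t fun w => ¬NoCollision opp κ σ w) _)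
  simp_rw [badCount, firstCount, ← sum_add_distrib]
  refine sum_le_sum fun e _ => sum_le_sum fun l _ => ?_
  rw [← ind_and]
  refine ind_le_add fun h => ?_
  by_cases hl : NoCollision opp κ σ l
  · left
    refine ⟨⟨h.1, hl⟩, ?_⟩
    by_contra h'
    exact h.2 ⟨h', hl⟩
  · exact Or.inr ⟨h.1, hl⟩

/-- Walks with an early collision are so few that the crude factor `Δ` for their extensions is
harmless; the sharp branching factor is only needed for the others. -/
lemma walkCount_succ_le {Δ : ℝ} (hΔ : ∀ c, siblings κ c ≤ Δ) (t : ℕ) :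
    walkCount opp κ σ (t + 1) ≤ simpleCount opp κ σ (t + 1) + Δ * badCount opp κ σ t := by
  refine le_trans ?_ (add_le_add_right (sum_extend_le hΔ t fun w => ¬NoCollision opp κ σ w) _)
  simp_rw [walkCount, simpleCount, ← sum_add_distrib]
  refine sum_le_sum fun e _ => sum_le_sum fun l _ => ind_le_add fun h => ?_
  by_cases hl : NoCollision opp κ σ l
  · exact Or.inl ⟨h, hl⟩
  · exact Or.inr ⟨h, hl⟩

/-- The last step is summed out; the number of ways to make it depends only on the check socket
behind the shorter walk, which is the quantity that `switching` randomizes. -/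
lemma simpleCount_succ_le (t : ℕ) :
    simpleCount opp κ σ (t + 1) ≤ ∑ e, ∑ l ∈ listsOfLength S t,
      ind (IsWalk opp κ σ (e :: l) ∧ NoCollision opp κ σ l) * siblings κ (σ (opp e)) := by
  simp_rw [simpleCount, sum_listsOfLength_succ]
  rw [sum_comm]
  refine sum_le_sum fun e _ => ?_
  rw [sum_comm]
  refine sum_le_sum fun l _ => ?_
  rw [← sum_step (σ := σ), mul_sum]
  refine sum_le_sum fun f _ => ?_
  rw [← ind_and]
  refine ind_mono fun h => ?_
  rw [isWalk_cons_cons] at h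
  exact ⟨⟨h.1.2, h.2.2⟩, h.1.1⟩

/-- The sum over all wirings. -/
noncomputable def total (f : (S ≃ T) → ℝ) : ℝ := ∑ σ : S ≃ T, f σ

/-- The expected number of walks without collisions grows like a branching process. -/
lemma total_simpleCount_le (hopp : ∀ e, opp (opp e) = e) (hfix : ∀ e, opp e ≠ e) {ρ : ℝ}
    (hρ : 0 ≤ ρ) (K : ℕ) (hK : (2 * K + 1 : ℝ) < Fintype.card S)
    (h : ∑ c, siblings κ c ≤ ρ * (Fintype.card S - (2 * K + 1))) (t : ℕ) (ht : t ≤ K) :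
    total (simpleCount opp κ · t) ≤
      Fintype.card S * ρ ^ t * (Fintype.card (S ≃ T) : ℝ) := by
  induction t with
  | zero =>
    have : ∀ σ : S ≃ T, simpleCount opp κ σ 0 ≤ Fintype.card S := fun σ => by
      have : simpleCount opp κ σ 0 ≤ ∑ e : S, (1 : ℝ) := by
        refine sum_le_sum fun e _ => ?_
        simp only [listsOfLength, sum_singleton]
        exact ind_le_one _
      simpa using this
    calc total (simpleCount opp κ · 0) ≤ ∑ _σ : S ≃ T, (Fintype.card S : ℝ) :=
          sum_le_sum fun σ _ => this σ
      _ = _ := by rw [sum_const, card_univ, nsmul_eq_mul]; ring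
  | succ t ih =>
    have ih := ih (by omega)
    -- With the number of siblings as `Φ`, the next step branches like a uniformly random check
    -- socket.
    have hsw := switching (κ := κ) (S := S) hopp hfix t (fun _ c => siblings κ c)
      (fun _ c => siblings_nonneg c)
    have htK : (t : ℝ) + 1 ≤ K := by exact_mod_cast ht
    have hpos : (0 : ℝ) < Fintype.card S - (2 * t + 1) := by linarith
    have h1 : total (simpleCount opp κ · (t + 1)) * (Fintype.card S - (2 * t + 1)) ≤
        (∑ c, siblings κ c) * total (simpleCount opp κ · t) := by
      refine le_trans (mul_le_mul_of_nonneg_right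
        (sum_le_sum fun σ _ => simpleCount_succ_le t) hpos.le) (hsw.trans (le_of_eq ?_))
      rw [mul_comm]
      simp_rw [total, simpleCount, ← sum_mul]
    have hS : 0 ≤ total (simpleCount (S := S) opp κ · t) := sum_nonneg fun σ _ =>
      sum_nonneg fun _ _ => sum_nonneg fun _ _ => ind_nonneg _
    have h2 : (∑ c, siblings κ c) ≤ ρ * (Fintype.card S - (2 * t + 1)) :=
      h.trans (mul_le_mul_of_nonneg_left (by linarith) hρ)
    have h3 : total (simpleCount opp κ · (t + 1)) * (Fintype.card S - (2 * t + 1)) ≤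
        (ρ * total (simpleCount opp κ · t)) * (Fintype.card S - (2 * t + 1)) := by
      refine h1.trans ((mul_le_mul_of_nonneg_right h2 hS).trans (le_of_eq (by ring)))
    refine (le_of_mul_le_mul_right h3 hpos).trans ?_
    calc _ ≤ ρ * (Fintype.card S * ρ ^ t * (Fintype.card (S ≃ T) : ℝ)) :=
          mul_le_mul_of_nonneg_left ih hρ
      _ = _ := by ring

/-- After switching, the check socket behind the walk is nearly uniform, and at most `(t + 1) * (Δ +
1)` check sockets belong to check nodes already met. The resulting probability, inversely
proportional to the number of sockets, cancels the number of walks, so the bound is independent of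
the size of the graph. -/
lemma total_firstCount_le (hopp : ∀ e, opp (opp e) = e) (hfix : ∀ e, opp e ≠ e) {Δ : ℝ}
    (hΔ0 : 0 ≤ Δ) (hΔ : ∀ c, siblings κ c ≤ Δ) (K : ℕ)
    (hK : 2 * (2 * K + 1 : ℝ) ≤ Fintype.card S) (hST : Fintype.card S = Fintype.card T)
    (t : ℕ) (ht : t ≤ K) :
    total (firstCount (S := S) opp κ · t) ≤
      2 * (Δ + 1) * (t + 1) * (2 * Δ) ^ t * (Fintype.card (S ≃ T) : ℝ) := by
  have hK0 : (0 : ℝ) ≤ K := K.cast_nonneg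
  have htK : (t : ℝ) ≤ K := by exact_mod_cast ht
  -- The graph is at least twice as large as the excluded part, so `2 * Δ` is an admissible, though
  -- crude, branching factor.
  have hD : ∑ c, siblings κ c ≤ 2 * Δ * (Fintype.card S - (2 * K + 1)) := by
    calc ∑ c, siblings κ c ≤ ∑ _c : T, Δ := sum_le_sum fun c _ => hΔ c
      _ = Δ * Fintype.card S := by rw [sum_const, card_univ, nsmul_eq_mul, hST, mul_comm]
      _ ≤ Δ * (2 * (Fintype.card S - (2 * K + 1))) := by gcongr; linarith
      _ = _ := by ring
  have hA := total_simpleCount_le hopp hfix (κ := κ) (S := S) (by positivity : 0 ≤ 2 * Δ) K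
    (by linarith) hD t ht
  have hsw := switching (κ := κ) (S := S) hopp hfix t (fun l c => ind (κ c ∈ l))
    (fun _ c => ind_nonneg _)
  have hfib : ∀ j : T, ∑ c, ind (κ c = κ j) ≤ Δ + 1 := by
    intro j
    have h1 : ∀ c, ind (κ c = κ j) ≤ ind (κ c = κ j ∧ c ≠ j) + ind (c = j) := fun c =>
      ind_le_add fun h => by
        by_cases hc : c = j
        · exact Or.inr hc
        · exact Or.inl ⟨h, hc⟩
    have h2 : ∑ c, ind (c = j) ≤ 1 := by
      refine (sum_ind_le_card {j} (by simp)).trans (by simp)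
    calc _ ≤ ∑ c, (ind (κ c = κ j ∧ c ≠ j) + ind (c = j)) := sum_le_sum fun c _ => h1 c
      _ ≤ _ := by rw [sum_add_distrib]; exact add_le_add (hΔ j) h2
  have hmem : ∀ (σ : S ≃ T) (w : List S),
      ∑ c, ind (κ c ∈ w.map fun x => κ (σ x)) ≤ w.length * (Δ + 1) := by
    intro σ w
    induction w with
    | nil => simp [ind]
    | cons a w ih =>
      calc _ ≤ ∑ c, (ind (κ c = κ (σ a)) + ind (κ c ∈ w.map fun x => κ (σ x))) :=
            sum_le_sum fun c _ => ind_le_add fun h => by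
              rw [List.map_cons, List.mem_cons] at h; exact h
        _ ≤ _ := by
          rw [sum_add_distrib, List.length_cons]
          push_cast
          linarith [hfib (σ a)]
  have hpos : (0 : ℝ) < Fintype.card S - (2 * t + 1) := by linarith
  have h1 : total (firstCount (S := S) opp κ · t) * (Fintype.card S - (2 * t + 1)) ≤
      ((t + 1) * (Δ + 1)) * total (simpleCount (S := S) opp κ · t) := by
    refine hsw.trans ?_
    simp_rw [total, simpleCount, mul_sum]
    refine sum_le_sum fun σ _ => sum_le_sum fun e _ => sum_le_sum fun l hl => ?_
    rw [mem_listsOfLength] at hl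
    rw [mul_comm, ← mul_sum, mul_comm]
    rw [mul_comm]
    refine mul_le_mul_of_nonneg_left ((hmem σ (e :: l)).trans (le_of_eq ?_)) (ind_nonneg _)
    rw [List.length_cons, hl]; push_cast; ring
  have h2 : (Fintype.card S : ℝ) ≤ 2 * (Fintype.card S - (2 * t + 1)) := by linarith
  refine le_of_mul_le_mul_right (h1.trans ?_) hpos
  calc _ ≤ ((t + 1) * (Δ + 1)) * (Fintype.card S * (2 * Δ) ^ t * (Fintype.card (S ≃ T) : ℝ)) := by
        gcongr
    _ ≤ ((t + 1) * (Δ + 1)) * (2 * (Fintype.card S - (2 * t + 1)) * (2 * Δ) ^ t *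
        (Fintype.card (S ≃ T) : ℝ)) := by gcongr
    _ = _ := by ring

/-- A bound for the expected number of walks with a collision. -/
noncomputable def badBound (Δ : ℝ) : ℕ → ℝ
  | 0 => 2 * (Δ + 1)
  | t + 1 => 2 * (Δ + 1) * (t + 2) * (2 * Δ) ^ (t + 1) + Δ * badBound Δ t

lemma total_badCount_le (hopp : ∀ e, opp (opp e) = e) (hfix : ∀ e, opp e ≠ e) {Δ : ℝ}
    (hΔ0 : 0 ≤ Δ) (hΔ : ∀ c, siblings κ c ≤ Δ) (K : ℕ)
    (hK : 2 * (2 * K + 1 : ℝ) ≤ Fintype.card S) (hST : Fintype.card S = Fintype.card T)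
    (t : ℕ) (ht : t ≤ K) :
    total (badCount (S := S) opp κ · t) ≤ badBound Δ t * (Fintype.card (S ≃ T) : ℝ) := by
  induction t with
  | zero =>
    refine (sum_le_sum fun σ _ => badCount_zero_le).trans
      ((total_firstCount_le hopp hfix hΔ0 hΔ K hK hST 0 ht).trans (le_of_eq ?_))
    simp [badBound]
  | succ t ih =>
    have h1 := total_firstCount_le hopp hfix hΔ0 hΔ K hK hST (t + 1) ht
    have h2 := mul_le_mul_of_nonneg_left (ih (by omega)) hΔ0
    calc total (badCount (S := S) opp κ · (t + 1)) ≤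
          ∑ σ : S ≃ T, (firstCount opp κ σ (t + 1) + Δ * badCount opp κ σ t) :=
          sum_le_sum fun σ _ => badCount_succ_le hΔ t
      _ = total (firstCount (S := S) opp κ · (t + 1)) + Δ * total (badCount (S := S) opp κ · t) := by
          rw [sum_add_distrib, ← mul_sum]; rfl
      _ ≤ _ := by
          refine (add_le_add h1 h2).trans (le_of_eq ?_)
          rw [badBound]; push_cast; ring

/-- The summand with `badBound` does not grow with the number of sockets and so becomes negligible
per variable node. -/
lemma total_walkCount_le (hopp : ∀ e, opp (opp e) = e) (hfix : ∀ e, opp e ≠ e) {Δ ρ : ℝ}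
    (hΔ0 : 0 ≤ Δ) (hΔ : ∀ c, siblings κ c ≤ Δ) (hρ : 0 ≤ ρ) (K : ℕ)
    (hK : 2 * (2 * K + 1 : ℝ) ≤ Fintype.card S) (hST : Fintype.card S = Fintype.card T)
    (h : ∑ c, siblings κ c ≤ ρ * (Fintype.card S - (2 * K + 1))) (t : ℕ) (ht : t + 1 ≤ K) :
    total (walkCount (S := S) opp κ · (t + 1)) ≤
      (Fintype.card S * ρ ^ (t + 1) + Δ * badBound Δ t) * (Fintype.card (S ≃ T) : ℝ) := by
  have hK0 : (0 : ℝ) ≤ K := K.cast_nonneg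
  have h1 := total_simpleCount_le hopp hfix hρ K (by linarith) h (t + 1) ht
  have h2 := mul_le_mul_of_nonneg_left
    (total_badCount_le hopp hfix hΔ0 hΔ K hK hST t (by omega)) hΔ0
  calc total (walkCount (S := S) opp κ · (t + 1)) ≤
        ∑ σ : S ≃ T, (simpleCount opp κ σ (t + 1) + Δ * badCount opp κ σ t) :=
        sum_le_sum fun σ _ => walkCount_succ_le hΔ t
    _ = total (simpleCount (S := S) opp κ · (t + 1)) +
        Δ * total (badCount (S := S) opp κ · t) := by
        rw [sum_add_distrib, ← mul_sum]; rfl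
    _ ≤ _ := (add_le_add h1 h2).trans (le_of_eq (by ring))

/-! ### A switch changes few walks -/

/-- Counted backwards from the last socket: the predecessors of `f` are the opposites of its
siblings. -/
lemma walks_to_le (hopp : ∀ e, opp (opp e) = e) {Δ : ℝ} (hΔ0 : 0 ≤ Δ)
    (hΔ : ∀ c, siblings κ c ≤ Δ) (t : ℕ) (f : S) :
    ∑ l ∈ listsOfLength S t, ind (IsWalk opp κ σ (f :: l)) ≤ Δ ^ t := by
  induction t generalizing f with
  | zero => simp [listsOfLength, ind_le_one]
  | succ t ih =>
    rw [sum_listsOfLength_succ]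
    simp_rw [isWalk_cons_cons, ind_and, ← mul_sum]
    have hback : ∑ e, ind (Step opp κ σ e f) ≤ Δ := by
      let E : S ≃ S := ⟨opp, opp, hopp, hopp⟩
      refine le_trans (le_of_eq ?_) (hΔ (σ f))
      rw [siblings, ← Equiv.sum_comp (E.trans σ)]
      refine sum_congr rfl fun e _ => ind_congr ?_
      simp only [Step, E, Equiv.trans_apply, Equiv.coe_fn_mk, ne_eq, EmbeddingLike.apply_eq_iff_eq]
      exact and_congr eq_comm (not_congr eq_comm)
    calc _ ≤ ∑ e, ind (Step opp κ σ e f) * Δ ^ t :=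
          sum_le_sum fun e _ => mul_le_mul_of_nonneg_left (ih e) (ind_nonneg _)
      _ = (∑ e, ind (Step opp κ σ e f)) * Δ ^ t := by rw [sum_mul]
      _ ≤ Δ * Δ ^ t := by gcongr
      _ = _ := by ring

/-- Each of the `t + 1` positions that `x` can occupy accounts for at most `Δ ^ t` walks; the
induction splits off the last position. -/
lemma walks_through_le (hopp : ∀ e, opp (opp e) = e) {Δ : ℝ} (hΔ0 : 0 ≤ Δ)
    (hΔ : ∀ c, siblings κ c ≤ Δ) (t : ℕ) (x : S) :
    ∑ e, ∑ l ∈ listsOfLength S t, ind (IsWalk opp κ σ (e :: l) ∧ x ∈ e :: l) ≤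
      (t + 1) * Δ ^ t := by
  have hhead : ∀ t, ∑ e, ∑ l ∈ listsOfLength S t, ind (IsWalk opp κ σ (e :: l) ∧ x = e) ≤
      Δ ^ t := by
    intro t
    rw [sum_eq_single x]
    · refine (sum_le_sum fun l _ => ind_mono And.left).trans (walks_to_le hopp hΔ0 hΔ t x)
    · intro e _ he
      exact sum_eq_zero fun l _ => ind_of_not fun h => he h.2.symm
    · simp
  induction t with
  | zero =>
    refine le_trans (sum_le_sum fun e _ => sum_le_sum fun l hl => ?_) ((hhead 0).trans (by simp))
    rw [mem_listsOfLength, List.length_eq_zero_iff] at hl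
    subst hl
    exact ind_mono fun h => ⟨h.1, by simpa using h.2⟩
  | succ t ih =>
    have h1 := sum_extend_le (opp := opp) (σ := σ) hΔ t fun w => x ∈ w
    calc _ ≤ ∑ e, ∑ l ∈ listsOfLength S (t + 1), (ind (IsWalk opp κ σ (e :: l) ∧ x = e) +
          ind (IsWalk opp κ σ (e :: l) ∧ x ∈ l)) :=
          sum_le_sum fun e _ => sum_le_sum fun l _ => ind_le_add fun h => by
            rcases List.mem_cons.1 h.2 with h2 | h2
            · exact Or.inl ⟨h.1, h2⟩
            · exact Or.inr ⟨h.1, h2⟩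
      _ ≤ Δ ^ (t + 1) + Δ * ((t + 1) * Δ ^ t) := by
          simp_rw [sum_add_distrib]
          exact add_le_add (hhead _) (h1.trans (mul_le_mul_of_nonneg_left ih hΔ0))
      _ = _ := by push_cast; ring

/-- Only walks through `a`, `b`, `opp a` or `opp b` can be destroyed, which explains the factor 4.
-/
lemma walkCount_swap_le (hopp : ∀ e, opp (opp e) = e) {Δ : ℝ} (hΔ0 : 0 ≤ Δ)
    (hΔ : ∀ c, siblings κ c ≤ Δ) (t : ℕ) (a b : S) :
    walkCount opp κ σ t ≤
      walkCount opp κ ((Equiv.swap a b).trans σ) t + 4 * ((t + 1) * Δ ^ t) := by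
  have h := fun x => walks_through_le (σ := σ) hopp hΔ0 hΔ t x
  calc walkCount opp κ σ t ≤ ∑ e, ∑ l ∈ listsOfLength S t,
        (ind (IsWalk opp κ ((Equiv.swap a b).trans σ) (e :: l)) +
        ((ind (IsWalk opp κ σ (e :: l) ∧ a ∈ e :: l) +
          ind (IsWalk opp κ σ (e :: l) ∧ b ∈ e :: l)) +
        (ind (IsWalk opp κ σ (e :: l) ∧ opp a ∈ e :: l) +
          ind (IsWalk opp κ σ (e :: l) ∧ opp b ∈ e :: l)))) := by
        refine sum_le_sum fun e _ => sum_le_sum fun l _ => ?_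
        by_cases hw : IsWalk opp κ σ (e :: l)
        swap
        · rw [ind_of_not hw]
          exact add_nonneg (ind_nonneg _) (add_nonneg
            (add_nonneg (ind_nonneg _) (ind_nonneg _)) (add_nonneg (ind_nonneg _) (ind_nonneg _)))
        refine le_trans (ind_le_add (R := (a ∈ e :: l ∨ b ∈ e :: l) ∨
          (opp a ∈ e :: l ∨ opp b ∈ e :: l)) fun _ => ?_) (add_le_add_right ?_ _)
        · by_contra! hc
          refine hc.1 (isWalk_congr (fun x hx => agree_of_notMem ?_ ?_)
            (fun x hx => agree_of_notMem ?_ ?_) hw)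
          · rintro rfl; exact hc.2.1.1 hx
          · rintro rfl; exact hc.2.1.2 hx
          · rintro rfl; rw [hopp] at hc; exact hc.2.2.1 (List.mem_cons_of_mem _ hx)
          · rintro rfl; rw [hopp] at hc; exact hc.2.2.2 (List.mem_cons_of_mem _ hx)
        · simp only [hw, true_and]
          refine (ind_le_add id).trans (add_le_add (ind_le_add id) (ind_le_add id))
    _ ≤ _ := by
        simp_rw [sum_add_distrib]
        rw [walkCount]
        linarith [h a, h b, h (opp a), h (opp b)]

lemma abs_walkCount_swap_sub_le (hopp : ∀ e, opp (opp e) = e) {Δ : ℝ} (hΔ0 : 0 ≤ Δ)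
    (hΔ : ∀ c, siblings κ c ≤ Δ) (t : ℕ) (a b : S) :
    |walkCount opp κ ((Equiv.swap a b).trans σ) t - walkCount opp κ σ t| ≤
      4 * ((t + 1) * Δ ^ t) := by
  have h1 := walkCount_swap_le (σ := σ) hopp hΔ0 hΔ t a b
  have h2 := walkCount_swap_le (σ := (Equiv.swap a b).trans σ) hopp hΔ0 hΔ t a b
  have h3 : (Equiv.swap a b).trans ((Equiv.swap a b).trans σ) = σ := by ext x; simp
  rw [h3] at h2
  rw [abs_le]
  constructor <;> linarith

end WalkCounts

/-! ### The variance of a Lipschitz function of a random permutation -/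

section Variance

open Finset Equiv

/-- The average of a function on a finite type. -/
noncomputable def average {α : Type*} [Fintype α] (f : α → ℝ) : ℝ :=
  (∑ a, f a) / Fintype.card α

/-- The decomposition of a second moment into variance and squared bias; applied on each fibre, it
yields the law of total variance in `variance_perm_le`. -/
lemma sum_sub_sq {α : Type*} [Fintype α] [Nonempty α] (f : α → ℝ) (m : ℝ) :
    ∑ a, (f a - m) ^ 2 =
      ∑ a, (f a - average f) ^ 2 + Fintype.card α * (average f - m) ^ 2 := by
  have hc : (Fintype.card α : ℝ) ≠ 0 := by exact_mod_cast Fintype.card_ne_zero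
  have h1 : ∑ a, f a = Fintype.card α * average f := by rw [average]; field_simp
  have h2 : ∀ a, (f a - m) ^ 2 = (f a - average f) ^ 2 +
      (2 * (average f - m) * f a + (m ^ 2 - average f ^ 2)) := fun a => by ring
  simp_rw [h2, sum_add_distrib, ← mul_sum, h1, sum_const, card_univ, nsmul_eq_mul]
  ring

lemma abs_average_sub_le {α : Type*} [Fintype α] [Nonempty α] {f : α → ℝ} {m c : ℝ}
    (h : ∀ a, |f a - m| ≤ c) : |average f - m| ≤ c := by
  have hc : (0 : ℝ) < Fintype.card α := by exact_mod_cast Fintype.card_pos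
  have h1 : average f - m = (∑ a, (f a - m)) / Fintype.card α := by
    rw [average, sum_sub_distrib, sum_const, card_univ, nsmul_eq_mul]; field_simp
  rw [h1, abs_div, abs_of_pos hc, div_le_iff₀ hc]
  calc _ ≤ ∑ a, |f a - m| := abs_sum_le_sum_abs _ _
    _ ≤ ∑ _a : α, c := sum_le_sum fun a _ => h a
    _ = c * Fintype.card α := by rw [sum_const, card_univ, nsmul_eq_mul, mul_comm]

/-- Induction on the number of points. Given the image `k` of the new point, `f` is again Lipschitz
as a function of a permutation of the old points. Two permutations that differ only in `k` are
joined by two switches, so the conditional averages differ by at most `2 * c`. By the law of total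
variance each point contributes at most `4 * c ^ 2`. -/
theorem variance_perm_le (α : Type) [Fintype α] : ∀ [DecidableEq α] (f : Perm α → ℝ) (c : ℝ),
    (∀ (π : Perm α) (a b : α), |f (swap a b * π) - f π| ≤ c) →
    ∑ π, (f π - average f) ^ 2 ≤ 4 * c ^ 2 * Fintype.card α * Fintype.card (Perm α) := by
  refine Fintype.induction_empty_option (P := fun α _ => ∀ [DecidableEq α] (f : Perm α → ℝ)
    (c : ℝ), (∀ (π : Perm α) (a b : α), |f (swap a b * π) - f π| ≤ c) →
    ∑ π, (f π - average f) ^ 2 ≤ 4 * c ^ 2 * Fintype.card α * Fintype.card (Perm α)) ?_ ?_ ?_ α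
  · intro α β _ e ih _ f c hf
    classical
    let E : Perm α ≃ Perm β := e.permCongr
    let _ := Fintype.ofEquiv β e.symm
    have h1 := ih (fun π => f (E π)) c fun π a b => by
      have : E (swap a b * π) = swap (e a) (e b) * E π := by
        ext x; simp [E, Equiv.permCongr_apply, Perm.mul_apply, e.injective.map_swap]
      rw [this]; exact hf _ _ _
    have h2 : average (fun π => f (E π)) = average f := by
      rw [average, average, Equiv.sum_comp E, Fintype.card_congr E]
    rw [h2, Equiv.sum_comp E (fun π => (f π - average f) ^ 2), Fintype.card_congr E,
      Fintype.card_congr e] at h1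
    convert h1
  · intro _ f c hf
    simp [average]
  · intro α _ ih inst f c hf
    classical
    obtain rfl : inst = Option.instDecidableEq := Subsingleton.elim _ _
    let E : Perm (Option α) ≃ Option α × Perm α := Perm.decomposeOption
    let g : Option α → Perm α → ℝ := fun k π => f (E.symm (k, π))
    have hE : ∀ k π, E.symm (k, π) = swap none k * optionCongr π := fun _ _ => rfl
    have hc : 0 ≤ c := (abs_nonneg _).trans (hf 1 none none)
    have hsum : ∀ F : Perm (Option α) → ℝ, ∑ π, F π = ∑ k, ∑ π, F (E.symm (k, π)) := by
      intro F
      rw [← Equiv.sum_comp E.symm, Fintype.sum_prod_type]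
    have hcard : Fintype.card (Perm (Option α)) =
        Fintype.card (Option α) * Fintype.card (Perm α) := by
      rw [Fintype.card_congr E, Fintype.card_prod]
    have havg : average f = average fun k => average (g k) := by
      simp_rw [average]
      rw [hsum, hcard, ← sum_div, div_div]
      push_cast
      rw [mul_comm]
    have hg1 : ∀ k, ∑ π, (g k π - average (g k)) ^ 2 ≤
        4 * c ^ 2 * Fintype.card α * Fintype.card (Perm α) := by
      intro k
      refine ih (g k) c fun π a b => ?_
      -- Conjugating a switch by `swap none k` gives a switch again.
      have h1 : E.symm (k, swap a b * π) =
          swap (swap none k (some a)) (swap none k (some b)) * E.symm (k, π) := by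
        have h2 : optionCongr (swap a b * π) = swap (some a) (some b) * optionCongr π := by
          rw [← optionCongr_swap]
          ext1 x
          cases x with
          | none => simp [swap_apply_of_ne_of_ne]
          | some v => simp [(Option.some_injective α).map_swap]
        rw [hE, hE, h2, ← mul_assoc, ← mul_assoc]
        congr 1
        exact Equiv.mul_swap_eq_swap_mul _ _ _
      change |f (E.symm (k, swap a b * π)) - f (E.symm (k, π))| ≤ c
      rw [h1]
      exact hf _ _ _
    have hg2 : ∀ k k', |average (g k) - average (g k')| ≤ 2 * c := by
      intro k k'
      have h1 : ∀ π, |g k π - g k' π| ≤ 2 * c := by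
        intro π
        -- The passage from `k'` to `k` undoes `swap none k'` and applies `swap none k`.
        have h2 : E.symm (k, π) = swap none k * (swap none k' * E.symm (k', π)) := by
          rw [hE, hE, ← mul_assoc (swap none k') (swap none k'), swap_mul_self, one_mul]
        have h3 := hf (swap none k' * E.symm (k', π)) none k
        have h4 := hf (E.symm (k', π)) none k'
        rw [← h2] at h3
        have h5 := abs_add_le (f (E.symm (k, π)) - f (swap none k' * E.symm (k', π)))
          (f (swap none k' * E.symm (k', π)) - f (E.symm (k', π)))
        rw [sub_add_sub_cancel] at h5
        change |f (E.symm (k, π)) - f (E.symm (k', π))| ≤ 2 * c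
        linarith
      have h6 : average (g k) - average (g k') = average (fun π => g k π - g k' π) := by
        simp_rw [average, sum_sub_distrib, sub_div]
      have h7 := abs_average_sub_le (f := fun π => g k π - g k' π) (m := 0) (c := 2 * c)
        (by simpa using h1)
      rw [h6]; simpa using h7
    have hg3 : ∀ k, (average (g k) - average f) ^ 2 ≤ 4 * c ^ 2 := by
      intro k
      have h1 := abs_average_sub_le (f := fun k' => average (g k')) (m := average (g k))
        (fun k' => hg2 k' k)
      rw [havg, ← sq_abs, abs_sub_comm]
      calc _ ≤ (2 * c) ^ 2 := pow_le_pow_left₀ (abs_nonneg _) h1 2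
        _ = _ := by ring
    rw [hsum]
    calc _ = ∑ k, (∑ π, (g k π - average (g k)) ^ 2 +
          Fintype.card (Perm α) * (average (g k) - average f) ^ 2) :=
          sum_congr rfl fun k _ => sum_sub_sq (g k) (average f)
      _ ≤ ∑ _k : Option α, (4 * c ^ 2 * Fintype.card α * Fintype.card (Perm α) +
          Fintype.card (Perm α) * (4 * c ^ 2)) := by
          refine sum_le_sum fun k _ => add_le_add (hg1 k) ?_
          exact mul_le_mul_of_nonneg_left (hg3 k) (Nat.cast_nonneg _)
      _ = _ := by
          rw [sum_const, card_univ, nsmul_eq_mul, hcard, Fintype.card_option]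
          push_cast
          ring

/-- Chebyshev's inequality for functions of a uniformly random bijection that are Lipschitz with
respect to switches. -/
theorem card_deviation_le {S T : Type} [Fintype S] [DecidableEq S] [Fintype T] [DecidableEq T]
    (f : (S ≃ T) → ℝ) {c : ℝ}
    (hf : ∀ (σ : S ≃ T) (a b : S), |f ((swap a b).trans σ) - f σ| ≤ c) {r : ℝ} (hr : 0 ≤ r) :
    (∑ σ, ind (average f + r ≤ f σ)) * r ^ 2 ≤
      4 * c ^ 2 * Fintype.card S * Fintype.card (S ≃ T) := by
  rcases isEmpty_or_nonempty (S ≃ T) with h | ⟨⟨σ₀⟩⟩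
  · simp
  -- A reference bijection turns wirings into permutations; a switch of values becomes a switch of
  -- the preimages.
  · let E : Perm S ≃ (S ≃ T) := Equiv.equivCongr (Equiv.refl S) σ₀
    have h1 := variance_perm_le S (fun π => f (E π)) c fun π a b => by
      have : E (swap a b * π) = (swap (π⁻¹ a) (π⁻¹ b)).trans (E π) := by
        rw [Equiv.swap_mul_eq_mul_swap]
        ext x; simp [E, Equiv.equivCongr]
      rw [this]; exact hf _ _ _
    have h2 : average (fun π => f (E π)) = average f := by
      rw [average, average, Equiv.sum_comp E, Fintype.card_congr E]
    rw [h2, Equiv.sum_comp E (fun π => (f π - average f) ^ 2), Fintype.card_congr E] at h1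
    refine le_trans ?_ h1
    rw [sum_mul]
    refine sum_le_sum fun σ _ => ?_
    by_cases h : average f + r ≤ f σ
    · rw [ind_of h, one_mul]
      exact pow_le_pow_left₀ hr (by linarith) 2
    · rw [ind_of_not h, zero_mul]; positivity

end Variance

/-! ### Values and step counts of computations -/

section CountedLemmas

variable {α β : Type}

@[simp] lemma Counted.val_bind (x : Counted α) (f : α → Counted β) :
    (x >>= f).val = (f x.val).val := rfl

@[simp] lemma Counted.steps_bind (x : Counted α) (f : α → Counted β) :
    (x >>= f).steps = x.steps + (f x.val).steps := rfl

@[simp] lemma Counted.val_pure (a : α) : (pure a : Counted α).val = a := rfl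

@[simp] lemma Counted.steps_pure (a : α) : (pure a : Counted α).steps = 0 := rfl

@[simp] lemma steps_tick : tick.steps = 1 := rfl

lemma val_foldlM (f : β → α → Counted β) (b : β) (l : List α) :
    (l.foldlM f b).val = l.foldl (fun b a => (f b a).val) b := by
  induction l generalizing b with
  | nil => rfl
  | cons a l ih => rw [List.foldlM_cons, List.foldl_cons, Counted.val_bind, ih]

/-- A loop, all of whose rounds take at most `c` steps. -/
lemma foldlM_bound {f : β → α → Counted β} {P : ℕ → β → Prop} {c : ℕ} {l : List α} {b : β}
    {k : ℕ} (hb : P k b) (h : ∀ j b, ∀ a ∈ l, k ≤ j → j < k + l.length → P j b →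
      (f b a).steps ≤ c ∧ P (j + 1) (f b a).val) :
    (l.foldlM f b).steps ≤ c * l.length ∧ P (k + l.length) (l.foldlM f b).val := by
  induction l generalizing b k with
  | nil => exact ⟨le_refl _, hb⟩
  | cons a l ih =>
    rw [List.foldlM_cons, Counted.steps_bind, Counted.val_bind, List.length_cons]
    have h0 := h k b a (by simp) le_rfl (by simp) hb
    have h1 := ih h0.2 fun j b' a' ha' hj hj' => h j b' a' (List.mem_cons_of_mem _ ha')
      (by omega) (by simp only [List.length_cons]; omega)
    refine ⟨?_, ?_⟩
    · rw [mul_add, mul_one]; omega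
    · rw [show k + (l.length + 1) = k + 1 + l.length by ring]; exact h1.2

end CountedLemmas

/-! ### The list operations -/

section ListLemmas

variable {F : Type} [DecidableEq F]

lemma val_memC (a : F) (l : List F) : (memC a l).val = decide (a ∈ l) := by
  induction l with
  | nil => simp [memC]
  | cons b l ih =>
    by_cases h : a = b <;> simp [memC, h, ih]

lemma steps_memC_le (a : F) (l : List F) : (memC a l).steps ≤ l.length := by
  induction l with
  | nil => simp [memC]
  | cons b l ih =>
    by_cases h : a = b
    · simp [memC, h]
    · simp [memC, h]; omega

lemma val_insertC (a : F) (l : List F) : (insertC a l).val = if a ∈ l then l else a :: l := by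
  by_cases h : a ∈ l <;> simp [insertC, val_memC, h]

lemma steps_insertC_le (a : F) (l : List F) : (insertC a l).steps ≤ l.length + 1 := by
  have := steps_memC_le a l
  by_cases h : a ∈ l <;> simp [insertC, val_memC, h] <;> omega

lemma length_insertC_le (a : F) (l : List F) : (insertC a l).val.length ≤ l.length + 1 := by
  rw [val_insertC]; split_ifs <;> simp

lemma mem_insertC {a b : F} {l : List F} : b ∈ (insertC a l).val ↔ b = a ∨ b ∈ l := by
  rw [val_insertC]
  split_ifs with h
  · exact ⟨Or.inr, fun h' => h'.elim (fun e => e ▸ h) id⟩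
  · exact List.mem_cons

lemma nodup_insertC {a : F} {l : List F} (h : l.Nodup) : (insertC a l).val.Nodup := by
  rw [val_insertC]
  split_ifs with h'
  · exact h
  · exact List.nodup_cons.2 ⟨h', h⟩

lemma insertC_map {f : F → F} (hf : Function.Injective f) (a : F) (l : List F) :
    (insertC (f a) (l.map f)).val = (insertC a l).val.map f := by
  rw [val_insertC, val_insertC]
  by_cases h : a ∈ l
  · rw [if_pos h, if_pos (List.mem_map_of_mem h)]
  · rw [if_neg h, if_neg (by rwa [List.mem_map_of_injective hf]), List.map_cons]

variable [Add F]

lemma val_sumsetC (l₁ l₂ : List F) : (sumsetC l₁ l₂).val =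
    l₁.foldl (fun acc a => l₂.foldl (fun acc b => (insertC (a + b) acc).val) acc) [] := by
  rw [sumsetC, val_foldlM]
  simp_rw [val_foldlM]
  rfl

lemma mem_sumsetC {l₁ l₂ : List F} {x : F} :
    x ∈ (sumsetC l₁ l₂).val ↔ ∃ a ∈ l₁, ∃ b ∈ l₂, a + b = x := by
  have inner : ∀ (a : F) (l acc : List F),
      x ∈ l.foldl (fun acc b => (insertC (a + b) acc).val) acc ↔
        x ∈ acc ∨ ∃ b ∈ l, a + b = x := by
    intro a l
    induction l with
    | nil => simp
    | cons b l ih =>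
      intro acc
      rw [List.foldl_cons, ih, mem_insertC]
      simp only [List.mem_cons, exists_eq_or_imp, eq_comm (a := x)]
      tauto
  have outer : ∀ (l acc : List F),
      x ∈ l.foldl (fun acc a => l₂.foldl (fun acc b => (insertC (a + b) acc).val) acc) acc ↔
        x ∈ acc ∨ ∃ a ∈ l, ∃ b ∈ l₂, a + b = x := by
    intro l
    induction l with
    | nil => simp
    | cons a l ih =>
      intro acc
      rw [List.foldl_cons, ih, inner, or_assoc]
      simp only [List.mem_cons, exists_eq_or_imp]
  rw [val_sumsetC, outer]
  simp

lemma foldl_insertC_nodup {α : Type} (g : α → F) (l : List α) {acc : List F} (h : acc.Nodup) :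
    (l.foldl (fun acc b => (insertC (g b) acc).val) acc).Nodup := by
  induction l generalizing acc with
  | nil => exact h
  | cons b l ih => exact ih (nodup_insertC h)

lemma nodup_sumsetC (l₁ l₂ : List F) : (sumsetC l₁ l₂).val.Nodup := by
  rw [val_sumsetC]
  generalize hacc : ([] : List F) = acc
  have h : acc.Nodup := hacc ▸ List.nodup_nil
  clear hacc
  induction l₁ generalizing acc with
  | nil => exact h
  | cons a l₁ ih => exact ih _ (foldl_insertC_nodup _ l₂ h)

/-- The list operations only compare symbols, so an injective relabelling compatible with addition
passes through them, with the order of the entries preserved. This starts the symmetry argument for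
dilations. -/
lemma sumsetC_map {f g h : F → F} (hh : Function.Injective h)
    (hfg : ∀ a b, f a + g b = h (a + b)) (l₁ l₂ : List F) :
    (sumsetC (l₁.map f) (l₂.map g)).val = (sumsetC l₁ l₂).val.map h := by
  have inner : ∀ (a : F) (l acc : List F),
      (l.map g).foldl (fun acc b => (insertC (f a + b) acc).val) (acc.map h) =
        (l.foldl (fun acc b => (insertC (a + b) acc).val) acc).map h := by
    intro a l
    induction l with
    | nil => simp
    | cons b l ih =>
      intro acc
      rw [List.map_cons, List.foldl_cons, List.foldl_cons, hfg, insertC_map hh, ih]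
  have outer : ∀ (l acc : List F),
      (l.map f).foldl (fun acc a => (l₂.map g).foldl
        (fun acc b => (insertC (a + b) acc).val) acc) (acc.map h) =
        (l.foldl (fun acc a => l₂.foldl
          (fun acc b => (insertC (a + b) acc).val) acc) acc).map h := by
    intro l
    induction l with
    | nil => simp
    | cons b l ih =>
      intro acc
      rw [List.map_cons, List.foldl_cons, List.foldl_cons, inner, ih]
  rw [val_sumsetC, val_sumsetC]
  exact outer l₁ []

lemma sumsetC_bound (l₁ l₂ : List F) :
    (sumsetC l₁ l₂).steps ≤ (l₁.length * l₂.length + 2) * l₂.length * l₁.length ∧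
      (sumsetC l₁ l₂).val.length ≤ l₁.length * l₂.length := by
  have h := foldlM_bound (f := fun acc a => l₂.foldlM (fun acc b => do
    tick
    insertC (a + b) acc) acc) (P := fun k acc => acc.length ≤ k * l₂.length) (l := l₁)
    (b := ([] : List F)) (k := 0) (c := (l₁.length * l₂.length + 2) * l₂.length) (by simp) ?_
  · simpa [sumsetC] using h
  · intro j acc a _ _ hj hacc
    have h2 := foldlM_bound (f := fun acc b => do
      tick
      insertC (a + b) acc) (P := fun k acc => acc.length ≤ k) (l := l₂)
      (b := acc) (k := j * l₂.length) (c := l₁.length * l₂.length + 2) hacc ?_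
    · refine ⟨h2.1, ?_⟩
      rw [add_mul, one_mul]; exact h2.2
    · intro i acc' b _ _ hi hacc'
      have h3 := steps_insertC_le (a + b) acc'
      have h4 := length_insertC_le (a + b) acc'
      have h5 : (j + 1) * l₂.length ≤ l₁.length * l₂.length :=
        Nat.mul_le_mul_right _ (by omega)
      rw [add_mul, one_mul] at h5
      simp only [Counted.steps_bind, steps_tick, Counted.val_bind]
      omega

end ListLemmas

/-! ### The message operations -/

section MsgLemmas

variable {F : Type}

/-- Apply a function to all the candidates of a message. -/
def Msg.map (f : F → F) : Msg F → Msg F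
  | Msg.unver l => Msg.unver (l.map f)
  | Msg.ver a => Msg.ver (f a)

lemma Msg.symbols_map (f : F → F) (m : Msg F) : (m.map f).symbols = m.symbols.map f := by
  cases m <;> rfl

/-- If the message is verified, its symbol is `x`. -/
def Msg.Sound (x : F) (m : Msg F) : Prop := ∀ a, m = Msg.ver a → a = x

variable [Field F] [DecidableEq F]

lemma val_scaleMsg (a : F) (m : Msg F) : (scaleMsg a m).val = m.map (a * ·) := by
  cases m <;> rfl

lemma steps_scaleMsg_le (a : F) (m : Msg F) : (scaleMsg a m).steps ≤ m.symbols.length := by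
  cases m <;> simp [scaleMsg, Msg.symbols]

lemma mem_addMsg {m₁ m₂ : Msg F} {x : F} : x ∈ (addMsg m₁ m₂).val.symbols ↔
    ∃ a ∈ m₁.symbols, ∃ b ∈ m₂.symbols, a + b = x := by
  cases m₁ <;> cases m₂ <;> simp [addMsg, Msg.symbols, mem_sumsetC, eq_comm]

lemma nodup_addMsg (m₁ m₂ : Msg F) : (addMsg m₁ m₂).val.symbols.Nodup := by
  cases m₁ <;> cases m₂ <;> simp [addMsg, Msg.symbols, nodup_sumsetC]

lemma sound_addMsg {m₁ m₂ : Msg F} {x₁ x₂ : F} (h₁ : m₁.Sound x₁) (h₂ : m₂.Sound x₂) :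
    (addMsg m₁ m₂).val.Sound (x₁ + x₂) := by
  cases m₁ <;> cases m₂ <;> intro a ha <;> simp [addMsg] at ha
  rw [← ha, h₁ _ rfl, h₂ _ rfl]

lemma addMsg_map {f g h : F → F} (hh : Function.Injective h)
    (hfg : ∀ a b, f a + g b = h (a + b)) (m₁ m₂ : Msg F) :
    (addMsg (m₁.map f) (m₂.map g)).val = (addMsg m₁ m₂).val.map h := by
  have h1 := sumsetC_map hh hfg m₁.symbols m₂.symbols
  cases m₁ <;> cases m₂ <;> simp_all [addMsg, Msg.map, Msg.symbols]

lemma addMsg_bound (m₁ m₂ : Msg F) {p q : ℕ} (hp : m₁.symbols.length ≤ p)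
    (hq : m₂.symbols.length ≤ q) :
    (addMsg m₁ m₂).steps ≤ (p * q + 2) * q * p + 1 ∧
      (addMsg m₁ m₂).val.symbols.length ≤ p * q := by
  have h := sumsetC_bound m₁.symbols m₂.symbols
  have h1 : m₁.symbols.length * m₂.symbols.length ≤ p * q := Nat.mul_le_mul hp hq
  have h2 : (m₁.symbols.length * m₂.symbols.length + 2) * m₂.symbols.length *
      m₁.symbols.length ≤ (p * q + 2) * q * p := by gcongr
  cases m₁ <;> cases m₂ <;> simp_all [addMsg, Msg.symbols] <;> omega

/-! ### The check-node rule -/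

lemma val_checkRule {ι : Type} (w : F) (L : List ι) (v : ι → F) (M : ι → Msg F) :
    (checkRule w (L.map fun k => (v k, M k))).val =
      (L.foldl (fun acc k => (addMsg acc ((M k).map (v k * ·))).val) (Msg.ver 0)).map
        (-w⁻¹ * ·) := by
  simp [checkRule, val_foldlM, val_scaleMsg, List.foldl_map]

lemma Msg.Sound.map {x : F} {m : Msg F} (h : m.Sound x) (f : F → F) : (m.map f).Sound (f x) := by
  cases m <;> intro a ha <;> simp [Msg.map] at ha
  rw [← ha, h _ rfl]

/-- The right-hand symbol is the one that the check equation forces on the output edge when the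
inputs carry `x k`; the loop is followed with its partial sum. -/
lemma sound_checkRule {ι : Type} (w : F) (L : List ι) (v x : ι → F) (M : ι → Msg F)
    (h : ∀ k ∈ L, (M k).Sound (x k)) :
    (checkRule w (L.map fun k => (v k, M k))).val.Sound
      (-w⁻¹ * (L.map fun k => v k * x k).sum) := by
  rw [val_checkRule]
  refine Msg.Sound.map ?_ (-w⁻¹ * ·)
  have : ∀ (acc : Msg F) (s : F), acc.Sound s →
      (L.foldl (fun acc k => (addMsg acc ((M k).map (v k * ·))).val) acc).Sound
        (s + (L.map fun k => v k * x k).sum) := by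
    induction L with
    | nil => intro acc s hs; simpa using hs
    | cons k L ih =>
      intro acc s hs
      rw [List.foldl_cons, List.map_cons, List.sum_cons, ← add_assoc]
      exact ih (fun k hk => h k (List.mem_cons_of_mem _ hk)) _ _
        (sound_addMsg hs ((h k (by simp)).map (v k * ·)))
  simpa using this (Msg.ver 0) 0 (by intro a ha; cases ha; rfl)

lemma mem_checkRule {ι : Type} (w : F) (L : List ι) (v x : ι → F) (M : ι → Msg F)
    (h : ∀ k ∈ L, x k ∈ (M k).symbols) :
    -w⁻¹ * (L.map fun k => v k * x k).sum ∈
      (checkRule w (L.map fun k => (v k, M k))).val.symbols := by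
  rw [val_checkRule, Msg.symbols_map]
  refine List.mem_map_of_mem (f := (-w⁻¹ * ·)) ?_
  have : ∀ (acc : Msg F) (s : F), s ∈ acc.symbols → s + (L.map fun k => v k * x k).sum ∈
      (L.foldl (fun acc k => (addMsg acc ((M k).map (v k * ·))).val) acc).symbols := by
    induction L with
    | nil => intro acc s hs; simpa using hs
    | cons k L ih =>
      intro acc s hs
      rw [List.foldl_cons, List.map_cons, List.sum_cons, ← add_assoc]
      refine ih (fun k hk => h k (List.mem_cons_of_mem _ hk)) _ _ ?_
      rw [mem_addMsg]
      refine ⟨s, hs, v k * x k, ?_, rfl⟩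
      rw [Msg.symbols_map]
      exact List.mem_map_of_mem (f := (v k * ·)) (h k (by simp))
  simpa using this (Msg.ver 0) 0 (by simp [Msg.symbols])

lemma nodup_checkRule {ι : Type} {w : F} (hw : w ≠ 0) (L : List ι) (v : ι → F) (M : ι → Msg F) :
    (checkRule w (L.map fun k => (v k, M k))).val.symbols.Nodup := by
  rw [val_checkRule, Msg.symbols_map]
  refine List.Nodup.map (mul_right_injective₀ (by simpa using hw)) ?_
  generalize hacc : (Msg.ver 0 : Msg F) = acc
  have h : acc.symbols.Nodup := by rw [← hacc]; simp [Msg.symbols]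
  clear hacc
  induction L generalizing acc with
  | nil => exact h
  | cons k L ih => exact ih _ (nodup_addMsg _ _)

/-- The dilation with centre `x` and factor `u`. -/
def dilate (u x s : F) : F := u * s + (1 - u) * x

lemma dilate_injective {u : F} (hu : u ≠ 0) (x : F) : Function.Injective (dilate u x) := by
  intro a b h
  simpa [dilate, hu] using h

lemma Msg.map_map (f g : F → F) (m : Msg F) : (m.map f).map g = m.map (g ∘ f) := by
  cases m <;> simp [Msg.map]

/-- Scaling by `c` moves the centre `z` of a dilation to `c * z`, and adding symbols adds the
centres. Therefore the output is dilated about the symbol that the check equation forces from the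
centres. -/
lemma checkRule_dilate {ι : Type} {u : F} (hu : u ≠ 0) (w : F) (L : List ι) (v x : ι → F)
    (M : ι → Msg F) :
    (checkRule w (L.map fun k => (v k, (M k).map (dilate u (x k))))).val =
      (checkRule w (L.map fun k => (v k, M k))).val.map
        (dilate u (-w⁻¹ * (L.map fun k => v k * x k).sum)) := by
  have hmul : ∀ c z : F, (c * ·) ∘ dilate u z = dilate u (c * z) ∘ (c * ·) := by
    intro c z; ext s; simp [dilate]; ring
  have : ∀ (acc : Msg F) (s : F),
      L.foldl (fun acc k => (addMsg acc (((M k).map (dilate u (x k))).map (v k * ·))).val)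
        (acc.map (dilate u s)) =
      (L.foldl (fun acc k => (addMsg acc ((M k).map (v k * ·))).val) acc).map
        (dilate u (s + (L.map fun k => v k * x k).sum)) := by
    induction L with
    | nil => intro acc s; simp
    | cons k L ih =>
      intro acc s
      rw [List.foldl_cons, List.foldl_cons, List.map_cons, List.sum_cons, ← add_assoc, ← ih]
      congr 1
      rw [Msg.map_map, hmul, ← Msg.map_map]
      refine addMsg_map (dilate_injective hu _) (fun a b => ?_) _ _
      simp [dilate]; ring
  have h0 : (Msg.ver 0 : Msg F).map (dilate u 0) = Msg.ver 0 := by simp [Msg.map, dilate]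
  have h1 := this (Msg.ver 0) 0
  rw [h0, zero_add] at h1
  rw [val_checkRule, val_checkRule, h1, Msg.map_map, Msg.map_map, hmul]

/-- The accumulated list has at most `B ^ k` entries after `k` inputs, and a check node of degree at
most three has two further edges. The size of the field does not enter. -/
lemma checkRule_bound {ι : Type} (w : F) (L : List ι) (v : ι → F) (M : ι → Msg F) {B : ℕ}
    (hB : 1 ≤ B) (hL : L.length ≤ 2) (hM : ∀ k ∈ L, (M k).symbols.length ≤ B) :
    (checkRule w (L.map fun k => (v k, M k))).steps ≤
        2 * (B + ((B ^ 2 * B + 2) * B * B ^ 2 + 1)) + 1 + B ^ 2 ∧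
      (checkRule w (L.map fun k => (v k, M k))).val.symbols.length ≤ B ^ 2 := by
  have h := foldlM_bound (f := fun (acc : Msg F) (wm : F × Msg F) => do
    let m ← scaleMsg wm.1 wm.2
    addMsg acc m) (P := fun k acc => acc.symbols.length ≤ B ^ k)
    (l := L.map fun k => (v k, M k)) (b := Msg.ver 0) (k := 0)
    (c := B + ((B ^ 2 * B + 2) * B * B ^ 2 + 1)) (by simp [Msg.symbols]) ?_
  · rw [List.length_map, zero_add] at h
    have h2 : B ^ L.length ≤ B ^ 2 := Nat.pow_le_pow_right hB hL
    have h3 := Nat.mul_le_mul_left (B + ((B ^ 2 * B + 2) * B * B ^ 2 + 1)) hL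
    have h4 := steps_scaleMsg_le (-w⁻¹) (List.foldlM (fun (acc : Msg F) (wm : F × Msg F) => do
      let m ← scaleMsg wm.1 wm.2
      addMsg acc m) (Msg.ver 0) (L.map fun k => (v k, M k))).val
    simp only [checkRule, Counted.steps_bind, Counted.val_bind, steps_tick, val_scaleMsg,
      Msg.symbols_map, List.length_map]
    omega
  · rintro j acc ⟨c, m⟩ hm _ hj hacc
    obtain ⟨k, hk, hkm⟩ := List.mem_map.1 hm
    obtain ⟨rfl, rfl⟩ := Prod.mk.inj hkm
    rw [List.length_map] at hj
    have h1 := steps_scaleMsg_le (v k) (M k)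
    have hMk := hM k hk
    have h2 := addMsg_bound acc (scaleMsg (v k) (M k)).val (q := B)
      (hacc.trans (Nat.pow_le_pow_right hB (show j ≤ 2 by omega)))
      (by rw [val_scaleMsg, Msg.symbols_map, List.length_map]; exact hMk)
    have h3 := addMsg_bound acc (scaleMsg (v k) (M k)).val (q := B) hacc
      (by rw [val_scaleMsg, Msg.symbols_map, List.length_map]; exact hMk)
    simp only [Counted.steps_bind, Counted.val_bind]
    refine ⟨by omega, ?_⟩
    rw [pow_succ]; exact h3.2

end MsgLemmas

/-! ### The variable-node rule -/

section VarRule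

variable {F : Type} [Field F] [DecidableEq F]

lemma val_verifiedSymbols (ms : List (Msg F)) : (verifiedSymbols ms).val =
    ms.foldl (fun acc m => (match m with
      | Msg.ver a => insertC a acc
      | Msg.unver _ => pure acc : Counted (List F)).val) [] := by
  rw [verifiedSymbols, val_foldlM]
  rfl

/-- One round of the inner loop of `mergeLists`. -/
def mergeStep (s : List F × List F) (b : F) : List F × List F :=
  if b ∈ s.1 then (s.1, (insertC b s.2).val) else (b :: s.1, s.2)

lemma val_mergeLists (y : F) (ms : List (Msg F)) : (mergeLists y ms).val =
    ms.foldl (fun acc m => m.symbols.foldl mergeStep acc) ([y], []) := by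
  rw [mergeLists, val_foldlM]
  congr 1
  ext1 acc; ext1 m
  rw [Counted.val_bind, val_foldlM]
  congr 1
  ext1 s; ext1 b
  by_cases h : b ∈ s.1 <;> simp [mergeStep, val_memC, h]

/-- Because `l` has no repetitions, a symbol is recorded as repeated only if it was already there
before `l` was processed, never on account of `l` alone. -/
lemma foldl_mergeStep {l : List F} (hl : l.Nodup) (s : List F × List F) :
    (∀ z, z ∈ (l.foldl mergeStep s).1 ↔ z ∈ s.1 ∨ z ∈ l) ∧
    (∀ z, z ∈ (l.foldl mergeStep s).2 ↔ z ∈ s.2 ∨ (z ∈ l ∧ z ∈ s.1)) ∧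
    (s.1.Nodup → (l.foldl mergeStep s).1.Nodup) ∧
    (s.2.Nodup → (l.foldl mergeStep s).2.Nodup) := by
  induction l generalizing s with
  | nil => simp
  | cons b l ih =>
    rw [List.nodup_cons] at hl
    obtain ⟨h1, h2, h3, h4⟩ := ih hl.2 (mergeStep s b)
    rw [List.foldl_cons]
    by_cases hb : b ∈ s.1
    · simp only [mergeStep, hb, if_true, mem_insertC] at h1 h2 h3 h4 ⊢
      refine ⟨fun z => ?_, fun z => ?_, h3, fun h => h4 (nodup_insertC h)⟩
      · rw [h1, List.mem_cons]
        constructor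
        · tauto
        · rintro (h | rfl | h)
          · exact Or.inl h
          · exact Or.inl hb
          · exact Or.inr h
      · rw [h2, List.mem_cons]
        constructor
        · rintro ((rfl | h) | h)
          · exact Or.inr ⟨Or.inl rfl, hb⟩
          · exact Or.inl h
          · exact Or.inr ⟨Or.inr h.1, h.2⟩
        · tauto
    · simp only [mergeStep, hb, if_false, List.mem_cons] at h1 h2 h3 h4 ⊢
      refine ⟨fun z => ?_, fun z => ?_, fun h => h3 (List.nodup_cons.2 ⟨hb, h⟩), h4⟩
      · rw [h1]; tauto
      · rw [h2]
        constructor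
        · rintro (h | ⟨h, rfl | h'⟩)
          · exact Or.inl h
          · exact absurd h hl.1
          · exact Or.inr ⟨Or.inr h, h'⟩
        · rintro (h | ⟨rfl | h, h'⟩)
          · exact Or.inl h
          · exact absurd h' hb
          · exact Or.inr ⟨h, Or.inr h'⟩

lemma eq_singleton_of_nodup {l : List F} (hl : l.Nodup) {a : F} (h : ∀ z, z ∈ l ↔ z = a) :
    l = [a] :=
  List.perm_singleton.1 ((List.perm_ext_iff_of_nodup hl (List.nodup_singleton a)).2
    fun z => by rw [h, List.mem_singleton])

lemma varRule_ver (y a : F) : (varRule y [Msg.ver a]).val = Msg.ver a := by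
  simp [varRule, val_verifiedSymbols, val_insertC]

lemma varRule_unver_of_mem {y : F} {l : List F} (hl : l.Nodup) (hy : y ∈ l) :
    (varRule y [Msg.unver l]).val = Msg.ver y := by
  obtain ⟨-, h2, -, h4⟩ := foldl_mergeStep hl ([y], [])
  have h5 : (l.foldl mergeStep ([y], [])).2 = [y] := eq_singleton_of_nodup (h4 List.nodup_nil)
    fun z => by rw [h2]; simp; rintro rfl; exact hy
  simp [varRule, val_verifiedSymbols, val_mergeLists, Msg.symbols, h5]

lemma varRule_unver_of_notMem {y : F} {l : List F} (hl : l.Nodup) (hy : y ∉ l) :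
    ∃ l' : List F, (varRule y [Msg.unver l]).val = Msg.unver l' ∧ l'.Nodup ∧
      ∀ z, z ∈ l' ↔ z = y ∨ z ∈ l := by
  obtain ⟨h1, h2, h3, h4⟩ := foldl_mergeStep hl ([y], [])
  have h5 : (l.foldl mergeStep ([y], [])).2 = [] := List.eq_nil_iff_forall_not_mem.2
    fun z => by rw [h2]; simp; rintro h rfl; exact hy h
  refine ⟨(l.foldl mergeStep ([y], [])).1, ?_, h3 (List.nodup_singleton _), fun z => by simp [h1]⟩
  simp [varRule, val_verifiedSymbols, val_mergeLists, Msg.symbols, h5]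

/-- With a single incoming message, a new verification can only arise when the received symbol is on
the incoming list. -/
lemma sound_varRule {x y : F} {m : Msg F} (hm : m.symbols.Nodup) (h : m.Sound x)
    (hy : y ∈ m.symbols → y = x) : (varRule y [m]).val.Sound x := by
  cases m with
  | ver a =>
    rw [varRule_ver]; exact h
  | unver l =>
    by_cases hyl : y ∈ l
    · rw [varRule_unver_of_mem (l := l) hm hyl]
      intro a ha; cases ha; exact hy hyl
    · obtain ⟨l', h1, -, -⟩ := varRule_unver_of_notMem (l := l) hm hyl
      rw [h1]; intro a ha; cases ha

lemma mem_varRule {x y : F} {m : Msg F} (hm : m.symbols.Nodup) (h : m.Sound x)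
    (hy : y ∈ m.symbols → y = x) (hx : y = x ∨ x ∈ m.symbols) :
    x ∈ (varRule y [m]).val.symbols := by
  cases m with
  | ver a =>
    rw [varRule_ver]
    simp [Msg.symbols, h a rfl]
  | unver l =>
    by_cases hyl : y ∈ l
    · rw [varRule_unver_of_mem (l := l) hm hyl]
      simp [Msg.symbols, hy hyl]
    · obtain ⟨l', h1, -, h2⟩ := varRule_unver_of_notMem (l := l) hm hyl
      rw [h1]
      exact (h2 x).2 (hx.imp Eq.symm id)

/-- The final decision is correct if both inputs contain the transmitted symbol, verified inputs
are correct, and no wrong symbol occurs twice. -/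
lemma varRule_pair {x y : F} {m₁ m₂ : Msg F} (hm₁ : m₁.symbols.Nodup) (hm₂ : m₂.symbols.Nodup)
    (h₁ : m₁.Sound x) (h₂ : m₂.Sound x) (hx₁ : x ∈ m₁.symbols) (hx₂ : x ∈ m₂.symbols)
    (hy₁ : y ∈ m₁.symbols → y = x) (hy₂ : y ∈ m₂.symbols → y = x)
    (h : ∀ z ∈ m₁.symbols, z ∈ m₂.symbols → z = x) :
    (varRule y [m₁, m₂]).val = Msg.ver x := by
  cases m₁ with
  | ver a =>
    obtain rfl := h₁ a rfl
    cases m₂ with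
    | ver b =>
      obtain rfl := h₂ b rfl
      simp [varRule, val_verifiedSymbols, val_insertC]
    | unver l => simp [varRule, val_verifiedSymbols, val_insertC]
  | unver l =>
    cases m₂ with
    | ver b =>
      obtain rfl := h₂ b rfl
      simp [varRule, val_verifiedSymbols, val_insertC]
    | unver l' =>
      simp only [Msg.symbols] at *
      obtain ⟨h1, h2, h3, h4⟩ := foldl_mergeStep hm₁ ([y], [])
      obtain ⟨-, g2, -, g4⟩ := foldl_mergeStep hm₂ (l.foldl mergeStep ([y], []))
      have h5 : (l'.foldl mergeStep (l.foldl mergeStep ([y], []))).2 = [x] := by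
        refine eq_singleton_of_nodup (g4 (h4 List.nodup_nil)) fun z => ?_
        rw [g2, h2, h1]
        simp only [List.mem_singleton, List.not_mem_nil, false_or]
        constructor
        -- A repeated symbol is the received one and lies on `l`, is the received one and lies on
        -- `l'`, or lies on both lists.
        · rintro (⟨h, rfl⟩ | ⟨h', rfl | h''⟩)
          · exact hy₁ h
          · exact hy₂ h'
          · exact h z h'' h'
        · rintro rfl
          exact Or.inr ⟨hx₂, Or.inr hx₁⟩
      simp [varRule, val_verifiedSymbols, val_mergeLists, Msg.symbols, h5]

/-- The rule does nothing with symbols except test them for equality. -/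
lemma varRule_map {f : F → F} (hf : Function.Injective f) (y : F) (ms : List (Msg F)) :
    (varRule (f y) (ms.map (Msg.map f))).val = (varRule y ms).val.map f := by
  have h1 : (verifiedSymbols (ms.map (Msg.map f))).val = (verifiedSymbols ms).val.map f := by
    rw [val_verifiedSymbols, val_verifiedSymbols]
    have : ∀ acc : List F, (ms.map (Msg.map f)).foldl (fun acc m => (match m with
        | Msg.ver a => insertC a acc
        | Msg.unver _ => pure acc : Counted (List F)).val) (acc.map f) =
        (ms.foldl (fun acc m => (match m with
          | Msg.ver a => insertC a acc
          | Msg.unver _ => pure acc : Counted (List F)).val) acc).map f := by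
      induction ms with
      | nil => simp
      | cons m ms ih =>
        intro acc
        rw [List.map_cons, List.foldl_cons, List.foldl_cons, ← ih]
        congr 1
        cases m with
        | ver a => exact insertC_map hf a acc
        | unver l => rfl
    exact this []
  have hstep : ∀ (s : List F × List F) (b : F), mergeStep (s.1.map f, s.2.map f) (f b) =
      ((mergeStep s b).1.map f, (mergeStep s b).2.map f) := by
    intro s b
    by_cases hb : b ∈ s.1
    · simp [mergeStep, hb, List.mem_map_of_injective hf, insertC_map hf]
    · simp [mergeStep, hb, List.mem_map_of_injective hf]
  have hfold : ∀ (l : List F) (s : List F × List F),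
      (l.map f).foldl mergeStep (s.1.map f, s.2.map f) =
      ((l.foldl mergeStep s).1.map f, (l.foldl mergeStep s).2.map f) := by
    intro l
    induction l with
    | nil => intro s; rfl
    | cons b l ih => intro s; rw [List.map_cons, List.foldl_cons, List.foldl_cons, hstep, ih]
  have h2 : (mergeLists (f y) (ms.map (Msg.map f))).val =
      ((mergeLists y ms).val.1.map f, (mergeLists y ms).val.2.map f) := by
    rw [val_mergeLists, val_mergeLists]
    have : ∀ s : List F × List F, (ms.map (Msg.map f)).foldl
        (fun acc m => m.symbols.foldl mergeStep acc) (s.1.map f, s.2.map f) =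
        ((ms.foldl (fun acc m => m.symbols.foldl mergeStep acc) s).1.map f,
          (ms.foldl (fun acc m => m.symbols.foldl mergeStep acc) s).2.map f) := by
      clear h1
      induction ms with
      | nil => intro s; rfl
      | cons m ms ih =>
        intro s
        rw [List.map_cons, List.foldl_cons, List.foldl_cons, Msg.symbols_map, hfold, ih]
    exact this ([y], [])
  rw [varRule, varRule, Counted.val_bind, Counted.val_bind, h1]
  rcases (verifiedSymbols ms).val with _ | ⟨a, _ | ⟨b, l⟩⟩
  · simp only [List.map_nil, Counted.val_bind, h2]
    rcases (mergeLists y ms).val.2 with _ | ⟨a, _ | ⟨b, l⟩⟩ <;> simp [Msg.map]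
  · simp [Msg.map]
  · simp [Msg.map]

lemma verifiedSymbols_bound (ms : List (Msg F)) :
    (verifiedSymbols ms).steps ≤ (ms.length + 2) * ms.length := by
  refine (foldlM_bound (P := fun k acc => acc.length ≤ k) (k := 0) (c := ms.length + 2)
    (by simp) ?_).1
  intro j acc m _ _ hj hacc
  cases m with
  | ver a =>
    have h1 := steps_insertC_le a acc
    have h2 := length_insertC_le a acc
    simp only [Counted.steps_bind, steps_tick, Counted.val_bind]
    omega
  | unver l =>
    simp only [Counted.steps_bind, steps_tick, Counted.val_bind, Counted.steps_pure,
      Counted.val_pure]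
    omega

lemma mergeLists_bound (y : F) (ms : List (Msg F)) {B : ℕ}
    (h : ∀ m ∈ ms, m.symbols.length ≤ B) :
    (mergeLists y ms).steps ≤ ((2 * (B * ms.length) + 2) * B + 1) * ms.length ∧
      (mergeLists y ms).val.1.length ≤ 1 + B * ms.length := by
  have h0 := foldlM_bound (P := fun k (s : List F × List F) =>
    s.1.length ≤ 1 + B * k ∧ s.2.length ≤ B * k) (k := 0) (l := ms) (b := ([y], []))
    (c := (2 * (B * ms.length) + 2) * B + 1) (f := fun acc m => do
    tick
    m.symbols.foldlM (fun (s : List F × List F) b => do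
      if ← memC b s.1 then
        let r ← insertC b s.2
        pure (s.1, r)
      else
        tick
        pure (b :: s.1, s.2)) acc) (by simp) ?_
  · refine ⟨h0.1, ?_⟩
    have := h0.2.1
    rw [zero_add] at this
    exact this
  · intro j acc m hm _ hj hacc
    have hB := h m hm
    have h3 : B * (j + 1) ≤ B * ms.length := Nat.mul_le_mul_left _ (by omega)
    rw [mul_add, mul_one] at h3
    have h1 := foldlM_bound (P := fun k (s : List F × List F) =>
      s.1.length ≤ 1 + k ∧ s.2.length ≤ k) (k := B * j) (l := m.symbols) (b := acc)
      (c := 2 * (B * ms.length) + 2) (f := fun (s : List F × List F) b => do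
      if ← memC b s.1 then
        let r ← insertC b s.2
        pure (s.1, r)
      else
        tick
        pure (b :: s.1, s.2)) hacc ?_
    · have h2 := Nat.mul_le_mul_left (2 * (B * ms.length) + 2) hB
      rw [Counted.steps_bind, steps_tick, Counted.val_bind, mul_add B, mul_one]
      refine ⟨by omega, ?_, ?_⟩
      · have := h1.2.1; omega
      · have := h1.2.2; omega
    · intro i s b _ _ hi hs
      have g1 := steps_memC_le b s.1
      have g2 := steps_insertC_le b s.2
      have g3 := length_insertC_le b s.2
      by_cases hb : b ∈ s.1
      · simp only [Counted.steps_bind, val_memC, hb, decide_true, if_true, Counted.steps_pure,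
          Counted.val_bind, Counted.val_pure]
        omega
      · simp only [Counted.steps_bind, val_memC, hb, decide_false, Bool.false_eq_true, if_false,
          Counted.steps_pure, Counted.val_bind, Counted.val_pure, steps_tick, List.length_cons]
        omega

/-- Allowing two messages covers the final decision as well as the message updates, which have only
one input. -/
lemma varRule_bound (y : F) (ms : List (Msg F)) {B : ℕ} (hms : ms.length ≤ 2)
    (h : ∀ m ∈ ms, m.symbols.length ≤ B) :
    (varRule y ms).steps ≤ 8 + ((2 * (B * 2) + 2) * B + 1) * 2 ∧
      (varRule y ms).val.symbols.length ≤ 1 + B * 2 := by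
  have h1 := verifiedSymbols_bound ms
  have h2 : (ms.length + 2) * ms.length ≤ (2 + 2) * 2 := by gcongr
  have h3 := mergeLists_bound y ms h
  have h4 : ((2 * (B * ms.length) + 2) * B + 1) * ms.length ≤
      ((2 * (B * 2) + 2) * B + 1) * 2 := by gcongr
  have h5 : 1 + B * ms.length ≤ 1 + B * 2 := by gcongr
  rw [varRule, Counted.steps_bind, Counted.val_bind]
  rcases (verifiedSymbols ms).val with _ | ⟨a, _ | ⟨b, l⟩⟩
  · simp only [Counted.steps_bind, Counted.val_bind]
    rcases (mergeLists y ms).val.2 with _ | ⟨a, _ | ⟨b, l⟩⟩ <;>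
      simp only [Counted.steps_pure, Counted.val_pure, Msg.symbols, List.length_singleton] <;> omega
  · simp only [Counted.steps_pure, Counted.val_pure, Msg.symbols, List.length_singleton]; omega
  · simp only [Counted.steps_pure, Counted.val_pure, Msg.symbols, List.length_singleton]; omega

end VarRule

/-! ### The messages of the decoder when all the variable nodes have degree two -/

section Messages

lemma sum_filter_finRange {M : Type} [AddCommGroup M] {d : ℕ} (k₀ : Fin d) (f : Fin d → M) :
    (((List.finRange d).filter fun k => decide (k ≠ k₀)).map f).sum = ∑ k, f k - f k₀ := by
  have hn : ((List.finRange d).filter fun k => decide (k ≠ k₀)).Nodup :=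
    (List.nodup_finRange d).filter _
  rw [← List.sum_toFinset f hn, eq_sub_iff_add_eq]
  have : ((List.finRange d).filter fun k => decide (k ≠ k₀)).toFinset =
      Finset.univ.erase k₀ := by ext k; simp
  rw [this, Finset.sum_erase_add _ _ (Finset.mem_univ _)]

lemma length_filter_finRange {d : ℕ} (k₀ : Fin d) :
    ((List.finRange d).filter fun k => decide (k ≠ k₀)).length + 1 = d := by
  have hn : ((List.finRange d).filter fun k => decide (k ≠ k₀)).Nodup :=
    (List.nodup_finRange d).filter _
  have : ((List.finRange d).filter fun k => decide (k ≠ k₀)).toFinset =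
      Finset.univ.erase k₀ := by ext k; simp
  rw [← List.toFinset_card_of_nodup hn, this, Finset.card_erase_add_one (Finset.mem_univ _),
    Finset.card_univ, Fintype.card_fin]

lemma filter_finRange_two {d : ℕ} (hd : d = 2) (k₀ : Fin d) :
    (List.finRange d).filter (fun k => decide (k ≠ k₀)) = [k₀.rev] := by
  subst hd
  fin_cases k₀ <;> rfl

lemma finRange_two {d : ℕ} (hd : d = 2) :
    List.finRange d = [⟨0, by omega⟩, Fin.rev ⟨0, by omega⟩] := by
  subst hd
  rfl

variable {n m : ℕ} {dv : Fin n → ℕ} {dc : Fin m → ℕ}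

/-- The other socket of a variable node of degree two. -/
def otherSocket (e : Sockets dv) : Sockets dv := ⟨e.1, e.2.rev⟩

@[simp] lemma otherSocket_fst (e : Sockets dv) : (otherSocket e).1 = e.1 := rfl

lemma otherSocket_otherSocket (e : Sockets dv) : otherSocket (otherSocket e) = e := by
  simp [otherSocket]

lemma otherSocket_ne (hdv : ∀ i, dv i = 2) (e : Sockets dv) : otherSocket e ≠ e := by
  obtain ⟨i, k⟩ := e
  intro h
  have h1 : k.rev = k := eq_of_heq (Sigma.mk.inj h).2
  have h2 := congrArg Fin.val h1
  rw [Fin.val_rev] at h2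
  have := hdv i
  omega

lemma eq_or_eq_otherSocket (hdv : ∀ i, dv i = 2) {e f : Sockets dv} (h : e.1 = f.1) :
    e = f ∨ e = otherSocket f := by
  obtain ⟨i, k⟩ := e
  obtain ⟨j, k'⟩ := f
  obtain rfl : i = j := h
  by_cases hk : k = k'
  · exact Or.inl (by rw [hk])
  · right
    have : k = k'.rev := by
      apply Fin.ext
      have h1 : (k : ℕ) ≠ k' := fun h' => hk (Fin.ext h')
      have h2 := k.isLt
      have h3 := k'.isLt
      have := hdv i
      rw [Fin.val_rev]
      omega
    rw [this]; rfl

/-- The check node of a check socket. -/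
abbrev checkNode (c : Sockets dc) : Fin m := c.1

/-- The socket `f` is a further socket at the check node of `e`. -/
def Sibling (σ : Wiring dv dc) (e f : Sockets dv) : Prop := (σ f).1 = (σ e).1 ∧ f ≠ e

lemma step_iff (σ : Wiring dv dc) (e f : Sockets dv) :
    Step otherSocket checkNode σ e f ↔ Sibling σ (otherSocket e) f := Iff.rfl

lemma sibling_symm (σ : Wiring dv dc) (e : Sockets dv) {k : Fin (dc (σ e).1)}
    (hk : k ≠ (σ e).2) : Sibling σ e (σ.symm ⟨(σ e).1, k⟩) := by
  refine ⟨by simp, fun h => hk ?_⟩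
  rw [Equiv.symm_apply_eq] at h
  exact eq_of_heq (Sigma.mk.inj (h.trans (Sigma.eta _).symm)).2

variable {F : Type} [Field F] [DecidableEq F]

/-- The message from the variable node to the check node of the edge `e` after `t` iterations. -/
def varMsg (σ : Wiring dv dc) (w : Sockets dv → Fˣ) (y : Fin n → F) (t : ℕ) (e : Sockets dv) :
    Msg F := (lmpMessages σ w y t).val e

/-- The message from the check node to the variable node of the edge `e` after `t` iterations. -/
def checkMsg (σ : Wiring dv dc) (w : Sockets dv → Fˣ) (y : Fin n → F) (t : ℕ)
    (e : Sockets dv) : Msg F := (checkRound σ w (lmpMessages σ w y t).val).val e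

variable (σ : Wiring dv dc) (w : Sockets dv → Fˣ) (y : Fin n → F)

/-- The other edges of the check node of `e`, as a list. -/
def otherEdges (e : Sockets dv) : List (Fin (dc (σ e).1)) :=
  (List.finRange (dc (σ e).1)).filter fun k => decide (k ≠ (σ e).2)

lemma checkMsg_eq (t : ℕ) (e : Sockets dv) : checkMsg σ w y t e =
    (checkRule (w e : F) ((otherEdges σ e).map fun k =>
      ((w (σ.symm ⟨(σ e).1, k⟩) : F), varMsg σ w y t (σ.symm ⟨(σ e).1, k⟩)))).val := rfl

lemma sibling_of_mem {e : Sockets dv} {k : Fin (dc (σ e).1)} (hk : k ∈ otherEdges σ e) :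
    Sibling σ e (σ.symm ⟨(σ e).1, k⟩) :=
  sibling_symm σ e (by simpa [otherEdges] using hk)

lemma varMsg_zero (e : Sockets dv) : varMsg σ w y 0 e = Msg.unver [y e.1] := rfl

lemma varMsg_succ (hdv : ∀ i, dv i = 2) (t : ℕ) (e : Sockets dv) :
    varMsg σ w y (t + 1) e = (varRule (y e.1) [checkMsg σ w y t (otherSocket e)]).val := by
  have : varMsg σ w y (t + 1) e = (varRule (y e.1)
      (((List.finRange (dv e.1)).filter fun k => decide (k ≠ e.2)).map fun k =>
        checkMsg σ w y t ⟨e.1, k⟩)).val := rfl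
  rw [this, filter_finRange_two (hdv _)]
  rfl

lemma lmpDecode_eq_some (hdv : ∀ i, dv i = 2) (l : ℕ) (i : Fin n) {a : F}
    (h : (varRule (y i) [checkMsg σ w y l ⟨i, ⟨0, by rw [hdv]; norm_num⟩⟩,
      checkMsg σ w y l (otherSocket ⟨i, ⟨0, by rw [hdv]; norm_num⟩⟩)]).val = Msg.ver a) :
    (lmpDecode σ w l y).val i = some a := by
  have : (lmpDecode σ w l y).val i = (match (varRule (y i)
      (((List.finRange (dv i)).filter fun _ => true).map fun k =>
        checkMsg σ w y l ⟨i, k⟩)).val with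
      | Msg.ver a => pure (some a)
      | Msg.unver _ => pure none : Counted (Option F)).val := rfl
  rw [this, List.filter_true, finRange_two (hdv i), List.map_cons, List.map_singleton]
  rw [otherSocket] at h
  rw [h]
  rfl

/-- The check equation of a codeword, solved for the symbol on the edge `e`. It identifies the
forced symbol in the check-node lemmas with the transmitted one. -/
lemma check_equation {x : Fin n → F} (hx : x ∈ ldpcCode σ w) (e : Sockets dv) :
    -(w e : F)⁻¹ * ((otherEdges σ e).map fun k =>
      (w (σ.symm ⟨(σ e).1, k⟩) : F) * x (σ.symm ⟨(σ e).1, k⟩).1).sum = x e.1 := by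
  have h1 : σ.symm ⟨(σ e).1, (σ e).2⟩ = e := by simp
  have h2 : ∑ k : Fin (dc (σ e).1), (w (σ.symm ⟨(σ e).1, k⟩) : F) *
      x (σ.symm ⟨(σ e).1, k⟩).1 = 0 := hx (σ e).1
  rw [otherEdges, sum_filter_finRange, h2, h1]
  have : (w e : F) ≠ 0 := (w e).ne_zero
  field_simp
  ring

lemma nodup_checkMsg (t : ℕ) (e : Sockets dv) : (checkMsg σ w y t e).symbols.Nodup := by
  rw [checkMsg_eq]
  exact nodup_checkRule (w e).ne_zero _ _ _

/-! ### Correctness -/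

/-- There is a path of `t` steps, starting with the edge `e`, that consists of wrongly received
symbols. -/
def WrongPath (x : Fin n → F) : ℕ → Sockets dv → Prop
  | 0, e => y e.1 ≠ x e.1
  | t + 1, e => y e.1 ≠ x e.1 ∧ ∃ f, Step otherSocket checkNode σ e f ∧ WrongPath x t f

/-- In the computation of the message on the edge `e`, no wrong received symbol occurs on an
incoming list. -/
def NoClash (x : Fin n → F) : ℕ → Sockets dv → Prop
  | 0, _ => True
  | t + 1, e => (y e.1 ∈ (checkMsg σ w y t (otherSocket e)).symbols → y e.1 = x e.1) ∧
      ∀ f, Step otherSocket checkNode σ e f → NoClash x t f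

variable {x : Fin n → F}

lemma sound_checkMsg (hx : x ∈ ldpcCode σ w) (t : ℕ) (e : Sockets dv)
    (h : ∀ f, Sibling σ e f → (varMsg σ w y t f).Sound (x f.1)) :
    (checkMsg σ w y t e).Sound (x e.1) := by
  rw [checkMsg_eq, ← check_equation σ w hx e]
  exact sound_checkRule _ _ _ (fun k => x (σ.symm ⟨(σ e).1, k⟩).1) _
    fun k hk => h _ (sibling_of_mem σ hk)

lemma mem_checkMsg (hx : x ∈ ldpcCode σ w) (t : ℕ) (e : Sockets dv)
    (h : ∀ f, Sibling σ e f → x f.1 ∈ (varMsg σ w y t f).symbols) :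
    x e.1 ∈ (checkMsg σ w y t e).symbols := by
  rw [checkMsg_eq, ← check_equation σ w hx e]
  exact mem_checkRule _ _ _ (fun k => x (σ.symm ⟨(σ e).1, k⟩).1) _
    fun k hk => h _ (sibling_of_mem σ hk)

/-- Verification is either inherited through a check node, or created when the received symbol meets
an incoming list; `NoClash` makes the second case correct. -/
lemma sound_varMsg (hdv : ∀ i, dv i = 2) (hx : x ∈ ldpcCode σ w) (t : ℕ) (e : Sockets dv)
    (h : NoClash σ w y x t e) : (varMsg σ w y t e).Sound (x e.1) := by
  induction t generalizing e with
  | zero => intro a ha; rw [varMsg_zero] at ha; cases ha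
  | succ t ih =>
    rw [varMsg_succ σ w y hdv]
    exact sound_varRule (nodup_checkMsg σ w y t _)
      (sound_checkMsg σ w y hx t (otherSocket e) fun f hf => ih f (h.2 f hf)) h.1

/-- A correctly received symbol stays on the list. If it is wrong, the transmitted symbol must
arrive through the check node, and it does unless one of the next sockets starts a wrong path. -/
lemma mem_varMsg (hdv : ∀ i, dv i = 2) (hx : x ∈ ldpcCode σ w) (t : ℕ) (e : Sockets dv)
    (h : NoClash σ w y x t e) (hp : ¬WrongPath σ y x t e) :
    x e.1 ∈ (varMsg σ w y t e).symbols := by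
  induction t generalizing e with
  | zero =>
    rw [varMsg_zero, Msg.symbols, List.mem_singleton]
    exact (not_not.1 hp).symm
  | succ t ih =>
    rw [varMsg_succ σ w y hdv]
    refine mem_varRule (nodup_checkMsg σ w y t _)
      (sound_checkMsg σ w y hx t (otherSocket e) fun f hf =>
        sound_varMsg σ w y hdv hx t f (h.2 f hf)) h.1 ?_
    by_cases hy : y e.1 = x e.1
    · exact Or.inl hy
    · refine Or.inr (mem_checkMsg σ w y hx t (otherSocket e) fun f hf => ih f (h.2 f hf) ?_)
      exact fun hf' => hp ⟨hy, f, hf, hf'⟩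

/-- The socket number zero at a variable node. -/
def firstSocket (hdv : ∀ i, dv i = 2) (i : Fin n) : Sockets dv := ⟨i, ⟨0, by rw [hdv]; norm_num⟩⟩

/-- Both incoming messages carry the transmitted symbol, and any verified one is right; `hy` and
`hz` exclude every other repeated symbol. -/
lemma lmpDecode_correct (hdv : ∀ i, dv i = 2) (hx : x ∈ ldpcCode σ w) (l : ℕ) (i : Fin n)
    (hc : ∀ e f : Sockets dv, e.1 = i → Sibling σ e f → NoClash σ w y x l f)
    (hp : ∀ e f : Sockets dv, e.1 = i → Sibling σ e f → ¬WrongPath σ y x l f)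
    (hy : ∀ e : Sockets dv, e.1 = i → y i ∈ (checkMsg σ w y l e).symbols → y i = x i)
    (hz : ∀ z ∈ (checkMsg σ w y l (firstSocket hdv i)).symbols,
      z ∈ (checkMsg σ w y l (otherSocket (firstSocket hdv i))).symbols → z = x i) :
    (lmpDecode σ w l y).val i = some (x i) := by
  refine lmpDecode_eq_some σ w y hdv l i ?_
  have hs : ∀ e : Sockets dv, e.1 = i → (checkMsg σ w y l e).Sound (x i) := fun e he => by
    rw [← he]
    exact sound_checkMsg σ w y hx l e fun f hf => sound_varMsg σ w y hdv hx l f (hc e f he hf)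
  have hm : ∀ e : Sockets dv, e.1 = i → x i ∈ (checkMsg σ w y l e).symbols := fun e he => by
    rw [← he]
    exact mem_checkMsg σ w y hx l e fun f hf =>
      mem_varMsg σ w y hdv hx l f (hc e f he hf) (hp e f he hf)
  exact varRule_pair (nodup_checkMsg σ w y l _) (nodup_checkMsg σ w y l _) (hs _ rfl)
    (hs _ rfl) (hm _ rfl) (hm _ rfl) (hy _ rfl) (hy _ rfl) hz

/-! ### Symmetry -/

/-- Dilating all the received symbols with centre the transmitted symbols dilates all messages. -/
lemma checkMsg_dilate_of (hx : x ∈ ldpcCode σ w) {u : F} (hu : u ≠ 0) (t : ℕ)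
    (h : ∀ e, varMsg σ w (fun i => dilate u (x i) (y i)) t e =
      (varMsg σ w y t e).map (dilate u (x e.1))) (e : Sockets dv) :
    checkMsg σ w (fun i => dilate u (x i) (y i)) t e =
      (checkMsg σ w y t e).map (dilate u (x e.1)) := by
  rw [checkMsg_eq, checkMsg_eq]
  simp_rw [h]
  rw [checkRule_dilate hu, check_equation σ w hx]

lemma varMsg_dilate (hdv : ∀ i, dv i = 2) (hx : x ∈ ldpcCode σ w) {u : F} (hu : u ≠ 0) (t : ℕ)
    (e : Sockets dv) : varMsg σ w (fun i => dilate u (x i) (y i)) t e =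
      (varMsg σ w y t e).map (dilate u (x e.1)) := by
  induction t generalizing e with
  | zero => rfl
  | succ t ih =>
    rw [varMsg_succ σ w _ hdv, varMsg_succ σ w _ hdv,
      checkMsg_dilate_of σ w y hx hu t ih, otherSocket_fst,
      ← varRule_map (dilate_injective hu (x e.1))]
    rfl

lemma checkMsg_dilate (hdv : ∀ i, dv i = 2) (hx : x ∈ ldpcCode σ w) {u : F} (hu : u ≠ 0)
    (t : ℕ) (e : Sockets dv) : checkMsg σ w (fun i => dilate u (x i) (y i)) t e =
      (checkMsg σ w y t e).map (dilate u (x e.1)) :=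
  checkMsg_dilate_of σ w y hx hu t (varMsg_dilate σ w y hdv hx hu t) e

/-! ### Locality -/

/-- The variable nodes the message from the variable node of the edge `e` depends on. -/
def nbhd : ℕ → Sockets dv → Set (Fin n)
  | 0, e => {e.1}
  | t + 1, e => insert e.1 {i | ∃ f, Step otherSocket checkNode σ e f ∧ i ∈ nbhd t f}

/-- The variable nodes the message from the check node of the edge `e` depends on. -/
def checkNbhd (t : ℕ) (e : Sockets dv) : Set (Fin n) := {i | ∃ f, Sibling σ e f ∧ i ∈ nbhd σ t f}

lemma nbhd_subset_checkNbhd {t : ℕ} {e f : Sockets dv} (h : Sibling σ e f) :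
    nbhd σ t f ⊆ checkNbhd σ t e := fun _ hi => ⟨f, h, hi⟩

lemma checkMsg_dependsOn_of (t : ℕ)
    (h : ∀ e, DependsOn (fun y => varMsg σ w y t e) (nbhd σ t e)) (e : Sockets dv) :
    DependsOn (fun y => checkMsg σ w y t e) (checkNbhd σ t e) := by
  intro y y' hyy
  simp only [checkMsg_eq]
  congr 2
  refine List.map_congr_left fun k hk => ?_
  rw [Prod.mk.injEq]
  exact ⟨rfl, h _ fun i hi => hyy i ⟨_, sibling_of_mem σ hk, hi⟩⟩

lemma varMsg_dependsOn (hdv : ∀ i, dv i = 2) (t : ℕ) (e : Sockets dv) :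
    DependsOn (fun y => varMsg σ w y t e) (nbhd σ t e) := by
  induction t generalizing e with
  | zero =>
    intro y y' hyy
    simp only [varMsg_zero]
    rw [hyy e.1 rfl]
  | succ t ih =>
    intro y y' hyy
    simp only [varMsg_succ σ w _ hdv]
    have h1 := checkMsg_dependsOn_of σ w t ih (otherSocket e) (x := y) (y := y')
      fun i hi => hyy i (Or.inr hi)
    simp only at h1
    rw [hyy e.1 (Or.inl rfl), h1]

lemma checkMsg_dependsOn (hdv : ∀ i, dv i = 2) (t : ℕ) (e : Sockets dv) :
    DependsOn (fun y => checkMsg σ w y t e) (checkNbhd σ t e) :=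
  checkMsg_dependsOn_of σ w t (varMsg_dependsOn σ w hdv t) e

lemma wrongPath_dependsOn (t : ℕ) (e : Sockets dv) :
    DependsOn (fun y => WrongPath σ y x t e) (nbhd σ t e) := by
  induction t generalizing e with
  | zero =>
    intro y y' hyy
    simp only [WrongPath]
    rw [hyy e.1 rfl]
  | succ t ih =>
    intro y y' hyy
    simp only [WrongPath]
    rw [hyy e.1 (Or.inl rfl)]
    congr 1
    refine propext (exists_congr fun f => and_congr_right fun hf => ?_)
    have := ih f (x := y) (y := y') fun i hi => hyy i (Or.inr ⟨f, hf, hi⟩)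
    exact iff_of_eq this

/-! ### List lengths and step counts -/

/-- A bound for the lengths of the lists after `t` iterations. -/
def listBound : ℕ → ℕ
  | 0 => 1
  | t + 1 => 1 + listBound t ^ 2 * 2

lemma one_le_listBound (t : ℕ) : 1 ≤ listBound t := by
  cases t <;> simp [listBound]

/-- A bound for the number of steps of a check node. -/
def checkCost (B : ℕ) : ℕ := 2 * (B + ((B ^ 2 * B + 2) * B * B ^ 2 + 1)) + 1 + B ^ 2

/-- A bound for the number of steps of a variable node. -/
def varCost (B : ℕ) : ℕ := 8 + ((2 * (B * 2) + 2) * B + 1) * 2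

lemma checkRound_bound (hdc : ∀ j, dc j ≤ 3) {M : Sockets dv → Msg F} {B : ℕ} (hB : 1 ≤ B)
    (hM : ∀ e, (M e).symbols.length ≤ B) :
    (checkRound σ w M).steps ≤ Fintype.card (Sockets dv) * (checkCost B + 4) ∧
      ∀ e, ((checkRound σ w M).val e).symbols.length ≤ B ^ 2 := by
  have h : ∀ e : Sockets dv, _ := fun e => checkRule_bound (w e : F) (otherEdges σ e)
    (fun k => (w (σ.symm ⟨(σ e).1, k⟩) : F)) (fun k => M (σ.symm ⟨(σ e).1, k⟩)) hB
    (by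
      have h1 := length_filter_finRange (σ e).2
      have h2 := hdc (σ e).1
      rw [otherEdges]; omega)
    (fun k _ => hM _)
  refine ⟨?_, fun e => (h e).2⟩
  have hs : ∀ e ∈ (Finset.univ : Finset (Sockets dv)), _ ≤ checkCost B + 4 := fun e _ =>
    show dc (σ e).1 + (checkRule (w e : F) ((otherEdges σ e).map fun k =>
      ((w (σ.symm ⟨(σ e).1, k⟩) : F), M (σ.symm ⟨(σ e).1, k⟩)))).steps + 1 ≤ checkCost B + 4 by
      have h1 := (h e).1
      have h2 := hdc (σ e).1
      rw [checkCost]; omega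
  have := Finset.sum_le_card_nsmul Finset.univ _ _ hs
  rw [smul_eq_mul, Finset.card_univ] at this
  exact this

lemma varRound_bound (hdv : ∀ i, dv i = 2) {M : Sockets dv → Msg F} {B : ℕ}
    (hM : ∀ e, (M e).symbols.length ≤ B) :
    (varRound y M).steps ≤ Fintype.card (Sockets dv) * (varCost B + 3) ∧
      ∀ e, ((varRound y M).val e).symbols.length ≤ 1 + B * 2 := by
  have h : ∀ e : Sockets dv, _ := fun e => varRule_bound (B := B) (y e.1)
    (((List.finRange (dv e.1)).filter fun k => decide (k ≠ e.2)).map fun k => M ⟨e.1, k⟩)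
    (by
      have h1 := length_filter_finRange e.2
      have h2 := hdv e.1
      rw [List.length_map]; omega)
    (fun m hm => by
      obtain ⟨k, -, rfl⟩ := List.mem_map.1 hm
      exact hM _)
  refine ⟨?_, fun e => (h e).2⟩
  have hs : ∀ e ∈ (Finset.univ : Finset (Sockets dv)), _ ≤ varCost B + 3 := fun e _ =>
    show dv e.1 + (varRule (y e.1) (((List.finRange (dv e.1)).filter
      fun k => decide (k ≠ e.2)).map fun k => M ⟨e.1, k⟩)).steps + 1 ≤ varCost B + 3 by
      have h1 := (h e).1
      have h2 := hdv e.1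
      rw [varCost]; omega
  have := Finset.sum_le_card_nsmul Finset.univ _ _ hs
  rw [smul_eq_mul, Finset.card_univ] at this
  exact this

/-- A bound, per edge, for the number of steps of `t` iterations. -/
def messageCost : ℕ → ℕ
  | 0 => 1
  | t + 1 => messageCost t + (checkCost (listBound t) + 4) + (varCost (listBound t ^ 2) + 3)

/-- Steps and list lengths are bounded in one induction, since the cost of a round depends on the
lengths it receives. Neither bound involves the size of the field. -/
lemma lmpMessages_bound (hdv : ∀ i, dv i = 2) (hdc : ∀ j, dc j ≤ 3) (t : ℕ) :
    (lmpMessages σ w y t).steps ≤ Fintype.card (Sockets dv) * messageCost t ∧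
      ∀ e, (varMsg σ w y t e).symbols.length ≤ listBound t := by
  induction t with
  | zero =>
    refine ⟨le_of_eq ?_, fun e => by simp [varMsg_zero, Msg.symbols, listBound]⟩
    simp [lmpMessages, forAll, messageCost]
  | succ t ih =>
    have h1 := checkRound_bound σ w hdc (one_le_listBound t) ih.2
    have h2 := varRound_bound y hdv h1.2
    refine ⟨?_, h2.2⟩
    change _ + (_ + (varRound y (checkRound σ w (lmpMessages σ w y t).val).val).steps) ≤ _
    rw [messageCost, mul_add, mul_add]
    exact (add_le_add ih.1 (add_le_add h1.1 h2.1)).trans (le_of_eq (by ring))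

lemma length_checkMsg_le (hdv : ∀ i, dv i = 2) (hdc : ∀ j, dc j ≤ 3) (t : ℕ) (e : Sockets dv) :
    (checkMsg σ w y t e).symbols.length ≤ listBound t ^ 2 :=
  (checkRound_bound σ w hdc (one_le_listBound t)
    (lmpMessages_bound σ w y hdv hdc t).2).2 e

lemma card_sockets (hdv : ∀ i, dv i = 2) : Fintype.card (Sockets dv) = 2 * n := by
  simp [hdv, mul_comm]

lemma lmpDecode_steps_le (hdv : ∀ i, dv i = 2) (hdc : ∀ j, dc j ≤ 3) (l : ℕ) :
    (lmpDecode σ w l y).steps ≤ (2 * messageCost l + 2 * (checkCost (listBound l) + 4) +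
      (varCost (listBound l ^ 2) + 3)) * n := by
  have h1 := lmpMessages_bound σ w y hdv hdc l
  have h2 := checkRound_bound σ w hdc (one_le_listBound l) h1.2
  have h3 : ∀ i ∈ Finset.univ, _ ≤ varCost (listBound l ^ 2) + 3 := fun i _ =>
    show (dv i + ((varRule (y i) (((List.finRange (dv i)).filter fun _ => true).map fun k =>
        (checkRound σ w (lmpMessages σ w y l).val).val ⟨i, k⟩)).steps +
      (match (varRule (y i) (((List.finRange (dv i)).filter fun _ => true).map fun k =>
          (checkRound σ w (lmpMessages σ w y l).val).val ⟨i, k⟩)).val with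
        | Msg.ver a => pure (some a)
        | Msg.unver _ => pure none : Counted (Option F)).steps)) + 1 ≤
        varCost (listBound l ^ 2) + 3 by
      have g1 := varRule_bound (B := listBound l ^ 2) (y i)
        (((List.finRange (dv i)).filter fun _ => true).map fun k =>
          (checkRound σ w (lmpMessages σ w y l).val).val ⟨i, k⟩)
        (by simp [hdv])
        (fun m hm => by
          obtain ⟨k, -, rfl⟩ := List.mem_map.1 hm
          exact h2.2 _)
      have g2 := hdv i
      have g3 := g1.1
      rw [varCost]
      split <;> simp only [Counted.steps_pure] <;> omega
  have h4 := Finset.sum_le_card_nsmul Finset.univ _ _ h3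
  rw [smul_eq_mul, Finset.card_univ, Fintype.card_fin] at h4
  change _ + (_ + ∑ i : Fin n, _) ≤ _
  have h5 := h1.1
  have h6 := h2.1
  rw [card_sockets hdv] at h5 h6
  refine (add_le_add h5 (add_le_add h6 h4)).trans (le_of_eq ?_)
  ring

end Messages

/-! ### The channel -/

section Channel

open Finset

variable {F : Type} [Field F] [Fintype F] [DecidableEq F]

lemma two_le_card_field : (2 : ℝ) ≤ Fintype.card F := by
  exact_mod_cast (Fintype.one_lt_card : 1 < Fintype.card F)

variable {n : ℕ} {p : ℝ}

lemma qsc_nonneg (hp : 0 ≤ p) (hp1 : p ≤ 1) (a b : F) : 0 ≤ qsc p a b := by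
  have := two_le_card_field (F := F)
  rw [qsc]
  split_ifs
  · linarith
  · exact div_nonneg hp (by linarith)

lemma sum_qsc_ne (p : ℝ) (a : F) : ∑ b, qsc p a b * ind (b ≠ a) = p := by
  have h2 := two_le_card_field (F := F)
  have h : ∀ b, qsc p a b * ind (b ≠ a) = if b = a then 0 else p / ((Fintype.card F : ℝ) - 1) := by
    intro b
    by_cases hb : b = a <;> simp [qsc, hb, ind]
  simp_rw [h]
  rw [sum_ite, sum_const_zero, sum_const, zero_add, filter_ne', card_erase_of_mem (mem_univ a),
    card_univ, nsmul_eq_mul, Nat.cast_sub Fintype.card_pos]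
  push_cast
  field_simp [show (Fintype.card F : ℝ) - 1 ≠ 0 by linarith]

lemma sum_qsc (p : ℝ) (a : F) : ∑ b, qsc p a b = 1 := by
  have h : ∀ b, qsc p a b = qsc p a b * ind (b ≠ a) + if b = a then 1 - p else 0 := by
    intro b
    by_cases hb : b = a <;> simp [qsc, hb, ind]
  rw [sum_congr rfl fun b _ => h b, sum_add_distrib, sum_qsc_ne, sum_ite_eq' univ a]
  simp

/-- The expectation of a function of the received word if `x` is transmitted. -/
noncomputable def channelExp (p : ℝ) (x : Fin n → F) (g : (Fin n → F) → ℝ) : ℝ :=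
  ∑ y, (∏ i, qsc p (x i) (y i)) * g y

variable (x : Fin n → F)

lemma channelExp_mono (hp : 0 ≤ p) (hp1 : p ≤ 1) {f g : (Fin n → F) → ℝ} (h : ∀ y, f y ≤ g y) :
    channelExp p x f ≤ channelExp p x g :=
  sum_le_sum fun y _ => mul_le_mul_of_nonneg_left (h y)
    (prod_nonneg fun _ _ => qsc_nonneg hp hp1 _ _)

lemma channelExp_nonneg (hp : 0 ≤ p) (hp1 : p ≤ 1) {f : (Fin n → F) → ℝ} (h : ∀ y, 0 ≤ f y) :
    0 ≤ channelExp p x f :=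
  sum_nonneg fun y _ => mul_nonneg (prod_nonneg fun _ _ => qsc_nonneg hp hp1 _ _) (h y)

lemma channelExp_sum {ι : Type*} (s : Finset ι) (f : ι → (Fin n → F) → ℝ) :
    channelExp p x (fun y => ∑ i ∈ s, f i y) = ∑ i ∈ s, channelExp p x (f i) := by
  simp_rw [channelExp, mul_sum]
  exact sum_comm

lemma channelExp_add (f g : (Fin n → F) → ℝ) :
    channelExp p x (fun y => f y + g y) = channelExp p x f + channelExp p x g := by
  simp_rw [channelExp, mul_add, sum_add_distrib]

lemma channelExp_const_mul (c : ℝ) (f : (Fin n → F) → ℝ) :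
    channelExp p x (fun y => c * f y) = c * channelExp p x f := by
  simp_rw [channelExp, mul_sum]
  exact sum_congr rfl fun y _ => by ring

/-- The remaining coordinates sum to 1 by the product form of the channel. -/
lemma channelExp_coord (i : Fin n) (h : F → ℝ) :
    channelExp p x (fun y => h (y i)) = ∑ s, qsc p (x i) s * h s := by
  have h1 : ∀ y : Fin n → F, (∏ j, qsc p (x j) (y j)) * h (y i) =
      ∏ j, qsc p (x j) (y j) * (if j = i then h (y j) else 1) := fun y => by
    rw [prod_mul_distrib, prod_ite_eq' univ i]; simp
  simp_rw [channelExp, h1]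
  rw [← Fintype.piFinset_univ,
    ← prod_univ_sum (fun _ => univ) fun j s => qsc p (x j) s * (if j = i then h s else 1)]
  rw [prod_eq_single i]
  · simp
  · intro j _ hj; simp [hj, sum_qsc]
  · simp

lemma channelExp_const (c : ℝ) : channelExp p x (fun _ => c) = c := by
  rcases n with _ | n
  · simp [channelExp]
  · have := channelExp_coord (p := p) x 0 (fun _ => c)
    rw [this, ← sum_mul, sum_qsc, one_mul]

/-- Functions of disjoint sets of received symbols are independent. -/
lemma channelExp_mul {f g : (Fin n → F) → ℝ} {s t : Set (Fin n)} (hf : DependsOn f s)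
    (hg : DependsOn g t) (hst : Disjoint s t) :
    channelExp p x (fun y => f y * g y) = channelExp p x f * channelExp p x g := by
  classical
  let E := Equiv.piEquivPiSubtypeProd (· ∈ s) (fun _ : Fin n => F)
  -- Splitting the coordinates at `s` factorizes the sum; coordinates that a function ignores are
  -- filled in from `x`. Using this also with the constant 1 in place of `f`, `g` or both supplies
  -- the normalizing factors.
  have key : ∀ {f g : (Fin n → F) → ℝ}, DependsOn f s → DependsOn g t →
      channelExp p x (fun y => f y * g y) =
        (∑ a : (i : {i // i ∈ s}) → F, (∏ i : {i // i ∈ s}, qsc p (x i) (a i)) * f (E.symm (a, fun i => x i))) *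
        ∑ b : (i : {i // i ∉ s}) → F, (∏ i : {i // i ∉ s}, qsc p (x i) (b i)) * g (E.symm (fun i => x i, b)) := by
    intro f g hf hg
    rw [channelExp, ← Equiv.sum_comp E.symm, Fintype.sum_prod_type, sum_mul_sum]
    refine sum_congr rfl fun a _ => sum_congr rfl fun b _ => ?_
    have h1 : f (E.symm (a, b)) = f (E.symm (a, fun i => x i)) := hf fun i hi => by
      simp [E, Equiv.piEquivPiSubtypeProd, hi]
    have h2 : g (E.symm (a, b)) = g (E.symm (fun i => x i, b)) := hg fun i hi => by
      have : i ∉ s := fun h => Set.disjoint_left.1 hst h hi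
      simp [E, Equiv.piEquivPiSubtypeProd, this]
    have h3 : ∏ i, qsc p (x i) (E.symm (a, b) i) =
        (∏ i : {i // i ∈ s}, qsc p (x i) (a i)) * ∏ i : {i // i ∉ s}, qsc p (x i) (b i) := by
      rw [← Fintype.prod_subtype_mul_prod_subtype (· ∈ s)]
      congr 1
      · refine prod_congr rfl fun i _ => ?_
        simp [E, Equiv.piEquivPiSubtypeProd]
      · refine prod_congr rfl fun i _ => ?_
        simp [E, Equiv.piEquivPiSubtypeProd, i.2]
    rw [h1, h2, h3]; ring
  have h1 : ∀ u : Set (Fin n), DependsOn (fun _ : Fin n → F => (1 : ℝ)) u := fun u _ _ _ => rfl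
  have k1 := key hf hg
  have k2 := key hf (h1 t)
  have k3 := key (h1 s) hg
  have k4 := key (h1 s) (h1 t)
  simp only [mul_one, one_mul] at k2 k3 k4
  rw [channelExp_const] at k4
  rw [k1, k2, k3]
  generalize (∑ a : (i : {i // i ∈ s}) → F, (∏ i : {i // i ∈ s}, qsc p (x i) (a i)) *
    f (E.symm (a, fun i => x i))) = A
  generalize (∑ b : (i : {i // i ∉ s}) → F, (∏ i : {i // i ∉ s}, qsc p (x i) (b i)) *
    g (E.symm (fun i => x i, b))) = B
  linear_combination A * B * k4

lemma dependsOn_ind {P : (Fin n → F) → Prop} {s : Set (Fin n)} (h : DependsOn P s) :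
    DependsOn (fun y => ind (P y)) s := fun y y' hyy => by
  simp only [h hyy]

/-- The distribution of the received word is invariant under dilations with centre the
transmitted word. -/
lemma channelExp_dilate {u : F} (hu : u ≠ 0) (g : (Fin n → F) → ℝ) :
    channelExp p x (fun y => g fun i => dilate u (x i) (y i)) = channelExp p x g := by
  have hinj : Function.Injective fun (y : Fin n → F) i => dilate u (x i) (y i) := by
    intro y y' h
    funext i
    exact dilate_injective hu (x i) (congrFun h i)
  let E := Equiv.ofBijective _ (Finite.injective_iff_bijective.1 hinj)
  rw [channelExp, channelExp, ← Equiv.sum_comp E fun y => (∏ i, qsc p (x i) (y i)) * g y]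
  refine sum_congr rfl fun y _ => ?_
  -- A dilation is injective and fixes its centre, so it keeps right symbols right and wrong symbols
  -- wrong, and the channel sees nothing else.
  have : ∀ i, qsc p (x i) (E y i) = qsc p (x i) (y i) := by
    intro i
    have h1 : dilate u (x i) (y i) = x i ↔ y i = x i := by
      constructor
      · intro h
        refine dilate_injective hu (x i) (h.trans ?_)
        simp [dilate]; ring
      · rintro h; rw [h]; simp [dilate]; ring
    simp only [qsc, E, Equiv.ofBijective_apply, h1]
  simp_rw [this]
  rfl

end Channel

/-! ### The error probability of a symbol with a tree-like neighbourhood -/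

section SymbolError

open Finset

variable {n m : ℕ} {dv : Fin n → ℕ} {dc : Fin m → ℕ}

/-- No message that enters the computation of the message on the edge `e` depends on the received
symbol it is combined with. -/
def Acyclic (σ : Wiring dv dc) : ℕ → Sockets dv → Prop
  | 0, _ => True
  | t + 1, e => e.1 ∉ checkNbhd σ t (otherSocket e) ∧
      ∀ f, Step otherSocket checkNode σ e f → Acyclic σ t f

/-- The number of walks of `t` steps that start with the edge `e`. -/
noncomputable def pathCount (σ : Wiring dv dc) : ℕ → Sockets dv → ℝ
  | 0, _ => 1
  | t + 1, e => ∑ f, ind (Step otherSocket checkNode σ e f) * pathCount σ t f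

/-- A bound for `q - 1` times the probability of a clash. -/
def clashBound : ℕ → ℝ
  | 0 => 0
  | t + 1 => (listBound t : ℝ) ^ 2 + 2 * clashBound t

lemma clashBound_nonneg (t : ℕ) : 0 ≤ clashBound t := by
  induction t with
  | zero => exact le_rfl
  | succ t ih => rw [clashBound]; positivity

lemma siblings_le_sub_one (c : Sockets dc) : siblings checkNode c ≤ (dc c.1 : ℝ) - 1 := by
  classical
  have h1 := sum_ind_le_card (P := fun c' : Sockets dc => checkNode c' = checkNode c ∧ c' ≠ c)
    (((univ : Finset (Fin (dc c.1))).erase c.2).image fun k => (⟨c.1, k⟩ : Sockets dc)) (by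
      rintro ⟨j, k⟩ ⟨hj, hk⟩
      obtain ⟨j', k'⟩ := c
      obtain rfl : j = j' := hj
      refine mem_image.2 ⟨k, mem_erase.2 ⟨fun h => hk ?_, mem_univ k⟩, rfl⟩
      rw [show k = k' from h])
  refine h1.trans ?_
  have h2 : (((univ : Finset (Fin (dc c.1))).erase c.2).image
      fun k => (⟨c.1, k⟩ : Sockets dc)).card + 1 ≤ dc c.1 := by
    refine (Nat.add_le_add_right card_image_le 1).trans ?_
    rw [card_erase_add_one (mem_univ _), card_univ, Fintype.card_fin]
  have h3 : (((((univ : Finset (Fin (dc c.1))).erase c.2).image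
      fun k => (⟨c.1, k⟩ : Sockets dc)).card : ℕ) : ℝ) + 1 ≤ dc c.1 := by exact_mod_cast h2
  linarith

lemma siblings_le (hdc : ∀ j, dc j ≤ 3) (c : Sockets dc) : siblings checkNode c ≤ 2 := by
  have h1 := siblings_le_sub_one c
  have h2 : (dc c.1 : ℝ) ≤ 3 := by exact_mod_cast hdc c.1
  linarith

lemma sum_sibling_le (hdc : ∀ j, dc j ≤ 3) (σ : Wiring dv dc) (e : Sockets dv) :
    ∑ f, ind (Sibling σ e f) ≤ 2 := by
  have h := sum_step (opp := otherSocket) (κ := checkNode) (σ := σ) (otherSocket e)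
  simp_rw [step_iff, otherSocket_otherSocket] at h
  rw [h]
  exact siblings_le hdc _

variable {F : Type} [Field F] [Fintype F] [DecidableEq F]
variable {p : ℝ} (σ : Wiring dv dc) (w : Sockets dv → Fˣ) {x : Fin n → F}

/-- A union bound over paths. By acyclicity the symbol received at `e` is independent of the rest of
the path, so each of the `t + 1` nodes contributes a factor `p`. -/
lemma prob_wrongPath_le (hp : 0 ≤ p) (hp1 : p ≤ 1) (t : ℕ) (e : Sockets dv)
    (h : Acyclic σ t e) :
    channelExp p x (fun y => ind (WrongPath σ y x t e)) ≤ p ^ (t + 1) * pathCount σ t e := by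
  have hwrong : ∀ i : Fin n, channelExp p x (fun y => ind (y i ≠ x i)) = p := fun i => by
    rw [channelExp_coord x i fun s => ind (s ≠ x i), sum_qsc_ne]
  induction t generalizing e with
  | zero => simp [WrongPath, pathCount, hwrong]
  | succ t ih =>
    have h1 : ∀ y, ind (WrongPath σ y x (t + 1) e) ≤
        ∑ f, ind (Step otherSocket checkNode σ e f) *
          (ind (y e.1 ≠ x e.1) * ind (WrongPath σ y x t f)) := by
      intro y
      refine ind_le_sum (fun f _ => mul_nonneg (ind_nonneg _)
        (mul_nonneg (ind_nonneg _) (ind_nonneg _))) ?_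
      rintro ⟨hy, f, hf, hf'⟩
      refine ⟨f, mem_univ f, ?_⟩
      rw [ind_of hy, ind_of hf, ind_of hf']; norm_num
    refine (channelExp_mono x hp hp1 h1).trans ?_
    rw [channelExp_sum, pathCount, mul_sum]
    refine sum_le_sum fun f _ => ?_
    rw [channelExp_const_mul]
    by_cases hf : Step otherSocket checkNode σ e f
    · rw [ind_of hf, one_mul, one_mul, channelExp_mul x (s := {e.1}) (t := nbhd σ t f), hwrong]
      · refine (mul_le_mul_of_nonneg_left (ih f (h.2 f hf)) hp).trans (le_of_eq (by ring))
      · exact dependsOn_ind fun y y' hyy => by rw [hyy e.1 rfl]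
      · exact dependsOn_ind (wrongPath_dependsOn σ t f)
      · exact Set.disjoint_singleton_left.2 fun h' => h.1 (nbhd_subset_checkNbhd σ hf h')
    · rw [ind_of_not hf, zero_mul, zero_mul, mul_zero]

/-- All the wrong symbols are equally likely to be on the list of a check-node message. -/
lemma prob_mem_checkMsg_le (hdv : ∀ i, dv i = 2) (hdc : ∀ j, dc j ≤ 3) (hp : 0 ≤ p) (hp1 : p ≤ 1)
    (hx : x ∈ ldpcCode σ w) (t : ℕ) (e : Sockets dv) {a : F} (ha : a ≠ x e.1) :
    channelExp p x (fun y => ind (a ∈ (checkMsg σ w y t e).symbols)) ≤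
      (listBound t : ℝ) ^ 2 / (Fintype.card F - 1) := by
  have h2 := two_le_card_field (F := F)
  have hsymm : ∀ b, b ≠ x e.1 →
      channelExp p x (fun y => ind (b ∈ (checkMsg σ w y t e).symbols)) =
      channelExp p x (fun y => ind (a ∈ (checkMsg σ w y t e).symbols)) := by
    intro b hb
    -- The ratio of the deviations of `b` and `a` from the centre is the factor that carries `a` to
    -- `b`.
    obtain ⟨u, hu, rfl⟩ : ∃ u : F, u ≠ 0 ∧ dilate u (x e.1) a = b := by
      have ha' : a - x e.1 ≠ 0 := sub_ne_zero.2 ha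
      refine ⟨(b - x e.1) / (a - x e.1), div_ne_zero (sub_ne_zero.2 hb) ha', ?_⟩
      simp only [dilate]; field_simp; ring
    rw [← channelExp_dilate x hu]
    congr 1
    ext1 y
    rw [checkMsg_dilate σ w y hdv hx hu, Msg.symbols_map]
    exact ind_congr <| List.mem_map_of_injective (dilate_injective hu _)
  -- The expected number of wrong symbols on the list is at most the list bound, and it is shared
  -- equally by `q - 1` symbols.
  have hsum : ∑ b ∈ univ.erase (x e.1),
      channelExp p x (fun y => ind (b ∈ (checkMsg σ w y t e).symbols)) ≤
      (listBound t : ℝ) ^ 2 := by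
    rw [← channelExp_sum]
    refine (channelExp_mono x hp hp1 (g := fun _ => (listBound t : ℝ) ^ 2) fun y => ?_).trans
      (le_of_eq (channelExp_const x _))
    calc _ ≤ ∑ b, ind (b ∈ (checkMsg σ w y t e).symbols) :=
          sum_le_sum_of_subset_of_nonneg (subset_univ _) fun _ _ _ => ind_nonneg _
      _ ≤ ((checkMsg σ w y t e).symbols.toFinset.card : ℝ) :=
          sum_ind_le_card _ fun b hb => List.mem_toFinset.2 hb
      _ ≤ ((checkMsg σ w y t e).symbols.length : ℝ) := by
          exact_mod_cast List.toFinset_card_le _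
      _ ≤ _ := by exact_mod_cast length_checkMsg_le σ w y hdv hdc t e
  rw [sum_congr rfl fun b hb => hsymm b (ne_of_mem_erase hb), sum_const,
    card_erase_of_mem (mem_univ _), card_univ, nsmul_eq_mul, Nat.cast_sub Fintype.card_pos] at hsum
  rw [le_div_iff₀ (by linarith)]
  push_cast at hsum
  linarith

/-- The received symbol is independent of the list, so one may sum over its wrong values and apply
`prob_mem_checkMsg_le` to each. -/
lemma prob_received_clash_le (hdv : ∀ i, dv i = 2) (hdc : ∀ j, dc j ≤ 3) (hp : 0 ≤ p)
    (hp1 : p ≤ 1) (hx : x ∈ ldpcCode σ w) (t : ℕ) (e : Sockets dv)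
    (h : e.1 ∉ checkNbhd σ t e) :
    channelExp p x (fun y => ind (y e.1 ∈ (checkMsg σ w y t e).symbols ∧ y e.1 ≠ x e.1)) ≤
      (listBound t : ℝ) ^ 2 / (Fintype.card F - 1) := by
  have h2 := two_le_card_field (F := F)
  have hc : 0 ≤ (listBound t : ℝ) ^ 2 / (Fintype.card F - 1) :=
    div_nonneg (by positivity) (by linarith)
  have h1 : ∀ y : Fin n → F, ind (y e.1 ∈ (checkMsg σ w y t e).symbols ∧ y e.1 ≠ x e.1) ≤
      ∑ a, ind (y e.1 = a ∧ a ≠ x e.1) * ind (a ∈ (checkMsg σ w y t e).symbols) := by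
    intro y
    refine ind_le_sum (fun a _ => mul_nonneg (ind_nonneg _) (ind_nonneg _)) ?_
    rintro ⟨hy, hy'⟩
    exact ⟨y e.1, mem_univ _, by rw [ind_of ⟨rfl, hy'⟩, ind_of hy, one_mul]⟩
  refine (channelExp_mono x hp hp1 h1).trans ?_
  rw [channelExp_sum]
  have h3 : ∀ a, channelExp p x (fun y => ind (y e.1 = a ∧ a ≠ x e.1) *
      ind (a ∈ (checkMsg σ w y t e).symbols)) ≤
      channelExp p x (fun y => ind (y e.1 = a ∧ a ≠ x e.1)) *
        ((listBound t : ℝ) ^ 2 / (Fintype.card F - 1)) := by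
    intro a
    rw [channelExp_mul x (s := {e.1}) (t := checkNbhd σ t e)]
    · by_cases ha : a = x e.1
      · have : channelExp p x (fun y => ind (y e.1 = a ∧ a ≠ x e.1)) = 0 := by
          rw [← channelExp_const (p := p) x 0]
          congr 1; ext y; exact ind_of_not fun h => h.2 ha
        rw [this, zero_mul, zero_mul]
      · exact mul_le_mul_of_nonneg_left (prob_mem_checkMsg_le σ w hdv hdc hp hp1 hx t e ha)
          (channelExp_nonneg x hp hp1 fun _ => ind_nonneg _)
    · exact dependsOn_ind fun y y' hyy => by rw [hyy e.1 rfl]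
    · refine dependsOn_ind fun y y' hyy => ?_
      have := checkMsg_dependsOn σ w hdv t e hyy
      simp only at this
      rw [this]
    · exact Set.disjoint_singleton_left.2 h
  refine (sum_le_sum fun a _ => h3 a).trans ?_
  rw [← sum_mul, ← channelExp_sum]
  refine mul_le_of_le_one_left hc ?_
  refine (channelExp_mono x hp hp1 (g := fun _ => 1) fun y => ?_).trans
    (le_of_eq (channelExp_const x _))
  calc _ ≤ ∑ a, ind (a = y e.1) := sum_le_sum fun a _ => ind_mono fun h => h.1.symm
    _ ≤ 1 := (sum_ind_le_card {y e.1} (by simp)).trans (by simp)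

/-- A union bound over one possible clash at the node itself and at most two subtrees; this is the
recursion of `clashBound`. -/
lemma prob_clash_le (hdv : ∀ i, dv i = 2) (hdc : ∀ j, dc j ≤ 3) (hp : 0 ≤ p)
    (hp1 : p ≤ 1) (hx : x ∈ ldpcCode σ w) (t : ℕ) (e : Sockets dv) (h : Acyclic σ t e) :
    channelExp p x (fun y => ind (¬NoClash σ w y x t e)) ≤
      clashBound t / (Fintype.card F - 1) := by
  have h2 := two_le_card_field (F := F)
  induction t generalizing e with
  | zero =>
    refine (channelExp_mono x hp hp1 (g := fun _ => 0) fun y => ?_).trans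
      (le_of_eq ((channelExp_const x _).trans (by simp [clashBound])))
    exact (ind_of_not fun h => h trivial).le
  | succ t ih =>
    have h1 : ∀ y, ind (¬NoClash σ w y x (t + 1) e) ≤
        ind (y (otherSocket e).1 ∈ (checkMsg σ w y t (otherSocket e)).symbols ∧
          y (otherSocket e).1 ≠ x (otherSocket e).1) +
        ∑ f, ind (Step otherSocket checkNode σ e f) * ind (¬NoClash σ w y x t f) := by
      intro y
      refine (ind_le_add (R := ∃ f, Step otherSocket checkNode σ e f ∧
        ¬NoClash σ w y x t f) fun h => ?_).trans (add_le_add_right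
          (ind_le_sum (fun f _ => mul_nonneg (ind_nonneg _) (ind_nonneg _)) ?_) _)
      · rw [NoClash, not_and_or] at h
        push Not at h
        exact h
      · rintro ⟨f, hf, hf'⟩
        exact ⟨f, mem_univ f, by rw [ind_of hf, ind_of hf', one_mul]⟩
    refine (channelExp_mono x hp hp1 h1).trans ?_
    rw [channelExp_add, channelExp_sum, clashBound, add_div]
    refine add_le_add (prob_received_clash_le σ w hdv hdc hp hp1 hx t (otherSocket e) h.1) ?_
    have h3 : ∀ f, channelExp p x (fun y => ind (Step otherSocket checkNode σ e f) *
        ind (¬NoClash σ w y x t f)) ≤ ind (Step otherSocket checkNode σ e f) *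
          (clashBound t / (Fintype.card F - 1)) := by
      intro f
      rw [channelExp_const_mul]
      by_cases hf : Step otherSocket checkNode σ e f
      · exact mul_le_mul_of_nonneg_left (ih f (h.2 f hf)) (ind_nonneg _)
      · rw [ind_of_not hf, zero_mul, zero_mul]
    refine (sum_le_sum fun f _ => h3 f).trans ?_
    rw [← sum_mul, mul_div_assoc]
    refine mul_le_mul_of_nonneg_right ?_ (div_nonneg (clashBound_nonneg t) (by linarith))
    exact sum_sibling_le hdc σ (otherSocket e)

/-- The two lists are independent, so the estimate for a single wrong symbol is squared, and then
summed over `q - 1` symbols. -/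
lemma prob_common_le (hdv : ∀ i, dv i = 2) (hdc : ∀ j, dc j ≤ 3) (hp : 0 ≤ p)
    (hp1 : p ≤ 1) (hx : x ∈ ldpcCode σ w) (t : ℕ) (e : Sockets dv)
    (h : Disjoint (checkNbhd σ t e) (checkNbhd σ t (otherSocket e))) :
    channelExp p x (fun y => ind (∃ z, z ∈ (checkMsg σ w y t e).symbols ∧
      z ∈ (checkMsg σ w y t (otherSocket e)).symbols ∧ z ≠ x e.1)) ≤
      (listBound t : ℝ) ^ 4 / (Fintype.card F - 1) := by
  have h2 := two_le_card_field (F := F)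
  have h1 : ∀ y : Fin n → F, ind (∃ z, z ∈ (checkMsg σ w y t e).symbols ∧
      z ∈ (checkMsg σ w y t (otherSocket e)).symbols ∧ z ≠ x e.1) ≤
      ∑ z ∈ univ.erase (x e.1), ind (z ∈ (checkMsg σ w y t e).symbols) *
        ind (z ∈ (checkMsg σ w y t (otherSocket e)).symbols) := by
    intro y
    refine ind_le_sum (fun a _ => mul_nonneg (ind_nonneg _) (ind_nonneg _)) ?_
    rintro ⟨z, hz, hz', hzx⟩
    exact ⟨z, mem_erase.2 ⟨hzx, mem_univ z⟩, by rw [ind_of hz, ind_of hz', one_mul]⟩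
  refine (channelExp_mono x hp hp1 h1).trans ?_
  rw [channelExp_sum]
  have hdep : ∀ (e : Sockets dv) (z : F), DependsOn
      (fun y => ind (z ∈ (checkMsg σ w y t e).symbols)) (checkNbhd σ t e) := fun e z =>
    dependsOn_ind fun y y' hyy => by
      have := checkMsg_dependsOn σ w hdv t e hyy
      simp only at this
      rw [this]
  have h3 : ∀ z ∈ univ.erase (x e.1), channelExp p x (fun y =>
      ind (z ∈ (checkMsg σ w y t e).symbols) *
        ind (z ∈ (checkMsg σ w y t (otherSocket e)).symbols)) ≤
      (listBound t : ℝ) ^ 2 / (Fintype.card F - 1) *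
        ((listBound t : ℝ) ^ 2 / (Fintype.card F - 1)) := by
    intro z hz
    rw [channelExp_mul x (hdep e z) (hdep (otherSocket e) z) h]
    exact mul_le_mul (prob_mem_checkMsg_le σ w hdv hdc hp hp1 hx t e (ne_of_mem_erase hz))
      (prob_mem_checkMsg_le σ w hdv hdc hp hp1 hx t (otherSocket e) (ne_of_mem_erase hz))
      (channelExp_nonneg x hp hp1 fun _ => ind_nonneg _)
      (div_nonneg (by positivity) (by linarith))
  refine (sum_le_sum h3).trans (le_of_eq ?_)
  rw [sum_const, card_erase_of_mem (mem_univ _), card_univ, nsmul_eq_mul,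
    Nat.cast_sub Fintype.card_pos]
  push_cast
  field_simp [show (Fintype.card F : ℝ) - 1 ≠ 0 by linarith]

/-- The neighbourhood of the variable node `i` is tree-like, as far as the decoder is concerned. -/
def TreeLike (σ : Wiring dv dc) (l : ℕ) (i : Fin n) : Prop :=
  ∀ e : Sockets dv, e.1 = i → i ∉ checkNbhd σ l e ∧
    (∀ f, Sibling σ e f → Acyclic σ l f) ∧
    Disjoint (checkNbhd σ l e) (checkNbhd σ l (otherSocket e))

/-- A bound for `q - 1` times the probability that clashes spoil the decoding of a symbol. -/
def spoilBound (l : ℕ) : ℝ := 4 * clashBound l + 2 * (listBound l : ℝ) ^ 2 + (listBound l : ℝ) ^ 4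

/-- By `lmpDecode_correct` an error needs a wrong path or a clash beyond one of at most four
neighbouring sockets, a clash of the received symbol with one of two lists, or a common wrong
symbol; hence the coefficients 4, 2, 1 in `spoilBound`. The walks start at `otherSocket` so that
their first step leads to the siblings of the given edge. -/
lemma prob_error_le (hdv : ∀ i, dv i = 2) (hdc : ∀ j, dc j ≤ 3) (hp : 0 ≤ p) (hp1 : p ≤ 1)
    (hx : x ∈ ldpcCode σ w) (l : ℕ) (i : Fin n) (h : TreeLike σ l i) :
    channelExp p x (fun y => ind ((lmpDecode σ w l y).val i ≠ some (x i))) ≤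
      p ^ (l + 1) * ∑ k : Fin (dv i), pathCount σ (l + 1) (otherSocket ⟨i, k⟩) +
        spoilBound l / (Fintype.card F - 1) := by
  have h2 := two_le_card_field (F := F)
  have hspoil := div_nonneg (clashBound_nonneg l) (show (0 : ℝ) ≤ Fintype.card F - 1 by linarith)
  have h1 : ∀ y : Fin n → F, ind ((lmpDecode σ w l y).val i ≠ some (x i)) ≤
      ((∑ k : Fin (dv i), ∑ f, ind (Sibling σ ⟨i, k⟩ f) * ind (WrongPath σ y x l f)) +
      (∑ k : Fin (dv i), ∑ f, ind (Sibling σ ⟨i, k⟩ f) * ind (¬NoClash σ w y x l f))) +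
      ((∑ k : Fin (dv i), ind (y i ∈ (checkMsg σ w y l ⟨i, k⟩).symbols ∧ y i ≠ x i)) +
      ind (∃ z, z ∈ (checkMsg σ w y l (firstSocket hdv i)).symbols ∧
        z ∈ (checkMsg σ w y l (otherSocket (firstSocket hdv i))).symbols ∧
        z ≠ x (firstSocket hdv i).1)) := by
    intro y
    have hsum : ∀ P : Sockets dv → Prop, ind (∃ k : Fin (dv i), ∃ f, Sibling σ ⟨i, k⟩ f ∧ P f) ≤
        ∑ k : Fin (dv i), ∑ f, ind (Sibling σ ⟨i, k⟩ f) * ind (P f) := by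
      intro P
      refine ind_le_sum (fun k _ => sum_nonneg fun f _ =>
        mul_nonneg (ind_nonneg _) (ind_nonneg _)) ?_
      rintro ⟨k, f, hf, hf'⟩
      refine ⟨k, mem_univ k, ?_⟩
      refine le_trans ?_ (single_le_sum (fun f _ => mul_nonneg (ind_nonneg _) (ind_nonneg _))
        (mem_univ f))
      rw [ind_of hf, ind_of hf', one_mul]
    refine (ind_le_add
      (Q := (∃ k : Fin (dv i), ∃ f, Sibling σ ⟨i, k⟩ f ∧ WrongPath σ y x l f) ∨
        (∃ k : Fin (dv i), ∃ f, Sibling σ ⟨i, k⟩ f ∧ ¬NoClash σ w y x l f))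
      (R := (∃ k : Fin (dv i), y i ∈ (checkMsg σ w y l ⟨i, k⟩).symbols ∧ y i ≠ x i) ∨
        (∃ z, z ∈ (checkMsg σ w y l (firstSocket hdv i)).symbols ∧
        z ∈ (checkMsg σ w y l (otherSocket (firstSocket hdv i))).symbols ∧
        z ≠ x (firstSocket hdv i).1)) fun herr => ?_).trans
      (add_le_add ((ind_le_add id).trans (add_le_add (hsum _) (hsum _)))
        ((ind_le_add id).trans (add_le_add_left
          (ind_le_sum (fun k _ => ind_nonneg _) ?_) _)))
    · by_contra! hc
      refine herr (lmpDecode_correct σ w y hdv hx l i ?_ ?_ ?_ ?_)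
      · rintro ⟨_, k⟩ f rfl hf; exact hc.1.2 k f hf
      · rintro ⟨_, k⟩ f rfl hf; exact hc.1.1 k f hf
      · rintro ⟨_, k⟩ rfl hy; exact hc.2.1 k hy
      · exact hc.2.2
    · rintro ⟨k, hk⟩
      exact ⟨k, mem_univ k, by rw [ind_of hk]⟩
  refine (channelExp_mono x hp hp1 h1).trans ?_
  rw [channelExp_add, channelExp_add, channelExp_add, channelExp_sum, channelExp_sum,
    channelExp_sum]
  have hA : ∑ k : Fin (dv i), channelExp p x (fun y => ∑ f, ind (Sibling σ ⟨i, k⟩ f) *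
      ind (WrongPath σ y x l f)) ≤
      p ^ (l + 1) * ∑ k : Fin (dv i), pathCount σ (l + 1) (otherSocket ⟨i, k⟩) := by
    rw [mul_sum]
    refine sum_le_sum fun k _ => ?_
    rw [channelExp_sum, pathCount, mul_sum]
    refine sum_le_sum fun f _ => ?_
    rw [channelExp_const_mul, step_iff, otherSocket_otherSocket]
    by_cases hf : Sibling σ ⟨i, k⟩ f
    · rw [ind_of hf, one_mul, one_mul]
      exact prob_wrongPath_le σ hp hp1 l f ((h ⟨i, k⟩ rfl).2.1 f hf)
    · rw [ind_of_not hf, zero_mul, zero_mul, mul_zero]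
  have hB : ∑ k : Fin (dv i), channelExp p x (fun y => ∑ f, ind (Sibling σ ⟨i, k⟩ f) *
      ind (¬NoClash σ w y x l f)) ≤ 4 * (clashBound l / (Fintype.card F - 1)) := by
    calc _ ≤ ∑ k : Fin (dv i), 2 * (clashBound l / (Fintype.card F - 1)) := by
          refine sum_le_sum fun k _ => ?_
          rw [channelExp_sum]
          refine le_trans (sum_le_sum (g := fun f => ind (Sibling σ ⟨i, k⟩ f) *
            (clashBound l / (Fintype.card F - 1))) fun f _ => ?_) ?_
          · rw [channelExp_const_mul]
            by_cases hf : Sibling σ ⟨i, k⟩ f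
            · exact mul_le_mul_of_nonneg_left
                (prob_clash_le σ w hdv hdc hp hp1 hx l f ((h ⟨i, k⟩ rfl).2.1 f hf)) (ind_nonneg _)
            · rw [ind_of_not hf, zero_mul, zero_mul]
          · rw [← sum_mul]
            exact mul_le_mul_of_nonneg_right (sum_sibling_le hdc σ ⟨i, k⟩) hspoil
      _ = _ := by rw [sum_const, card_univ, Fintype.card_fin, hdv]; simp; ring
  have hC : ∑ k : Fin (dv i), channelExp p x (fun y =>
      ind (y i ∈ (checkMsg σ w y l ⟨i, k⟩).symbols ∧ y i ≠ x i)) ≤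
      2 * ((listBound l : ℝ) ^ 2 / (Fintype.card F - 1)) := by
    calc _ ≤ ∑ k : Fin (dv i), (listBound l : ℝ) ^ 2 / (Fintype.card F - 1) :=
          sum_le_sum fun k _ => prob_received_clash_le σ w hdv hdc hp hp1 hx l ⟨i, k⟩
            (h ⟨i, k⟩ rfl).1
      _ = _ := by rw [sum_const, card_univ, Fintype.card_fin, hdv]; simp
  have hD := prob_common_le σ w hdv hdc hp hp1 hx l (firstSocket hdv i)
    (h (firstSocket hdv i) rfl).2.2
  rw [spoilBound, add_div, add_div, mul_div_assoc, mul_div_assoc]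
  linarith

/-- Steps are moved one at a time from `pathCount`, which recurses from the start of a walk, to the
list, which begins with its end. -/
lemma sum_pathCount (s t : ℕ) :
    ∑ e, ∑ l ∈ listsOfLength (Sockets dv) t,
      ind (IsWalk otherSocket checkNode σ (e :: l)) * pathCount σ s e =
    walkCount otherSocket checkNode σ (t + s) := by
  induction s generalizing t with
  | zero => simp [pathCount, walkCount]
  | succ s ih =>
    rw [show t + (s + 1) = t + 1 + s by ring, ← ih (t + 1)]
    simp_rw [sum_listsOfLength_succ, pathCount, mul_sum, isWalk_cons_cons]
    rw [sum_comm (s := (univ : Finset (Sockets dv))) (t := (univ : Finset (Sockets dv)))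
      (f := fun f e => ∑ l ∈ listsOfLength (Sockets dv) t, _)]
    refine sum_congr rfl fun e _ => ?_
    rw [sum_comm]
    refine sum_congr rfl fun f _ => sum_congr rfl fun l _ => ?_
    rw [ind_and]; ring

/-- The symbol error rate is bounded in terms of the numbers of exceptional variable nodes and of
walks. -/
lemma symbolErrorRate_le (hdv : ∀ i, dv i = 2) (hdc : ∀ j, dc j ≤ 3) (hp : 0 ≤ p) (hp1 : p ≤ 1)
    (hx : x ∈ ldpcCode σ w) (l : ℕ) (hn : 0 < n) :
    symbolErrorRate p σ w l x ≤ (∑ i, ind (¬TreeLike σ l i)) / n +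
      p ^ (l + 1) * walkCount otherSocket checkNode σ (l + 1) / n +
      spoilBound l / (Fintype.card F - 1) := by
  have h2 := two_le_card_field (F := F)
  have hn' : (0 : ℝ) < n := by exact_mod_cast hn
  have hspoil : 0 ≤ spoilBound l / (Fintype.card F - 1) := by
    refine div_nonneg ?_ (by linarith)
    have := clashBound_nonneg l
    rw [spoilBound]; positivity
  have hpath : ∀ t e, 0 ≤ pathCount σ t e := by
    intro t
    induction t with
    | zero => intro e; exact zero_le_one
    | succ t ih => intro e; exact sum_nonneg fun f _ => mul_nonneg (ind_nonneg _) (ih f)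
  have h1 : symbolErrorRate p σ w l x =
      (∑ i, channelExp p x fun y => ind ((lmpDecode σ w l y).val i ≠ some (x i))) / n := by
    rw [← channelExp_sum, symbolErrorRate, channelExp, sum_div]
    refine sum_congr rfl fun y _ => ?_
    rw [sum_ind_eq_card, mul_div_assoc]
  have hi : ∀ i, channelExp p x (fun y => ind ((lmpDecode σ w l y).val i ≠ some (x i))) ≤
      ind (¬TreeLike σ l i) +
      p ^ (l + 1) * ∑ k : Fin (dv i), pathCount σ (l + 1) (otherSocket ⟨i, k⟩) +
        spoilBound l / (Fintype.card F - 1) := by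
    intro i
    by_cases hT : TreeLike σ l i
    · rw [ind_of_not (not_not.2 hT), zero_add]
      exact prob_error_le σ w hdv hdc hp hp1 hx l i hT
    · rw [ind_of hT]
      have h3 : channelExp p x (fun y => ind ((lmpDecode σ w l y).val i ≠ some (x i))) ≤ 1 :=
        (channelExp_mono x hp hp1 fun y => ind_le_one _).trans (le_of_eq (channelExp_const x 1))
      have h4 : 0 ≤ p ^ (l + 1) *
          ∑ k : Fin (dv i), pathCount σ (l + 1) (otherSocket ⟨i, k⟩) :=
        mul_nonneg (by positivity) (sum_nonneg fun k _ => hpath _ _)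
      linarith
  have hw : ∑ i, ∑ k : Fin (dv i), pathCount σ (l + 1) (otherSocket ⟨i, k⟩) =
      walkCount otherSocket checkNode σ (l + 1) := by
    rw [← Fintype.sum_sigma' fun i k => pathCount σ (l + 1) (otherSocket ⟨i, k⟩)]
    let E : Sockets dv ≃ Sockets dv :=
      ⟨otherSocket, otherSocket, otherSocket_otherSocket, otherSocket_otherSocket⟩
    have h3 := sum_pathCount σ (l + 1) 0
    rw [zero_add] at h3
    rw [← h3, ← Equiv.sum_comp E]
    refine sum_congr rfl fun e _ => ?_
    simp [listsOfLength, ind_of (isWalk_singleton _), E, otherSocket]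
  rw [h1]
  calc _ ≤ (∑ i, (ind (¬TreeLike σ l i) +
      p ^ (l + 1) * ∑ k : Fin (dv i), pathCount σ (l + 1) (otherSocket ⟨i, k⟩) +
        spoilBound l / (Fintype.card F - 1))) / n := by
        gcongr with i; exact hi i
    _ = _ := by
        rw [sum_add_distrib, sum_add_distrib, ← mul_sum, hw, sum_const, card_univ,
          Fintype.card_fin, nsmul_eq_mul]
        field_simp

end SymbolError

/-! ### Most neighbourhoods are tree-like -/

section TreeLikeCount

open Finset

variable {n m : ℕ} {dv : Fin n → ℕ} {dc : Fin m → ℕ} {σ : Wiring dv dc}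

/-- Dependence on a node is witnessed by prolonging a given walk; keeping the walk so far allows a
collision to be detected on the combined walk. -/
lemma exists_walk_of_mem_nbhd {t : ℕ} {e : Sockets dv} {l : List (Sockets dv)} {v : Fin n}
    (hw : IsWalk otherSocket checkNode σ (e :: l)) (hv : v ∈ nbhd σ t e) :
    ∃ u f r, u ++ e :: l = f :: r ∧ IsWalk otherSocket checkNode σ (f :: r) ∧ f.1 = v ∧
      u.length ≤ t := by
  induction t generalizing e l with
  | zero => exact ⟨[], e, l, rfl, hw, hv.symm, le_rfl⟩
  | succ t ih =>
    rcases hv with rfl | ⟨g, hg, hv⟩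
    · exact ⟨[], e, l, rfl, hw, rfl, Nat.zero_le _⟩
    · obtain ⟨u, f, r, h1, h2, h3, h4⟩ := ih (isWalk_cons_cons.2 ⟨hg, hw⟩) hv
      exact ⟨u ++ [g], f, r, by simpa using h1, h2, h3, by simpa using h4⟩

lemma exists_walk_of_mem_checkNbhd {t : ℕ} {e : Sockets dv} {l : List (Sockets dv)} {v : Fin n}
    (hw : IsWalk otherSocket checkNode σ (e :: l)) (hv : v ∈ checkNbhd σ t (otherSocket e)) :
    ∃ f u, f.1 = v ∧ IsWalk otherSocket checkNode σ (f :: u ++ e :: l) ∧ u.length ≤ t := by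
  obtain ⟨g, hg, hv⟩ := hv
  obtain ⟨u, f, r, h1, h2, h3, h4⟩ := exists_walk_of_mem_nbhd (isWalk_cons_cons.2 ⟨hg, hw⟩) hv
  cases u with
  | nil =>
    rw [List.nil_append, List.cons.injEq] at h1
    obtain ⟨rfl, rfl⟩ := h1
    exact ⟨g, [], h3, h2, Nat.zero_le _⟩
  | cons a u =>
    rw [List.cons_append, List.cons.injEq] at h1
    obtain ⟨rfl, rfl⟩ := h1
    refine ⟨a, u ++ [g], h3, by simpa using h2, by simpa using h4⟩

/-- All the walks of at most `K` sockets through the variable node `i` are without collisions. -/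
def NoCollisionAt (σ : Wiring dv dc) (K : ℕ) (i : Fin n) : Prop :=
  ∀ w, IsWalk otherSocket checkNode σ w → w.length ≤ K → (∃ s ∈ w, s.1 = i) →
    NoCollision otherSocket checkNode σ w

/-- A variable node has only two sockets, so coming back to it means meeting `f` or `otherSocket f`
again. -/
lemma walk_fst_ne (hdv : ∀ i, dv i = 2) {f s : Sockets dv} {r : List (Sockets dv)}
    (hw : IsWalk otherSocket checkNode σ (f :: r))
    (hc : NoCollision otherSocket checkNode σ (f :: r)) (hs : s ∈ r) : s.1 ≠ f.1 := by
  intro h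
  rcases eq_or_eq_otherSocket hdv h with rfl | rfl
  · exact hw.notMem_of_noCollision hc.2 hs
  · exact hw.opp_notMem_of_noCollision otherSocket_otherSocket (otherSocket_ne hdv) hc.2
      (List.mem_cons_of_mem _ hs)

lemma notMem_checkNbhd (hdv : ∀ i, dv i = 2) {K : ℕ} {i : Fin n} (h : NoCollisionAt σ K i)
    {t : ℕ} {e : Sockets dv} {l : List (Sockets dv)}
    (hw : IsWalk otherSocket checkNode σ (e :: l)) (hi : ∃ s ∈ e :: l, s.1 = i)
    (hK : l.length + t + 2 ≤ K) : e.1 ∉ checkNbhd σ t (otherSocket e) := by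
  intro hv
  obtain ⟨f, u, hf, hfw, hu⟩ := exists_walk_of_mem_checkNbhd hw hv
  have hc := h _ hfw (by simp; omega) (by
    obtain ⟨s, hs, hsi⟩ := hi
    exact ⟨s, by simp at hs ⊢; tauto, hsi⟩)
  exact walk_fst_ne hdv hfw hc (s := e) (by simp) hf.symm

lemma acyclic_of_noCollisionAt (hdv : ∀ i, dv i = 2) {K : ℕ} {i : Fin n}
    (h : NoCollisionAt σ K i) {t : ℕ} {e : Sockets dv} {l : List (Sockets dv)}
    (hw : IsWalk otherSocket checkNode σ (e :: l)) (hi : ∃ s ∈ e :: l, s.1 = i)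
    (hK : l.length + t + 1 ≤ K) : Acyclic σ t e := by
  induction t generalizing e l with
  | zero => trivial
  | succ t ih =>
    refine ⟨notMem_checkNbhd hdv h hw hi (by omega), fun f hf => ?_⟩
    refine ih (isWalk_cons_cons.2 ⟨hf, hw⟩) ?_ (by simp; omega)
    obtain ⟨s, hs, hsi⟩ := hi
    exact ⟨s, List.mem_cons_of_mem _ hs, hsi⟩

lemma treeLike_of_noCollisionAt (hdv : ∀ i, dv i = 2) {l : ℕ} {i : Fin n}
    (h : NoCollisionAt σ (2 * l + 3) i) : TreeLike σ l i := by
  rintro e rfl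
  have hw : ∀ e : Sockets dv, IsWalk otherSocket checkNode σ [e] := isWalk_singleton
  refine ⟨?_, fun f hf => ?_, Set.disjoint_left.2 fun v hv hv' => ?_⟩
  · have := notMem_checkNbhd hdv h (t := l) (hw (otherSocket e)) ⟨otherSocket e, by simp, rfl⟩
      (by simp; omega)
    rwa [otherSocket_otherSocket] at this
  · refine acyclic_of_noCollisionAt hdv h (l := [otherSocket e])
      (isWalk_cons_cons.2 ⟨?_, hw _⟩) ⟨otherSocket e, by simp, rfl⟩ (by simp; omega)
    rw [step_iff, otherSocket_otherSocket]
    exact hf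
  -- A node seen from both sides is the end of two walks that leave through the two sockets.
  -- Reversing one of them and appending the other gives a walk of at most `2 * l + 3` sockets whose
  -- two ends lie at the same node.
  · rw [← otherSocket_otherSocket e] at hv
    obtain ⟨f₁, u₁, hf₁, hw₁, hu₁⟩ := exists_walk_of_mem_checkNbhd (hw (otherSocket e)) hv
    obtain ⟨f₂, u₂, hf₂, hw₂, hu₂⟩ := exists_walk_of_mem_checkNbhd (hw e) hv'
    have hrev := hw₁.reverse otherSocket_otherSocket
    have hlist : ((f₁ :: u₁ ++ [otherSocket e]).reverse.map otherSocket) =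
        e :: ((f₁ :: u₁).reverse.map otherSocket) := by
      simp [otherSocket_otherSocket]
    rw [hlist] at hrev
    have hwalk : IsWalk otherSocket checkNode σ
        (f₂ :: (u₂ ++ e :: ((f₁ :: u₁).reverse.map otherSocket))) :=
      List.isChain_split.2 ⟨hw₂, hrev⟩
    have hc := h _ hwalk (by simp; omega) ⟨e, by simp, rfl⟩
    refine walk_fst_ne hdv hwalk hc (s := otherSocket f₁) (by simp) ?_
    rw [otherSocket_fst, hf₁, hf₂]

/-- Each exceptional node is charged to a colliding walk through it, and a walk of `t` steps passes
through at most `t + 1` nodes. -/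
lemma sum_not_treeLike_le (hdv : ∀ i, dv i = 2) (l : ℕ) :
    ∑ i, ind (¬TreeLike σ l i) ≤
      ∑ t ∈ range (2 * l + 3), (t + 1 : ℝ) * badCount otherSocket checkNode σ t := by
  have h1 : ∀ i, ind (¬TreeLike σ l i) ≤ ∑ t ∈ range (2 * l + 3), ∑ e,
      ∑ r ∈ listsOfLength (Sockets dv) t, ind (IsWalk otherSocket checkNode σ (e :: r) ∧
        ¬NoCollision otherSocket checkNode σ (e :: r)) * ind (∃ s ∈ e :: r, s.1 = i) := by
    intro i
    have hnn : ∀ (e : Sockets dv) (r : List (Sockets dv)),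
        0 ≤ ind (IsWalk otherSocket checkNode σ (e :: r) ∧
        ¬NoCollision otherSocket checkNode σ (e :: r)) * ind (∃ s ∈ e :: r, s.1 = i) :=
      fun e r => mul_nonneg (ind_nonneg _) (ind_nonneg _)
    refine ind_le_sum (fun t _ => sum_nonneg fun e _ => sum_nonneg fun r _ => hnn e r) fun hT => ?_
    have h2 : ¬NoCollisionAt σ (2 * l + 3) i := fun h => hT (treeLike_of_noCollisionAt hdv h)
    rw [NoCollisionAt] at h2
    push Not at h2
    obtain ⟨w, hw, hlen, hi, hc⟩ := h2
    cases w with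
    | nil => simp at hi
    | cons e r =>
      refine ⟨r.length, mem_range.2 (by simpa [Nat.lt_iff_add_one_le] using hlen), ?_⟩
      refine le_trans ?_ (single_le_sum (f := fun e => ∑ r ∈ listsOfLength (Sockets dv) r.length,
        ind (IsWalk otherSocket checkNode σ (e :: r) ∧
        ¬NoCollision otherSocket checkNode σ (e :: r)) * ind (∃ s ∈ e :: r, s.1 = i))
        (fun e _ => sum_nonneg fun r _ => hnn e r) (mem_univ e))
      refine le_trans ?_ (single_le_sum (fun r _ => hnn e r) ((mem_listsOfLength _ r).2 rfl))
      rw [ind_of ⟨hw, hc⟩, ind_of hi, one_mul]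
  have h2 : ∀ w : List (Sockets dv), ∑ i, ind (∃ s ∈ w, s.1 = i) ≤ w.length := by
    intro w
    refine (sum_ind_le_card (w.map Sigma.fst).toFinset fun i hi => ?_).trans ?_
    · obtain ⟨s, hs, rfl⟩ := hi
      exact List.mem_toFinset.2 (List.mem_map_of_mem hs)
    · have := List.toFinset_card_le (w.map Sigma.fst)
      rw [List.length_map] at this
      exact_mod_cast this
  refine (sum_le_sum fun i _ => h1 i).trans ?_
  rw [sum_comm]
  refine sum_le_sum fun t _ => ?_
  rw [sum_comm, badCount, mul_sum]
  refine sum_le_sum fun e _ => ?_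
  rw [sum_comm, mul_sum]
  refine sum_le_sum fun r hr => ?_
  rw [← mul_sum, mul_comm]
  refine mul_le_mul_of_nonneg_right ((h2 _).trans (le_of_eq ?_)) (ind_nonneg _)
  rw [mem_listsOfLength] at hr
  rw [List.length_cons, hr]; push_cast; ring

end TreeLikeCount

/-! ### Realizations of the degree distributions -/

section Realization

open Finset

lemma coeff_checkDist (ε : ℝ) (k : ℕ) :
    (checkDist ε).coeff k = if k = 1 then 1 - ε else if k = 2 then ε else 0 := by
  rw [checkDist, coeff_add, coeff_C_mul, coeff_C_mul, coeff_X, coeff_X_pow]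
  rcases eq_or_ne k 1 with rfl | h1
  · simp
  · rcases eq_or_ne k 2 with rfl | h2
    · simp
    · simp [h1, h2, h1.symm]

/-! ### Design rate, threshold and existence of the ensemble -/

lemma designRate_eq (ε : ℝ) : designRate varDist (checkDist ε) = ε / 3 := by
  have h1 : ∫ x in (0 : ℝ)..1, (checkDist ε).eval x = (1 - ε) / 2 + ε / 3 := by
    simp only [checkDist, eval_add, eval_mul, eval_C, eval_X, eval_pow]
    rw [intervalIntegral.integral_add (Continuous.intervalIntegrable (by fun_prop) _ _)
      (Continuous.intervalIntegrable (by fun_prop) _ _), intervalIntegral.integral_const_mul,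
      intervalIntegral.integral_const_mul, integral_id, integral_pow]
    norm_num
    ring
  have h2 : ∫ x in (0 : ℝ)..1, (varDist).eval x = 1 / 2 := by
    simp [varDist]
  rw [designRate, h1, h2]
  ring

/-- After division by `x` the condition reads `p * (1 + ε - ε * x) < 1` and is tightest as `x` tends
to 0. Since 0 itself is excluded, the endpoint `1 / (1 + ε)` satisfies it. -/
lemma lmpThreshold_eq {ε : ℝ} (hε : 0 < ε) :
    lmpThreshold varDist (checkDist ε) = 1 / (1 + ε) := by
  have hset : {p : ℝ | p ∈ Set.Ioc (0 : ℝ) 1 ∧ ∀ x ∈ Set.Ioc (0 : ℝ) 1,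
      p * varDist.eval (1 - (checkDist ε).eval (1 - x)) < x} = Set.Ioc 0 (1 / (1 + ε)) := by
    have h1 : ∀ x, varDist.eval (1 - (checkDist ε).eval (1 - x)) = x * (1 + ε - ε * x) := by
      intro x
      simp only [varDist, checkDist, eval_add, eval_mul, eval_C, eval_X, eval_pow]
      ring
    ext p
    simp only [Set.mem_ofPred_eq, h1, Set.mem_Ioc]
    rw [le_div_iff₀ (by linarith)]
    constructor
    · rintro ⟨⟨hp, hp1⟩, h⟩
      refine ⟨hp, ?_⟩
      by_contra! hc
      -- At any `x` not exceeding this quotient one has `p * (1 + ε - ε * x) ≥ 1`.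
      have hx0 : 0 < min 1 ((p * (1 + ε) - 1) / (p * ε)) :=
        lt_min one_pos (div_pos (by linarith) (by positivity))
      have h2 := h _ ⟨hx0, min_le_left _ _⟩
      have h3 := min_le_right 1 ((p * (1 + ε) - 1) / (p * ε))
      rw [le_div_iff₀ (by positivity)] at h3
      nlinarith
    · rintro ⟨hp, h⟩
      refine ⟨⟨hp, by nlinarith⟩, fun x ⟨hx, hx1⟩ => ?_⟩
      have h2 : 0 < p * ε * x := by positivity
      nlinarith
  rw [lmpThreshold, hset, csSup_Ioc (by positivity)]

/-- With `3 * s` variable nodes there are `6 * s` edges, of which `2 * k` cubic check nodes use `6 *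
k` and `3 * (s - k)` check nodes of degree two use the rest. Rounding `k = ⌊ε * s⌋` costs at most `1
/ s` in the fractions. -/
lemma exists_realization {ε : ℝ} (hε : 0 < ε) (hε1 : ε ≤ 1) {τ : ℝ} (hτ : 0 < τ) (N : ℕ) :
    ∃ n ≥ N, ∃ (m : ℕ) (dv : Fin n → ℕ) (dc : Fin m → ℕ),
      IsRealization varDist (checkDist ε) τ dv dc := by
  obtain ⟨M, hM⟩ := exists_nat_gt (1 / τ)
  have hM0 : (0 : ℝ) < M := lt_trans (by positivity) hM
  set s : ℕ := N + M with hs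
  have hs0 : (0 : ℝ) < s := by rw [hs]; push_cast; positivity
  set k : ℕ := ⌊ε * s⌋₊ with hk
  have hk1 : (k : ℝ) ≤ ε * s := Nat.floor_le (by positivity)
  have hk2 : ε * s < k + 1 := Nat.lt_floor_add_one _
  have hks : k ≤ s := by
    have : (k : ℝ) ≤ s := hk1.trans (by nlinarith)
    exact_mod_cast this
  -- For `ε = 1` check nodes of degree two are forbidden, so here the rounding must be exact.
  have hεk : ε = 1 → k = s := by rintro rfl; rw [hk, one_mul, Nat.floor_natCast]
  set dc : Fin (2 * k + 3 * (s - k)) → ℕ := fun j => if (j : ℕ) < 2 * k then 3 else 2 with hdc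
  have hcard3 : (univ.filter fun j => dc j = 3).card = 2 * k := by
    have : (univ.filter fun j => dc j = 3) =
        univ.filter fun j : Fin (2 * k + 3 * (s - k)) => (j : ℕ) < 2 * k := by
      ext j; simp only [hdc, mem_filter, mem_univ, true_and]; split_ifs <;> simp_all
    rw [this, Fin.card_filter_val_lt]; omega
  have hcard2 : (univ.filter fun j => dc j = 2).card = 3 * (s - k) := by
    have h1 : (univ.filter fun j => dc j = 2) = univ.filter fun j => ¬dc j = 3 := by
      ext j; simp only [hdc, mem_filter, mem_univ, true_and]; split_ifs <;> simp_all
    have h2 := card_filter_add_card_filter_not (s := univ) fun j => dc j = 3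
    rw [← h1, hcard3, card_univ, Fintype.card_fin] at h2
    omega
  have hdc23 : ∀ j, dc j = 2 ∨ dc j = 3 := fun j => by
    simp only [hdc]; split_ifs <;> simp
  have hsum : ∑ j, dc j = 2 * (3 * s) := by
    have : ∀ j, dc j = 3 * (if dc j = 3 then 1 else 0) + 2 * (if dc j = 2 then 1 else 0) :=
      fun j => by rcases hdc23 j with h | h <;> simp [h]
    rw [sum_congr rfl fun j _ => this j, sum_add_distrib, ← mul_sum, ← mul_sum, ← card_filter,
      ← card_filter, hcard3, hcard2]
    omega
  refine ⟨3 * s, by omega, 2 * k + 3 * (s - k), fun _ => 2, dc, ?_, ?_, ?_, ?_, ?_⟩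
  · exact fun _ => ⟨1, rfl, by simp [varDist]⟩
  · intro j
    by_cases hj : (j : ℕ) < 2 * k
    · exact ⟨2, by simp [hdc, hj], by rw [coeff_checkDist]; simp [hε.ne']⟩
    · refine ⟨1, by simp [hdc, hj], ?_⟩
      rw [coeff_checkDist, if_pos rfl, sub_ne_zero]
      intro h1
      have := hεk h1.symm
      have := j.isLt
      omega
  · rw [hsum]; simp [mul_comm]
  · intro i
    have h1 : edgeFraction (fun _ : Fin (3 * s) => 2) (i + 1) = varDist.coeff i := by
      rw [edgeFraction, varDist, coeff_X]
      rcases eq_or_ne i 1 with rfl | hi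
      · simp [hs0.ne', mul_comm]
      · simp [hi.symm, show ¬(2 = i + 1) by omega]
    rw [h1, sub_self, abs_zero]; exact hτ.le
  · have h3 : |(k : ℝ) / s - ε| ≤ τ := by
      have h4 : (k : ℝ) / s - ε = (k - ε * s) / s := by field_simp
      rw [h4, abs_div, abs_of_pos hs0, div_le_iff₀ hs0, abs_sub_comm,
        abs_of_nonneg (by linarith)]
      have h5 : 1 < M * τ := by rwa [div_lt_iff₀ hτ] at hM
      have h6 : (M : ℝ) ≤ s := by rw [hs]; push_cast; linarith [N.cast_nonneg (α := ℝ)]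
      nlinarith
    intro i
    rw [coeff_checkDist, edgeFraction, hsum]
    rcases eq_or_ne i 1 with rfl | hi1
    · have h4 : ((((1 + 1) * (univ.filter fun j => dc j = 1 + 1).card : ℕ) : ℝ) /
          ((2 * (3 * s) : ℕ) : ℝ)) = 1 - k / s := by
        rw [show 1 + 1 = 2 from rfl, hcard2]
        push_cast [Nat.cast_sub hks]
        field_simp
      rw [h4, if_pos rfl, show 1 - (k : ℝ) / s - (1 - ε) = -(k / s - ε) by ring, abs_neg]
      exact h3
    · rcases eq_or_ne i 2 with rfl | hi2
      · have h4 : ((((2 + 1) * (univ.filter fun j => dc j = 2 + 1).card : ℕ) : ℝ) /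
            ((2 * (3 * s) : ℕ) : ℝ)) = k / s := by
          rw [show 2 + 1 = 3 from rfl, hcard3]
          push_cast
          field_simp
        rw [h4, if_neg hi1, if_pos rfl]
        exact h3
      · have h4 : (univ.filter fun j => dc j = i + 1) = ∅ := by
          refine filter_eq_empty_iff.2 fun j _ h => ?_
          rcases hdc23 j with h' | h' <;> omega
        rw [h4, if_neg hi1, if_neg hi2]
        simpa using hτ.le

/-! ### Edge counts, branching factor and rate of a realization -/

variable {n m : ℕ} {dv : Fin n → ℕ} {dc : Fin m → ℕ} {ε τ : ℝ}

lemma IsRealization.var_eq_two (h : IsRealization varDist (checkDist ε) τ dv dc) (i : Fin n) :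
    dv i = 2 := by
  obtain ⟨k, hk, hk'⟩ := h.var_deg i
  rw [varDist, coeff_X] at hk'
  split_ifs at hk' with h1
  · omega
  · exact absurd rfl hk'

lemma IsRealization.check_eq (h : IsRealization varDist (checkDist ε) τ dv dc) (j : Fin m) :
    dc j = 2 ∨ dc j = 3 := by
  obtain ⟨k, hk, hk'⟩ := h.check_deg j
  rw [coeff_checkDist] at hk'
  split_ifs at hk' with h1 h2
  · omega
  · omega
  · exact absurd rfl hk'

lemma IsRealization.check_le (h : IsRealization varDist (checkDist ε) τ dv dc) (j : Fin m) :
    dc j ≤ 3 := by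
  have := h.check_eq j
  omega

/-- The number of check nodes of degree three. -/
def cubicCount (dc : Fin m → ℕ) : ℕ := (univ.filter fun j => dc j = 3).card

lemma IsRealization.sum_check (h : IsRealization varDist (checkDist ε) τ dv dc) :
    ∑ j, dc j = 2 * n := by
  rw [← h.edges_eq]
  simp [h.var_eq_two, mul_comm]

lemma IsRealization.sum_check_fn (h : IsRealization varDist (checkDist ε) τ dv dc) (g : ℕ → ℝ) :
    ∑ j, g (dc j) = g 2 * m + (g 3 - g 2) * cubicCount dc := by
  have : ∀ j, g (dc j) = g 2 + (g 3 - g 2) * ind (dc j = 3) := fun j => by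
    rcases h.check_eq j with h | h <;> simp [h, ind]
  simp_rw [this]
  rw [sum_add_distrib, ← mul_sum, sum_ind_eq_card, sum_const, card_univ, Fintype.card_fin,
    nsmul_eq_mul, cubicCount]
  ring

lemma IsRealization.two_mul_checks (h : IsRealization varDist (checkDist ε) τ dv dc) :
    2 * (m : ℝ) + cubicCount dc = 2 * n := by
  have h1 := h.sum_check_fn fun k => (k : ℝ)
  have h2 : ∑ j, (dc j : ℝ) = 2 * n := by exact_mod_cast h.sum_check
  rw [h2] at h1
  push_cast at h1
  linarith

lemma IsRealization.cubicCount_bounds (h : IsRealization varDist (checkDist ε) τ dv dc)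
    (hn : 0 < n) : 2 * n * (ε - τ) ≤ 3 * cubicCount dc ∧
      3 * (cubicCount dc : ℝ) ≤ 2 * n * (ε + τ) := by
  have hn' : (0 : ℝ) < n := by exact_mod_cast hn
  have h1 := h.check_frac 2
  rw [edgeFraction, coeff_checkDist, h.sum_check] at h1
  change |(((3 * cubicCount dc : ℕ) : ℝ) / ((2 * n : ℕ) : ℝ)) - _| ≤ τ at h1
  push_cast at h1
  rw [abs_le] at h1
  have h2 : (3 * (cubicCount dc : ℝ)) / (2 * n) * (2 * n) = 3 * cubicCount dc := by
    field_simp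
  norm_num at h1
  rw [← h2]
  constructor <;> nlinarith

/-- The average number of siblings is the branching factor of the walks: `ρ'(1) = 1 + ε`, up to the
tolerance. -/
lemma IsRealization.sum_siblings_le (h : IsRealization varDist (checkDist ε) τ dv dc)
    (hn : 0 < n) : ∑ c : Sockets dc, siblings checkNode c ≤ 2 * n * (1 + ε + τ) := by
  calc _ ≤ ∑ c : Sockets dc, ((dc c.1 : ℝ) - 1) := sum_le_sum fun c _ => siblings_le_sub_one c
    _ = ∑ j, (dc j : ℝ) * ((dc j : ℝ) - 1) := by
        rw [Fintype.sum_sigma]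
        refine sum_congr rfl fun j _ => ?_
        change ∑ _k : Fin (dc j), ((dc j : ℝ) - 1) = _
        rw [sum_const, card_univ, Fintype.card_fin, nsmul_eq_mul]
    _ = 2 * n + 3 * cubicCount dc := by
        rw [h.sum_check_fn fun k => (k : ℝ) * ((k : ℝ) - 1), ← h.two_mul_checks]
        push_cast; ring
    _ ≤ _ := by linarith [(h.cubicCount_bounds hn).2]

/-- The code contains the kernel of `m` linear forms, which need not be independent. By
`two_mul_checks` the bound equals the number of cubic check nodes divided by `2 * n`. -/
lemma codeRate_ge {F : Type} [Field F] (σ : Wiring dv dc) (w : Sockets dv → Fˣ) (hn : 0 < n) :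
    1 - (m : ℝ) / n ≤ codeRate (ldpcCode σ w) := by
  have hn' : (0 : ℝ) < n := by exact_mod_cast hn
  let H : (Fin n → F) →ₗ[F] (Fin m → F) := LinearMap.pi fun j => ∑ k : Fin (dc j),
    (w (σ.symm ⟨j, k⟩) : F) • LinearMap.proj (R := F) (σ.symm ⟨j, k⟩).1
  have hker : LinearMap.ker H ≤ ldpcCode σ w := by
    intro x hx j
    have := congrFun (LinearMap.mem_ker.1 hx) j
    simpa [H, LinearMap.sum_apply] using this
  have h1 := LinearMap.finrank_range_add_finrank_ker H
  have h2 := Submodule.finrank_le (LinearMap.range H)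
  have h3 := Submodule.finrank_mono hker
  rw [Module.finrank_fin_fun] at h1 h2
  have h4 : (n : ℝ) ≤ m + Module.finrank F (ldpcCode σ w) := by
    exact_mod_cast (by omega : n ≤ m + Module.finrank F (ldpcCode σ w))
  rw [codeRate, sub_le_iff_le_add, ← add_div, le_div_iff₀ hn', one_mul]
  linarith

end Realization

/-! ### Typical wirings -/

section Typical

open Finset

variable {n m : ℕ} {dv : Fin n → ℕ} {dc : Fin m → ℕ}

/-- A bound for the expected number of variable nodes without a tree-like neighbourhood. -/
noncomputable def exceptionBound (l : ℕ) : ℝ :=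
  ∑ t ∈ range (2 * l + 3), (t + 1 : ℝ) * badBound 2 t

lemma wiring_card_pos (hdeg : ∑ i, dv i = ∑ j, dc j) : 0 < Fintype.card (Wiring dv dc) := by
  have hST : Fintype.card (Sockets dv) = Fintype.card (Sockets dc) := by simpa using hdeg
  have : Nonempty (Wiring dv dc) := ⟨Fintype.equivOfCardEq hST⟩
  exact Fintype.card_pos

variable (hdv : ∀ i, dv i = 2) (hdc : ∀ j, dc j ≤ 3) (hdeg : ∑ i, dv i = ∑ j, dc j)
include hdv hdc hdeg

/-- The expected number of exceptional nodes is bounded independently of `n`. Walks of up to `K = 2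
* l + 3` sockets are involved, and `4 * l + 7` is `2 * K + 1`. -/
lemma total_not_treeLike_le (l : ℕ) (hn : 4 * l + 7 ≤ n) :
    ∑ σ : Wiring dv dc, ∑ i, ind (¬TreeLike σ l i) ≤
      exceptionBound l * Fintype.card (Wiring dv dc) := by
  have hn' : (4 * l + 7 : ℝ) ≤ n := by exact_mod_cast hn
  have hST : Fintype.card (Sockets dv) = Fintype.card (Sockets dc) := by simpa using hdeg
  calc _ ≤ ∑ σ : Wiring dv dc, ∑ t ∈ range (2 * l + 3), (t + 1 : ℝ) *
        badCount otherSocket checkNode σ t := sum_le_sum fun σ _ => sum_not_treeLike_le hdv l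
    _ = ∑ t ∈ range (2 * l + 3), (t + 1 : ℝ) *
        total (S := Sockets dv) (badCount otherSocket (checkNode (dc := dc)) · t) := by
        rw [sum_comm]; simp_rw [← mul_sum]; rfl
    _ ≤ ∑ t ∈ range (2 * l + 3), (t + 1 : ℝ) *
        (badBound 2 t * Fintype.card (Wiring dv dc)) := by
        refine sum_le_sum fun t ht => mul_le_mul_of_nonneg_left ?_ (by positivity)
        refine total_badCount_le otherSocket_otherSocket (otherSocket_ne hdv) (by norm_num)
          (siblings_le hdc) (2 * l + 3) ?_ hST t (mem_range.1 ht).le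
        rw [card_sockets hdv]; push_cast; linarith
    _ = _ := by rw [exceptionBound, sum_mul]; simp_rw [mul_assoc]

lemma average_walkCount_le {ρ : ℝ} (hρ : 0 ≤ ρ) (l : ℕ) (hn : 4 * l + 7 ≤ n)
    (h : ∑ c : Sockets dc, siblings checkNode c ≤ ρ * (2 * n - (4 * l + 7))) :
    average (fun σ : Wiring dv dc => walkCount otherSocket checkNode σ (l + 1)) ≤
      2 * n * ρ ^ (l + 1) + 2 * badBound 2 l := by
  have hn' : (4 * l + 7 : ℝ) ≤ n := by exact_mod_cast hn
  have hST : Fintype.card (Sockets dv) = Fintype.card (Sockets dc) := by simpa using hdeg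
  have hpos : (0 : ℝ) < Fintype.card (Wiring dv dc) := by
    exact_mod_cast wiring_card_pos hdeg
  rw [average, div_le_iff₀ hpos]
  have h1 := total_walkCount_le (S := Sockets dv) (κ := checkNode (dc := dc))
    otherSocket_otherSocket (otherSocket_ne hdv)
    (by norm_num : (0 : ℝ) ≤ 2) (siblings_le hdc) hρ (2 * l + 3)
    (by rw [card_sockets hdv]; push_cast; linarith) hST
    (by rw [card_sockets hdv]; push_cast; refine h.trans (le_of_eq (by ring))) l (by omega)
  rw [card_sockets hdv] at h1
  push_cast at h1
  exact h1

/-- Almost all wirings have few walks and few exceptional variable nodes. -/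
lemma card_typical_ge {ρ : ℝ} (hρ : 0 ≤ ρ) (l : ℕ) (hn : 4 * l + 7 ≤ n)
    (h : ∑ c : Sockets dc, siblings checkNode c ≤ ρ * (2 * n - (4 * l + 7)))
    {a ξ : ℝ} (ha : 0 < a) (hξ : 0 < ξ)
    (hn1 : 2 * exceptionBound l / (a * ξ) ≤ n) (hn2 : 2 * badBound 2 l / a ≤ n)
    (hn3 : 16 * (4 * ((l + 2) * 2 ^ (l + 1))) ^ 2 / (a ^ 2 * ξ) ≤ (n : ℝ)) :
    (1 - ξ) * Fintype.card (Wiring dv dc) ≤ ∑ σ : Wiring dv dc,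
      ind (∑ i, ind (¬TreeLike σ l i) < a * n ∧
        walkCount otherSocket checkNode σ (l + 1) < 2 * n * ρ ^ (l + 1) + 2 * a * n) := by
  have hn0 : (0 : ℝ) < n := by exact_mod_cast (by omega : 0 < n)
  have hcard := Nat.cast_nonneg (α := ℝ) (Fintype.card (Wiring dv dc))
  -- Markov's inequality is enough here, as the expectation is bounded and `a * n` grows.
  have h1 : (∑ σ : Wiring dv dc, ind (a * n ≤ ∑ i, ind (¬TreeLike σ l i))) ≤
      ξ / 2 * Fintype.card (Wiring dv dc) := by
    have g1 : (∑ σ : Wiring dv dc, ind (a * n ≤ ∑ i, ind (¬TreeLike σ l i))) * (a * n) ≤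
        exceptionBound l * Fintype.card (Wiring dv dc) := by
      refine le_trans ?_ (total_not_treeLike_le hdv hdc hdeg l hn)
      rw [sum_mul]
      refine sum_le_sum fun σ _ => ?_
      by_cases hσ : a * n ≤ ∑ i, ind (¬TreeLike σ l i)
      · rw [ind_of hσ, one_mul]; exact hσ
      · rw [ind_of_not hσ, zero_mul]; exact sum_nonneg fun i _ => ind_nonneg _
    rw [div_le_iff₀ (by positivity)] at hn1
    refine le_of_mul_le_mul_right (g1.trans ?_) (by positivity : 0 < a * (n : ℝ))
    have := mul_le_mul_of_nonneg_right hn1 hcard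
    linarith
  -- The number of walks is itself of order `n`, so Markov's inequality would lose a factor
  -- depending on `ξ`; Chebyshev's does not. One `a * n` absorbs the additive term of the mean, the
  -- other is the deviation.
  have h2 : (∑ σ : Wiring dv dc, ind (2 * n * ρ ^ (l + 1) + 2 * a * n ≤
      walkCount otherSocket checkNode σ (l + 1))) ≤ ξ / 2 * Fintype.card (Wiring dv dc) := by
    have hav := average_walkCount_le hdv hdc hdeg hρ l hn h
    have hdev := card_deviation_le
      (fun σ : Wiring dv dc => walkCount otherSocket checkNode σ (l + 1))
      (fun σ a b => abs_walkCount_swap_sub_le otherSocket_otherSocket (by norm_num)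
        (siblings_le hdc) (l + 1) a b) (r := a * n) (by positivity)
    rw [div_le_iff₀ ha] at hn2
    rw [div_le_iff₀ (by positivity)] at hn3
    have g1 : (∑ σ : Wiring dv dc, ind (2 * n * ρ ^ (l + 1) + 2 * a * n ≤
        walkCount otherSocket checkNode σ (l + 1))) * (a * n) ^ 2 ≤
        4 * (4 * (((l + 1 : ℕ) + 1) * 2 ^ (l + 1))) ^ 2 * Fintype.card (Sockets dv) *
          Fintype.card (Wiring dv dc) := by
      refine le_trans (mul_le_mul_of_nonneg_right (sum_le_sum fun σ _ => ind_mono fun hσ => ?_)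
        (by positivity)) hdev
      linarith
    refine le_of_mul_le_mul_right (g1.trans ?_) (by positivity : 0 < (a * (n : ℝ)) ^ 2)
    rw [card_sockets hdv]
    have g2 := mul_le_mul_of_nonneg_right hn3 (mul_nonneg hn0.le hcard)
    push_cast at g2 ⊢
    rw [show (l : ℝ) + 1 + 1 = l + 2 by ring]
    linarith
  have h3 : ∑ σ : Wiring dv dc, (1 : ℝ) ≤ ∑ σ : Wiring dv dc,
      (ind (∑ i, ind (¬TreeLike σ l i) < a * n ∧
        walkCount otherSocket checkNode σ (l + 1) < 2 * n * ρ ^ (l + 1) + 2 * a * n) +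
      (ind (a * n ≤ ∑ i, ind (¬TreeLike σ l i)) +
      ind (2 * n * ρ ^ (l + 1) + 2 * a * n ≤
        walkCount otherSocket checkNode σ (l + 1)))) := by
    refine sum_le_sum fun σ _ => ?_
    rw [← ind_of trivial]
    refine (ind_le_add (R := a * n ≤ ∑ i, ind (¬TreeLike σ l i) ∨
      2 * n * ρ ^ (l + 1) + 2 * a * n ≤ walkCount otherSocket checkNode σ (l + 1))
      fun _ => ?_).trans (add_le_add_right (ind_le_add id) _)
    by_contra! hc
    exact absurd hc.2.2 (not_lt.2 (hc.1 hc.2.1))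
  rw [sum_add_distrib, sum_add_distrib, sum_const, card_univ, nsmul_eq_mul, mul_one] at h3
  linarith

end Typical

/-! ### The main theorem -/

theorem achievesInLinearTime {ε p : ℝ} (hε : 0 < ε) (hε1 : ε ≤ 1) (hp : 0 ≤ p)
    (hpε : p * (1 + ε) < 1) : AchievesInLinearTime varDist (checkDist ε) p (ε / 3) := by
  classical
  have hp1 : p ≤ 1 := by nlinarith
  refine ⟨fun τ hτ N => exists_realization hε hε1 hτ N, fun η hη => ?_⟩
  -- The midpoint between `p * (1 + ε)` and 1 leaves room for the tolerance, which is chosen after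
  -- `l`.
  set θ : ℝ := (1 + p * (1 + ε)) / 2 with hθ
  have hθ0 : 0 ≤ θ := by positivity
  have hθ1 : θ < 1 := by linarith
  obtain ⟨l, hl⟩ := exists_pow_lt_of_lt_one (show 0 < η / 8 by positivity) hθ1
  have hl1 : θ ^ (l + 1) ≤ η / 8 := by
    rw [pow_succ]
    nlinarith [pow_nonneg hθ0 l]
  have hspoil : 0 ≤ spoilBound l := by
    have := clashBound_nonneg l
    rw [spoilBound]; positivity
  obtain ⟨q₀, hq₀⟩ := exists_nat_gt (4 * spoilBound l / η + 1)
  refine ⟨l, q₀, 2 * messageCost l + 2 * (checkCost (listBound l) + 4) +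
    (varCost (listBound l ^ 2) + 3), fun F _ _ _ hF => ⟨?_, fun ξ hξ => ?_⟩⟩
  · intro τ n m dv dc h σ w y
    exact lmpDecode_steps_le σ w y h.var_eq_two h.check_le l
  -- The first bound keeps `p * ρ ≤ θ`; the second keeps the loss of rate, at most `τ / 3`, below
  -- `ξ`.
  set τ : ℝ := min ((1 - p * (1 + ε)) / 4) ξ with hτ
  have hτ0 : 0 < τ := lt_min (by linarith) hξ
  have hτ1 : τ ≤ (1 - p * (1 + ε)) / 4 := min_le_left _ _
  have hτ2 : τ ≤ ξ := min_le_right _ _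
  -- One `τ` pays for the degree tolerance, the other for the `4 * l + 7` sockets given up in the
  -- switching.
  set ρ : ℝ := 1 + ε + 2 * τ with hρ
  have hρ0 : 0 ≤ ρ := by positivity
  have hpρ : p * ρ ≤ θ := by rw [hρ, hθ]; nlinarith
  have ha : 0 < η / 8 := by positivity
  obtain ⟨N, hN⟩ := exists_nat_ge (max (4 * l + 7 : ℝ) (max (ρ * (4 * l + 7) / (2 * τ))
    (max (2 * exceptionBound l / (η / 8 * ξ)) (max (2 * badBound 2 l / (η / 8))
      (16 * (4 * ((l + 2) * 2 ^ (l + 1))) ^ 2 / ((η / 8) ^ 2 * ξ))))))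
  refine ⟨N, τ, hτ0, fun n hn m dv dc h w => ?_⟩
  have hNn : (N : ℝ) ≤ n := by exact_mod_cast hn
  replace hN := hN.trans hNn
  simp only [max_le_iff] at hN
  obtain ⟨hn1, hn2, hn3, hn4, hn5⟩ := hN
  have hn7 : 4 * l + 7 ≤ n := by exact_mod_cast hn1
  have hn0 : 0 < n := by omega
  have hn0' : (0 : ℝ) < n := by exact_mod_cast hn0
  refine ⟨fun σ => ?_, ?_⟩
  · refine le_trans ?_ (codeRate_ge σ w hn0)
    have h1 := h.two_mul_checks
    have h2 := (h.cubicCount_bounds hn0).1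
    rw [le_sub_iff_add_le, ← le_sub_iff_add_le', div_le_iff₀ hn0']
    nlinarith
  · have hsib : ∑ c : Sockets dc, siblings checkNode c ≤ ρ * (2 * n - (4 * l + 7)) := by
      refine (h.sum_siblings_le hn0).trans ?_
      rw [div_le_iff₀ (by positivity)] at hn2
      rw [hρ] at hn2 ⊢
      linarith
    have htyp := card_typical_ge h.var_eq_two h.check_le h.edges_eq hρ0 l hn7 hsib ha hξ
      hn3 hn4 hn5
    have hpos : (0 : ℝ) < Fintype.card (Wiring dv dc) := by
      exact_mod_cast wiring_card_pos h.edges_eq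
    rw [wiringProb, le_div_iff₀ hpos, ← sum_ind_eq_card]
    refine htyp.trans (Finset.sum_le_sum fun σ _ => ind_mono ?_)
    rintro ⟨htree, hwalk⟩ x hx
    have hq : 4 * spoilBound l / η < (Fintype.card F : ℝ) - 1 := by
      have : (q₀ : ℝ) ≤ Fintype.card F := by exact_mod_cast hF
      linarith
    have hq0 : (0 : ℝ) < (Fintype.card F : ℝ) - 1 := lt_of_le_of_lt (by positivity) hq
    -- The error budget is `η / 8` for exceptional nodes, `η / 2` for wrong paths and `η / 4` for
    -- clashes.
    have e1 : (∑ i, ind (¬TreeLike σ l i)) / n < η / 8 := by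
      rw [div_lt_iff₀ hn0']; exact htree
    have e2 : p ^ (l + 1) * walkCount otherSocket checkNode σ (l + 1) / n ≤ η / 2 := by
      rw [div_le_iff₀ hn0']
      have g1 : p ^ (l + 1) ≤ 1 := pow_le_one₀ hp hp1
      have g2 : (p * ρ) ^ (l + 1) ≤ η / 8 :=
        (pow_le_pow_left₀ (by positivity) hpρ _).trans hl1
      calc _ ≤ p ^ (l + 1) * (2 * n * ρ ^ (l + 1) + 2 * (η / 8) * n) :=
            mul_le_mul_of_nonneg_left hwalk.le (by positivity)
        _ = 2 * n * (p * ρ) ^ (l + 1) + p ^ (l + 1) * (2 * (η / 8) * n) := by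
            rw [mul_pow]; ring
        _ ≤ 2 * n * (η / 8) + 1 * (2 * (η / 8) * n) := by gcongr
        _ = _ := by ring
    have e3 : spoilBound l / (Fintype.card F - 1) < η / 4 := by
      rw [div_lt_iff₀ hη] at hq
      rw [div_lt_iff₀ hq0]
      linarith
    have := symbolErrorRate_le σ w h.var_eq_two h.check_le hp hp1 hx l hn0
    linarith

theorem mainTheorem2 :
    (∀ ε : ℝ, 0 < ε → ε ≤ 1 →
      lmpThreshold varDist (checkDist ε) = 1 - ε / (1 + ε) ∧
      ε / (3 * (1 + ε)) < designRate varDist (checkDist ε) ∧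
      ∀ p : ℝ, 0 ≤ p → p < lmpThreshold varDist (checkDist ε) →
        AchievesInLinearTime varDist (checkDist ε) p (designRate varDist (checkDist ε))) ∧
    ∃ c C : ℝ, 0 < c ∧ 0 < C ∧ ∃ ε : ℝ → ℝ, ∀ δ : ℝ, 0 < δ → δ < 1 →
      0 < ε δ ∧ ε δ ≤ 1 ∧
      c * δ ≤ designRate varDist (checkDist (ε δ)) ∧
      designRate varDist (checkDist (ε δ)) ≤ C * δ ∧
      1 - δ < lmpThreshold varDist (checkDist (ε δ)) ∧
      AchievesInLinearTime varDist (checkDist (ε δ)) (1 - δ)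
        (designRate varDist (checkDist (ε δ))) := by
  -- The choice `ε = δ` works: the design rate is exactly `δ / 3`, and `(1 - δ) * (1 + δ) < 1` puts
  -- `1 - δ` below the threshold.
  refine ⟨fun ε hε hε1 => ⟨?_, ?_, fun p hp hpε => ?_⟩, 1 / 3, 1 / 3, by norm_num, by norm_num,
    fun δ => δ, fun δ hδ hδ1 => ⟨hδ, hδ1.le, ?_, ?_, ?_, ?_⟩⟩
  · rw [lmpThreshold_eq hε]
    field_simp
    ring
  · rw [designRate_eq, div_lt_div_iff₀ (by positivity) (by norm_num)]
    nlinarith [mul_pos hε hε]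
  · rw [lmpThreshold_eq hε, lt_div_iff₀ (by linarith)] at hpε
    rw [designRate_eq]
    exact achievesInLinearTime hε hε1 hp hpε
  · rw [designRate_eq]; linarith
  · rw [designRate_eq]; linarith
  · rw [lmpThreshold_eq hδ, lt_div_iff₀ (by linarith)]
    nlinarith [mul_pos hδ hδ]
  · rw [designRate_eq]
    exact achievesInLinearTime hδ hδ1.le (by linarith) (by nlinarith [mul_pos hδ hδ])
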